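/- \textbf{Definitions.} Let $\mathbf k$ be $\mathbb R$ or $\mathbb C$, with $\mathbb R\subset\mathbb C=\mathbb R^2$. A \emph{marked linkage} $\mathcal L$ is a finite loopless graph with a positive length $\ell[vw]$ on each edge $[vw]$, an ordered set $W=(w_1,\dots,w_s)$ of fixed vertices, and a (possibly empty) set of degenerate triangles $ABC$, $\ell[AC]=\ell[AB]+\ell[BC]$, designated as bars $[AC]$ with a hole $B$. For $Z\in\mathbb C^s$, $C(\mathcal L,Z)$ is the set of maps $\phi$ from the vertices to $\mathbb R^2$ with $|\phi(v)-\phi(w)|^2=\ell[vw]^2$ for all edges and $\phi(w_j)=z_j$ for all $j$. It is the set of real points of the affine scheme $\mathfrak C(\mathcal L,Z)$ given by these equations together with $\phi(B)=\frac{\ell[BC]}{\ell[AC]}\phi(A)+\frac{\ell[AB]}{\ell[AC]}\phi(C)$ for every designated bar. Let $F:\mathbf k^m\to\mathbf k^n$ and $O\in\mathbf k^m$. A marked linkage with a vector $Z$, distinct input vertices $P_1,\dots,P_m$ and distinct output vertices $Q_1,\dots,Q_n$ is \emph{functional for the germ} $(F,O)$ if: (1) the input map $p(\phi)=(\phi(P_1),\dots,\phi(P_m))$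 on $C(\mathcal L,Z)$ is a branched covering onto a set $Dom\subset\mathbf k^m$ with nonempty interior (that is, a closed continuous surjection with finite fibers which is a covering over the complement of a closed nowhere dense set with nowhere dense preimage), and it is regular: the group of scheme-theoretic automorphisms of $C(\mathcal L,Z)$ over $p$ (automorphisms of the ring of rational functions on $\mathfrak C(\mathcal L,Z)$ without poles at real points, fixing the coordinates of the inputs) acts transitively on the fibers of $p$; (2) $O\in Dom^*:=p(C^*)$, where $C^*\subset C(\mathcal L,Z)$ is the set of points at which $p:\mathfrak C(\mathcal L,Z)\to\mathbf k^m$ is a local real analytic isomorphism in the scheme-theoretic sense; (3) $(\phi(Q_1),\dots,\phi(Q_n))=F(p(\phi))$ for all $\phi\in C(\mathcal L,Z)$. \textbf{Theorem (expansion of domain).} Let $f:\mathbf k^m\to\mathbf k^n$ be a polynomial map (with components in $\mathbf k[x_1,\dots,x_m]$) and let $\mathcal L$ be a functional linkage for the germ $(f,0)$. Then for every $r>0$ the linkage $\mathcal L$ can be modified to a functional linkage for $f$ whose $Dom^*$ contains the disk $B_r(0)$: there is a linkage $\tilde{\mathcal L}$ (with $m$ inputs and $n$ outputs, and its own image of marking)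 which contains $\mathcal L$ as a sublinkage (a subgraph with the restricted lengths and designated bars among those of $\tilde{\mathcal L}$, whose fixed vertices are exactly the fixed vertices of $\tilde{\mathcal L}$ lying in it, with the same images), is functional for the germ $(f,0)$, and satisfies $$\{x\in\mathbf k^m:\ \|x\|\le r\}\subset Dom^*(\tilde{\mathcal L}),\qquad \|x\|^2=\textstyle\sum_i|x_i|^2 .$$ -/

import Mathlib

open Filter Topology

noncomputable section

namespace Linkages

/-! ### Abstract marked linkages with chosen input and output vertices -/

/-- An abstract marked linkage on the vertex set `V`: a graph without loops, a positive length for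
every edge, an ordered set `fixed` of fixed vertices (the marking), and a (possibly empty) set
`bars` of degenerate triangles `(A, B, C)`, `ℓ[AC] = ℓ[AB] + ℓ[BC]`, each of which is regarded as
one bar `[AC]` with a hole `B`.  The set `bars` does not change the set of realizations; it only
enters the scheme structure of the configuration space (see `MarkedLinkage.barPolys`). -/
structure MarkedLinkage (V : Type*) where
  graph : SimpleGraph V
  /-- Edge lengths; only the values on edges of `graph` matter. -/
  len : Sym2 V → ℝ
  len_pos : ∀ e ∈ graph.edgeSet, 0 < len e
  numFixed : ℕ
  fixed : Fin numFixed ↪ V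
  bars : Set (V × V × V)
  bars_spec : ∀ a b c, (a, b, c) ∈ bars →
    graph.Adj a b ∧ graph.Adj b c ∧ graph.Adj a c ∧ len s(a, c) = len s(a, b) + len s(b, c)

/-- A marked linkage with `m` input vertices, `n` output vertices and a choice of the image
`Z` of the marking. An output vertex may also be an input vertex or a fixed vertex. -/
structure IOLinkage (V : Type*) (m n : ℕ) extends MarkedLinkage V where
  Z : Fin numFixed → ℂ
  inp : Fin m ↪ V
  out : Fin n ↪ V

/-- The inclusion `𝕜 ⊆ ℂ` (`𝕜` is `ℝ`, the real axis, or `ℂ`). -/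
def toComplex {𝕜 : Type*} [RCLike 𝕜] (x : 𝕜) : ℂ := ⟨RCLike.re x, RCLike.im x⟩

/-- The retraction of `ℂ` onto `𝕜`: the identity if `𝕜 = ℂ`, the real part if `𝕜 = ℝ`. -/
def ofComplex (𝕜 : Type*) [RCLike 𝕜] (z : ℂ) : 𝕜 := (z.re : 𝕜) + (z.im : 𝕜) * RCLike.I

/-- Real coordinates of a map from the vertices to the plane `ℂ = ℝ²`. -/
def coords {V : Type*} (φ : V → ℂ) (c : V × Fin 2) : ℝ :=
  if c.2 = 0 then (φ c.1).re else (φ c.1).im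

namespace IOLinkage

variable {V : Type*} {m n : ℕ} (L : IOLinkage V m n)

/-- The relative configuration space `C(L, Z)`: all relative planar realizations. -/
def Config : Set (V → ℂ) :=
  {φ | (∀ v w, L.graph.Adj v w → ‖φ v - φ w‖ ^ 2 = L.len s(v, w) ^ 2) ∧
    ∀ j, φ (L.fixed j) = L.Z j}

/-! ### The configuration scheme -/

open MvPolynomial in
/-- The equations `|φ(v) - φ(w)|² = ℓ[vw]²` of the edges. -/
def edgePolys : Set (MvPolynomial (V × Fin 2) ℝ) :=
  {q | ∃ v w, L.graph.Adj v w ∧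
    q = (X (v, 0) - X (w, 0)) ^ 2 + (X (v, 1) - X (w, 1)) ^ 2 - C (L.len s(v, w) ^ 2)}

open MvPolynomial in
/-- The equations `φ(w_j) = z_j` of the marking. -/
def markPolys : Set (MvPolynomial (V × Fin 2) ℝ) :=
  {q | ∃ j, q = X (L.fixed j, 0) - C (L.Z j).re ∨ q = X (L.fixed j, 1) - C (L.Z j).im}

open MvPolynomial in
/-- For a bar `[AC]` with the hole `B`, the linear equations
`φ(B) = (ℓ[BC]/ℓ[AC]) φ(A) + (ℓ[AB]/ℓ[AC]) φ(C)`. Together with the equation of `[AC]` they imply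
the equations of `[AB]` and `[BC]`, so that the latter may be kept. -/
def barPolys : Set (MvPolynomial (V × Fin 2) ℝ) :=
  {q | ∃ a b c, (a, b, c) ∈ L.bars ∧ ∃ i : Fin 2,
    q = X (b, i) - (C (L.len s(b, c) / L.len s(a, c)) * X (a, i)
      + C (L.len s(a, b) / L.len s(a, c)) * X (c, i))}

/-- The ideal of the affine scheme `𝔠(L, Z)`. It need not be radical. -/
def ideal : Ideal (MvPolynomial (V × Fin 2) ℝ) :=
  Ideal.span (L.edgePolys ∪ L.markPolys ∪ L.barPolys)

/-- In a degenerate triangle the middle vertex is determined by the two others. -/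
theorem bar_eq {a b c : ℂ} {l k t : ℝ} (hl : 0 < l) (hk : 0 < k) (ht : t = l + k)
    (h1 : ‖a - b‖ ^ 2 = l ^ 2) (h2 : ‖b - c‖ ^ 2 = k ^ 2) (h3 : ‖a - c‖ ^ 2 = t ^ 2) :
    b.re = k / t * a.re + l / t * c.re ∧ b.im = k / t * a.im + l / t * c.im := by
  subst ht
  rw [← Complex.normSq_eq_norm_sq, Complex.normSq_apply] at h1 h2 h3
  simp only [Complex.sub_re, Complex.sub_im] at h1 h2 h3
  have hs : (k * (a.re - b.re) - l * (b.re - c.re)) ^ 2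
      + (k * (a.im - b.im) - l * (b.im - c.im)) ^ 2 = 0 := by
    linear_combination (k ^ 2 + k * l) * h1 + (l ^ 2 + k * l) * h2 - k * l * h3
  have e1 : k * (a.re - b.re) - l * (b.re - c.re) = 0 := by
    have := sq_nonneg (k * (a.im - b.im) - l * (b.im - c.im))
    have h := sq_nonneg (k * (a.re - b.re) - l * (b.re - c.re))
    exact pow_eq_zero_iff (two_ne_zero) |>.1 (by linarith)
  have e2 : k * (a.im - b.im) - l * (b.im - c.im) = 0 := by
    have := sq_nonneg (k * (a.re - b.re) - l * (b.re - c.re))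
    have h := sq_nonneg (k * (a.im - b.im) - l * (b.im - c.im))
    exact pow_eq_zero_iff (two_ne_zero) |>.1 (by linarith)
  have ht : l + k ≠ 0 := by positivity
  constructor
  · field_simp; linarith
  · field_simp; linarith

/-- `C(L, Z)` is the set of real points of the scheme `𝔠(L, Z)`. -/
theorem mem_config_iff (φ : V → ℂ) :
    φ ∈ L.Config ↔ ∀ q ∈ L.ideal, MvPolynomial.aeval (coords φ) q = 0 := by
  have key : (∀ q ∈ L.ideal, MvPolynomial.aeval (coords φ) q = 0) ↔
      ∀ q ∈ L.edgePolys ∪ L.markPolys ∪ L.barPolys, MvPolynomial.aeval (coords φ) q = 0 := by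
    constructor
    · exact fun h q hq => h q (Ideal.subset_span hq)
    · intro h q hq
      have : L.ideal ≤ RingHom.ker (MvPolynomial.aeval (coords φ) :
          MvPolynomial (V × Fin 2) ℝ →ₐ[ℝ] ℝ) := Ideal.span_le.2 fun q hq => h q hq
      exact this hq
  rw [key]
  constructor
  · rintro ⟨h1, h2⟩ q ((⟨v, w, hvw, rfl⟩ | ⟨j, rfl | rfl⟩) | ⟨a, b, c, habc, i, rfl⟩)
    · have := h1 v w hvw
      rw [← Complex.normSq_eq_norm_sq, Complex.normSq_apply] at this
      simp [coords] at this ⊢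
      linarith
    · simp [coords, h2 j]
    · simp [coords, h2 j]
    · obtain ⟨hab, hbc, hac, hl⟩ := L.bars_spec a b c habc
      have := bar_eq (L.len_pos _ hab) (L.len_pos _ hbc) hl (h1 a b hab) (h1 b c hbc) (h1 a c hac)
      fin_cases i
      · simp [coords]; linarith [this.1]
      · simp [coords]; linarith [this.2]
  · intro h
    refine ⟨fun v w hvw => ?_, fun j => ?_⟩
    · have := h _ (Or.inl (Or.inl ⟨v, w, hvw, rfl⟩))
      rw [← Complex.normSq_eq_norm_sq, Complex.normSq_apply]
      simp [coords] at this ⊢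
      linarith
    · have h1 := h _ (Or.inl (Or.inr ⟨j, Or.inl rfl⟩))
      have h2 := h _ (Or.inl (Or.inr ⟨j, Or.inr rfl⟩))
      simp [coords] at h1 h2
      exact Complex.ext (by linarith) (by linarith)

/-- The coordinate ring `ℝ[X] / I` of the scheme `𝔠(L, Z)`. -/
abbrev CoordRing : Type _ := MvPolynomial (V × Fin 2) ℝ ⧸ L.ideal

/-- The value of a function on the scheme at a real point. -/
def evalAt (φ : L.Config) : L.CoordRing →ₐ[ℝ] ℝ :=
  Ideal.Quotient.liftₐ L.ideal (MvPolynomial.aeval (coords φ.1))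
    ((L.mem_config_iff φ.1).1 φ.2)

/-- The functions on `𝔠(L, Z)` that vanish at no real point. -/
def nonvanishing : Submonoid L.CoordRing where
  carrier := {g | ∀ φ : L.Config, L.evalAt φ g ≠ 0}
  one_mem' := fun φ => by simp
  mul_mem' := fun {a b} ha hb φ => by simpa using ⟨ha φ, hb φ⟩

/-- The ring of (entire) rational functions on the scheme `𝔠(L, Z)`: quotients `g / h` of elements
of `ℝ[X] / I`, where `h` vanishes at no real point. Its maximal ideals are the points of `C(L, Z)`,
and its automorphisms are the automorphisms of `C(L, Z)` as the locally ringed space of the real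
points of the scheme, nilpotents included. -/
abbrev RatRing : Type _ := Localization L.nonvanishing

/-- The value of a rational function at a real point. -/
def evalRat (φ : L.Config) : L.RatRing →ₐ[ℝ] ℝ :=
  IsLocalization.liftAlgHom (A := ℝ) (R := L.CoordRing) (S := L.RatRing) (P := ℝ)
    (M := L.nonvanishing) (f := L.evalAt φ) (fun y => isUnit_iff_ne_zero.2 (y.2 φ))

/-- The coordinate functions of the vertices, as rational functions on the scheme. -/
def coordFun (c : V × Fin 2) : L.RatRing :=
  algebraMap L.CoordRing L.RatRing (Ideal.Quotient.mk L.ideal (MvPolynomial.X c))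

/-- The symmetry group: the scheme-theoretic automorphisms of the configuration space over the
input map, that is, those that fix the coordinate functions of all input vertices. -/
def Sym : Subgroup (L.RatRing ≃ₐ[ℝ] L.RatRing) where
  carrier := {σ | ∀ (i : Fin m) (j : Fin 2), σ (L.coordFun (L.inp i, j)) = L.coordFun (L.inp i, j)}
  one_mem' := fun _ _ => rfl
  mul_mem' := fun {a b} ha hb i j => by
    show a (b _) = _
    rw [hb i j, ha i j]
  inv_mem' := fun {a} ha i j => by
    show a.symm _ = _
    rw [AlgEquiv.symm_apply_eq, ha i j]

/-! ### The input map, its domain and its regular points -/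

/-- The input map `p`, on all maps from the vertices to the plane. On `C(L, Z)` it is the map
`φ ↦ (φ(P₁), …, φ(P_m))` as soon as the values of the latter are in `𝕜^m`. -/
def inputMap (𝕜 : Type*) [RCLike 𝕜] (φ : V → ℂ) : EuclideanSpace 𝕜 (Fin m) :=
  WithLp.toLp 2 fun i => ofComplex 𝕜 (φ (L.inp i))

/-- The domain `Dom(L, Z)`, the image of the input map. -/
def Dom (𝕜 : Type*) [RCLike 𝕜] : Set (EuclideanSpace 𝕜 (Fin m)) :=
  L.inputMap 𝕜 '' L.Config

/-- The input map as a map from `C(L, Z)` onto `Dom(L, Z)`. -/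
def toDom (𝕜 : Type*) [RCLike 𝕜] (φ : L.Config) : L.Dom 𝕜 :=
  ⟨L.inputMap 𝕜 φ.1, φ.1, φ.2, rfl⟩

/-- The germ of the function `g` at `φ` belongs to the ideal that the equations of the scheme
generate in the ring of germs of real analytic functions at `φ`. -/
def InAnalyticIdeal [Fintype V] (φ : V → ℂ) (g : (V → ℂ) → ℝ) : Prop :=
  ∃ (N : ℕ) (h : Fin N → (V → ℂ) → ℝ) (q : Fin N → MvPolynomial (V × Fin 2) ℝ),
    (∀ i, AnalyticAt ℝ (h i) φ) ∧ (∀ i, q i ∈ L.ideal) ∧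
      g =ᶠ[𝓝 φ] fun ψ => ∑ i, h i ψ * MvPolynomial.aeval (coords ψ) (q i)

/-- The input map is a local analytic isomorphism at `φ` in the scheme-theoretic sense: it induces
a bijection from the ring of germs of real analytic functions on `𝕜^m` at `p(φ)` to the
ring of germs of real analytic functions at `φ` modulo the equations of the scheme. -/
def IsRegularAt (𝕜 : Type*) [RCLike 𝕜] [Fintype V] (φ : V → ℂ) : Prop :=
  (∀ h : EuclideanSpace 𝕜 (Fin m) → ℝ, AnalyticAt ℝ h (L.inputMap 𝕜 φ) →
    L.InAnalyticIdeal φ (fun ψ => h (L.inputMap 𝕜 ψ)) → h =ᶠ[𝓝 (L.inputMap 𝕜 φ)] 0) ∧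
  (∀ g : (V → ℂ) → ℝ, AnalyticAt ℝ g φ →
    ∃ h : EuclideanSpace 𝕜 (Fin m) → ℝ, AnalyticAt ℝ h (L.inputMap 𝕜 φ) ∧
      L.InAnalyticIdeal φ (fun ψ => g ψ - h (L.inputMap 𝕜 ψ)))

/-- The set `Crit(L, Z)` of irregular points of the input map. -/
def Crit (𝕜 : Type*) [RCLike 𝕜] [Fintype V] : Set (V → ℂ) :=
  {φ | φ ∈ L.Config ∧ ¬ L.IsRegularAt 𝕜 φ}

/-- `C*(L, Z) = C(L, Z) - Crit(L, Z)`. -/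
def ConfigStar (𝕜 : Type*) [RCLike 𝕜] [Fintype V] : Set (V → ℂ) := L.Config \ L.Crit 𝕜

/-- `Dom*(L, Z) = p(C*(L, Z))`. -/
def DomStar (𝕜 : Type*) [RCLike 𝕜] [Fintype V] : Set (EuclideanSpace 𝕜 (Fin m)) :=
  L.inputMap 𝕜 '' L.ConfigStar 𝕜

end IOLinkage

/-! ### Functional linkages -/

/-- Topological branched coverings: finite closed continuous surjections that are coverings over
the complement of a closed nowhere dense set with nowhere dense preimage. -/
structure IsBranchedCovering {X Y : Type*} [TopologicalSpace X] [TopologicalSpace Y]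
    (p : X → Y) : Prop where
  continuous : Continuous p
  surjective : Function.Surjective p
  isClosedMap : IsClosedMap p
  finite_fibers : ∀ y, (p ⁻¹' {y}).Finite
  covering : ∃ B : Set Y, IsClosed B ∧ IsNowhereDense B ∧ IsNowhereDense (p ⁻¹' B) ∧
    IsCoveringMapOn p Bᶜ

/-- `L` (with the image `L.Z` of its marking) is a `𝕜`-functional linkage for the germ
`(F, O)` of the map `F : 𝕜^m → 𝕜^n`. -/
structure IOLinkage.IsFunctional (𝕜 : Type*) [RCLike 𝕜] {V : Type*} [Fintype V] {m n : ℕ}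
    (L : IOLinkage V m n) (F : EuclideanSpace 𝕜 (Fin m) → EuclideanSpace 𝕜 (Fin n))
    (O : EuclideanSpace 𝕜 (Fin m)) : Prop where
  /-- the input map `φ ↦ (φ(P₁), …, φ(P_m))` has values in `𝕜^m` -/
  input_mem : ∀ φ ∈ L.Config, ∀ i, φ (L.inp i) = toComplex (L.inputMap 𝕜 φ i)
  /-- its image is a domain: a set with nonempty interior -/
  domain : (interior (L.Dom 𝕜)).Nonempty
  /-- it is a topological branched covering of its image -/
  branched : IsBranchedCovering (L.toDom 𝕜)
  /-- this covering is regular, with scheme-theoretic covering transformations: the group of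
  scheme-theoretic automorphisms over the input map is transitive on every fiber -/
  regular : ∀ φ ψ : L.Config, L.inputMap 𝕜 φ.1 = L.inputMap 𝕜 ψ.1 →
    ∃ σ ∈ L.Sym, ∀ g : L.RatRing, L.evalRat φ (σ g) = L.evalRat ψ g
  /-- the base point is in `Dom*` -/
  base_mem : O ∈ L.DomStar 𝕜
  /-- the output map factors through the input map and induces `F` on the domain -/
  output_eq : ∀ φ ∈ L.Config, ∀ j, φ (L.out j) = toComplex (F (L.inputMap 𝕜 φ) j)

/-- `L` is a sublinkage of `L'` by means of the injection `ι` of its vertices: it is a subgraph with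
the restricted lengths (and its bars are bars of `L'`), and its marking is the intersection of
the marking of `L'` with `L`, with the same image. -/
structure IOLinkage.IsSublinkage {V V' : Type*} {m n m' n' : ℕ}
    (L : IOLinkage V m n) (L' : IOLinkage V' m' n') (ι : V ↪ V') : Prop where
  adj : ∀ v w, L.graph.Adj v w →
    L'.graph.Adj (ι v) (ι w) ∧ L'.len s(ι v, ι w) = L.len s(v, w)
  bars : ∀ a b c, (a, b, c) ∈ L.bars → (ι a, ι b, ι c) ∈ L'.bars
  fixed : ∀ v, (∃ j, L.fixed j = v) ↔ ∃ j, L'.fixed j = ι v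
  image : ∀ j j', L'.fixed j' = ι (L.fixed j) → L'.Z j' = L.Z j

/-- The polynomial map `𝕜^m → 𝕜^n` with the components `f`. -/
def polyMap {𝕜 : Type*} [RCLike 𝕜] {m n : ℕ} (f : Fin n → MvPolynomial (Fin m) 𝕜)
    (x : EuclideanSpace 𝕜 (Fin m)) : EuclideanSpace 𝕜 (Fin n) :=
  WithLp.toLp 2 fun j => MvPolynomial.eval (fun i => x i) (f j)

end Linkages

end

open Filter Topology

noncomputable section
-- Polynomials extrapolate. If the components of `f` have degree less than `N` and `t i` are `N`
-- distinct real numbers different from `1`, there are nonzero real `c i` with `∑ c i * t i ^ k = 1`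
-- for `k < N`, hence `f x = ∑ c i • f (t i • x)` for all `x` (`exists_extrapolation`,
-- `eval_eq_sum_eval_smul`). When the `t i` are small, the right side involves `f` only near `0`,
-- where the given linkage computes it. So `N` copies of the linkage receive the inputs `t i • x`,
-- and their outputs are combined linearly.
--
-- The linear operations are done by pantographs, which force `w = (1 - s) u + s v` with `0 < s <
-- 1`. A pantograph is good as long as its ends neither coincide nor reach the full length of its
-- arm. Scaling about `0` would collapse at `x = 0`; therefore `t i = τ i ^ 2`, and two scalings by
-- `τ i` about the distant points `6R` and `-6R τ i` are composed. The combination of the outputs is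
-- a chain of weighted averages that starts and ends at the same distant fixed point. The total
-- weight returns to its initial value because `∑ c i = 1` and the new output enters with the
-- coefficient `-1`. Finally an arm with the lengths `2R` and `R`, fixed at `-2R`, restricts each
-- input to `R ≤ |x_j + 2R| ≤ 3R`. This contains the disk of radius `R` about `0` and keeps
-- everything bounded.
--
-- The scheme structure is handled by two tools. A regular point is one where the scheme is, near
-- that point, the image of an analytic section of the input map (`HasSection`); congruences of
-- germs modulo the equations are preserved by analytic maps because of Hadamard's lemma. Since the
-- symmetries of the given linkage act transitively on fibers and preserve regularity, every point
-- over a small ball is regular (`IsFunctional.exists_ball`). On the other hand, a function without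
-- real zeros is a unit of `RatRing`. Nondegeneracy at the real points therefore turns the quadratic
-- equations of the pantographs into linear ones over `RatRing` itself, nilpotents included
-- (`isReduced_coordFun`).
--
-- Consequently a realization of the new linkage amounts to an input, a lift to each copy, and a
-- sign for each arm (`IsRealized.exists_build`). Away from the boundary of the domain all these
-- depend analytically on the input, so all points there are regular (`hasSection_linkage`); the
-- configuration space is compact, which gives the branched covering. Symmetries of the copies
-- together with reflections of arms act transitively on fibers (`exists_mem_sym`). The copies may
-- be moved independently because their symmetries fix the output functions near regular points
-- (`incl_out`).
namespace Linkages

/-! ### Hadamard's lemma: analytic difference quotients -/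

section Hadamard

variable {E F : Type*} [NormedAddCommGroup E] [NormedSpace ℝ E] [NormedAddCommGroup F]
  [NormedSpace ℝ F]

/-- The summands of `quotientSeries`. -/
def quotientTerm (p : FormalMultilinearSeries ℝ E F) (k : ℕ) (i : Fin (k + 1)) :
    ContinuousMultilinearMap ℝ (fun _ : Fin k => E × E) (E →L[ℝ] F) :=
  ((p (k + 1)).curryMid i).flipMultilinear.compContinuousLinearMap
    fun j => if j.castSucc < i then ContinuousLinearMap.fst ℝ E E else ContinuousLinearMap.snd ℝ E E

/-- The power series at `0` of the difference quotient of a function of two variables. -/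
def quotientSeries (p : FormalMultilinearSeries ℝ E F) :
    FormalMultilinearSeries ℝ (E × E) (E →L[ℝ] F) := fun k => ∑ i : Fin (k + 1), quotientTerm p k i

theorem quotientTerm_apply (p : FormalMultilinearSeries ℝ E F) (k : ℕ) (i : Fin (k + 1))
    (z : Fin k → E × E) (v : E) :
    quotientTerm p k i z v =
      p (k + 1) (i.insertNth v fun j => if j.castSucc < i then (z j).1 else (z j).2) := by
  show (p (k + 1)) (i.insertNth v _) = _
  congr 2
  ext j
  by_cases h : j.castSucc < i <;> simp [h]

/-- The arguments `x` are replaced by `y` one at a time and the differences telescope: in the term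
`i` the slots before `i` hold `x`, the slot `i` holds `x - y`, and the later ones hold `y`. -/
theorem quotientSeries_apply (p : FormalMultilinearSeries ℝ E F) (k : ℕ) (x y : E) :
    quotientSeries p k (fun _ => (x, y)) (x - y) =
      p (k + 1) (fun _ => x) - p (k + 1) (fun _ => y) := by
  have h := (p (k + 1)).toMultilinearMap.map_piecewise_sub_map_piecewise
    (fun _ => x) (fun _ => y) (fun _ => 0) Finset.univ
  simp only [Finset.piecewise_univ, Finset.mem_univ, if_true] at h
  simp only [quotientSeries, _root_.sum_apply]
  refine Eq.trans (Finset.sum_congr rfl fun i _ => ?_) h.symm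
  rw [quotientTerm_apply]
  show (p (k + 1)) _ = (p (k + 1)) _
  congr 1
  ext j
  refine Fin.succAboveCases i ?_ (fun j => ?_) j
  · simp
  · rw [Fin.insertNth_apply_succAbove]
    have : i.succAbove j < i ↔ j.castSucc < i := Fin.succAbove_lt_iff_castSucc_lt i j
    by_cases hj : j.castSucc < i
    · simp [hj, this]
    · simp [hj, this, Fin.succAbove_ne]

theorem norm_quotientTerm_le (p : FormalMultilinearSeries ℝ E F) (k : ℕ) (i : Fin (k + 1)) :
    ‖quotientTerm p k i‖ ≤ ‖p (k + 1)‖ := by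
  refine ContinuousMultilinearMap.opNorm_le_bound (norm_nonneg _) fun z => ?_
  refine ContinuousLinearMap.opNorm_le_bound _ (by positivity) fun v => ?_
  rw [quotientTerm_apply]
  refine ((p (k + 1)).norm_map_insertNth_le (i := i) v _).trans ?_
  rw [mul_right_comm]
  gcongr with j
  split_ifs
  · exact norm_fst_le (z j)
  · exact norm_snd_le (z j)

theorem norm_quotientSeries_le (p : FormalMultilinearSeries ℝ E F) (k : ℕ) :
    ‖quotientSeries p k‖ ≤ (k + 1) * ‖p (k + 1)‖ := by
  have h : ‖quotientSeries p k‖ ≤ ∑ i : Fin (k + 1), ‖quotientTerm p k i‖ := by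
    rw [quotientSeries]
    exact norm_sum_le (Finset.univ : Finset (Fin (k + 1))) (quotientTerm p k)
  refine h.trans ((Finset.sum_le_sum fun i _ => norm_quotientTerm_le p k i).trans_eq ?_)
  simp

theorem quotientSeries_radius_pos {p : FormalMultilinearSeries ℝ E F} (hp : 0 < p.radius) :
    0 < (quotientSeries p).radius := by
  obtain ⟨ρ, hρ0, hρ⟩ := ENNReal.lt_iff_exists_nnreal_btwn.1 hp
  have hρ0 : 0 < ρ := by exact_mod_cast hρ0
  obtain ⟨C, hC, h⟩ := p.norm_mul_pow_le_of_lt_radius hρ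
  -- The `k + 1 ≤ 2 ^ k` summands in degree `k` are absorbed by halving `ρ`; the factor `1 / ρ` in
  -- the bound pays for the shift of the degree.
  have hle : ((ρ / 2 : NNReal) : ENNReal) ≤ (quotientSeries p).radius := by
    refine FormalMultilinearSeries.le_radius_of_bound _ (C / ρ) fun k => ?_
    have h1 := norm_quotientSeries_le p k
    have h2 := h (k + 1)
    have h3 : ((k : ℝ) + 1) ≤ 2 ^ k := by exact_mod_cast Nat.lt_two_pow_self (n := k)
    have hr : (0 : ℝ) < ρ := by exact_mod_cast hρ0
    rw [NNReal.coe_div, NNReal.coe_ofNat, div_pow, le_div_iff₀ hr, ← mul_div_assoc, div_mul_eq_mul_div,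
      div_le_iff₀ (by positivity)]
    calc _ ≤ ((k + 1) * ‖p (k + 1)‖) * ρ ^ k * ρ := by gcongr
      _ = (k + 1) * (‖p (k + 1)‖ * ρ ^ (k + 1)) := by ring
      _ ≤ 2 ^ k * C := by gcongr
      _ = _ := by ring
  refine lt_of_lt_of_le ?_ hle
  exact_mod_cast half_pos hρ0

/-- **Hadamard's lemma** for analytic functions. -/
theorem exists_analytic_quotient [CompleteSpace F] {g : E → F} {φ : E} (hg : AnalyticAt ℝ g φ) :
    ∃ G : E × E → E →L[ℝ] F, AnalyticAt ℝ G (φ, φ) ∧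
      ∀ᶠ z in 𝓝 (φ, φ), g z.1 - g z.2 = G z (z.1 - z.2) := by
  obtain ⟨p, r, hp⟩ := hg
  have hq := quotientSeries_radius_pos (lt_of_lt_of_le hp.r_pos hp.r_le)
  have hG := (quotientSeries p).hasFPowerSeriesOnBall hq
  refine ⟨fun z => (quotientSeries p).sum (z - (φ, φ)), ?_, ?_⟩
  · refine AnalyticAt.fun_comp (g := (quotientSeries p).sum) ?_ (by fun_prop)
    rw [sub_self]
    exact hG.analyticAt
  · have e1 : ∀ᶠ z : E × E in 𝓝 (φ, φ), z.1 - φ ∈ Metric.eball (0 : E) r := by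
      refine ContinuousAt.eventually_mem (f := fun z : E × E => z.1 - φ) (by fun_prop) ?_
      simpa using Metric.eball_mem_nhds (0 : E) hp.r_pos
    have e2 : ∀ᶠ z : E × E in 𝓝 (φ, φ), z.2 - φ ∈ Metric.eball (0 : E) r := by
      refine ContinuousAt.eventually_mem (f := fun z : E × E => z.2 - φ) (by fun_prop) ?_
      simpa using Metric.eball_mem_nhds (0 : E) hp.r_pos
    have e3 : ∀ᶠ z : E × E in 𝓝 (φ, φ), z - (φ, φ) ∈ Metric.eball (0 : E × E) (quotientSeries p).radius := by
      refine ContinuousAt.eventually_mem (f := fun z : E × E => z - (φ, φ)) (by fun_prop) ?_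
      rw [sub_self]
      exact Metric.eball_mem_nhds (0 : E × E) hq
    filter_upwards [e1, e2, e3] with z h1 h2 h3
    have s1 := hp.hasSum h1
    have s2 := hp.hasSum h2
    have s3 := hG.hasSum h3
    have s4 := (s1.sub s2)
    -- The terms of degree `0` cancel, so the difference of the two series starts in degree `1`, in
    -- accordance with the shifted indices of `quotientSeries`.
    rw [← hasSum_nat_add_iff' 1] at s4
    have s5 := s3.mapL (ContinuousLinearMap.apply ℝ F (z.1 - z.2))
    have A : HasSum (fun k => p (k + 1) (fun _ => z.1 - φ) - p (k + 1) fun _ => z.2 - φ)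
        (g z.1 - g z.2) := by
      have h0 : (p 0 fun _ => z.1 - φ) = p 0 fun _ => z.2 - φ := by
        congr 1; ext i; exact i.elim0
      simpa [h0] using s4
    have B : HasSum (fun k => p (k + 1) (fun _ => z.1 - φ) - p (k + 1) fun _ => z.2 - φ)
        ((quotientSeries p).sum (z - (φ, φ)) (z.1 - z.2)) := by
      have : ∀ k, ContinuousLinearMap.apply ℝ F (z.1 - z.2)
          (quotientSeries p k fun _ => z - (φ, φ)) =
          p (k + 1) (fun _ => z.1 - φ) - p (k + 1) fun _ => z.2 - φ := fun k => by
        have := quotientSeries_apply p k (z.1 - φ) (z.2 - φ)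
        rw [sub_sub_sub_cancel_right] at this
        exact this
      simp only [this] at s5
      convert s5 using 1
      simp
    exact A.unique B

end Hadamard

/-! ### Real coordinates of realizations -/

section Coordinates

variable {V : Type*}

@[simp] theorem coords_zero (φ : V → ℂ) (v : V) : coords φ (v, 0) = (φ v).re := by simp [coords]

@[simp] theorem coords_one (φ : V → ℂ) (v : V) : coords φ (v, 1) = (φ v).im := by simp [coords]

theorem coords_ext {φ ψ : V → ℂ} (h : ∀ c, coords φ c = coords ψ c) : φ = ψ := by
  funext v
  exact Complex.ext (by simpa using h (v, 0)) (by simpa using h (v, 1))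

theorem coords_sub (φ ψ : V → ℂ) (c : V × Fin 2) : coords (φ - ψ) c = coords φ c - coords ψ c := by
  obtain ⟨v, i⟩ := c
  fin_cases i <;> simp

/-- A coordinate, as a continuous linear map. -/
def coordCLM [Fintype V] (c : V × Fin 2) : (V → ℂ) →L[ℝ] ℝ :=
  (if c.2 = 0 then Complex.reCLM else Complex.imCLM).comp (ContinuousLinearMap.proj c.1)

theorem coordCLM_apply [Fintype V] (c : V × Fin 2) (φ : V → ℂ) : coordCLM c φ = coords φ c := by
  simp only [coordCLM, coords]
  split_ifs <;> simp

@[fun_prop]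
theorem analyticAt_coords [Fintype V] (c : V × Fin 2) (φ : V → ℂ) :
    AnalyticAt ℝ (fun ψ => coords ψ c) φ := by
  have h : (fun ψ => coords ψ c) = coordCLM c := funext fun ψ => (coordCLM_apply c ψ).symm
  rw [h]
  exact (coordCLM c).analyticAt φ

/-- The coordinate vectors. -/
def coordVec [DecidableEq V] (c : V × Fin 2) : V → ℂ :=
  Pi.single c.1 (if c.2 = 0 then 1 else Complex.I)

theorem sum_coords_smul_coordVec [Fintype V] [DecidableEq V] (φ : V → ℂ) :
    ∑ c, coords φ c • coordVec c = φ := by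
  funext v
  rw [Fintype.sum_prod_type, Finset.sum_apply, Finset.sum_eq_single v]
  · simp [coordVec, Fin.sum_univ_two, Complex.re_add_im]
  · intro w _ hw
    simp [coordVec, hw.symm]
  · simp

@[fun_prop]
theorem analyticAt_aeval_coords [Fintype V] (q : MvPolynomial (V × Fin 2) ℝ) (φ : V → ℂ) :
    AnalyticAt ℝ (fun ψ => MvPolynomial.aeval (coords ψ) q) φ := by
  induction q using MvPolynomial.induction_on with
  | C a => simpa using analyticAt_const
  | add p q hp hq => simpa using hp.fun_add hq
  | mul_X p c hp => simpa using hp.fun_mul (analyticAt_coords c φ)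

end Coordinates

/-! ### Taylor polynomials and powers of the maximal ideal of a point -/

section Taylor

/-- The limit at `0` kills the constant coefficient; dividing by the variable, which is legitimate
in the punctured neighbourhood, then lowers the order by one. -/
theorem polynomial_coeff_eq_zero_of_isBigO (N : ℕ) (u : Polynomial ℝ)
    (h : (fun t => u.eval t) =O[𝓝[≠] 0] fun t : ℝ => t ^ N) : ∀ k < N, u.coeff k = 0 := by
  induction N generalizing u with
  | zero => simp
  | succ N ih =>
    have h0 : u.coeff 0 = 0 := by
      rw [Polynomial.coeff_zero_eq_eval_zero]
      have t1 : Tendsto (fun t => u.eval t) (𝓝[≠] 0) (𝓝 (u.eval 0)) :=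
        (u.continuous.tendsto 0).mono_left nhdsWithin_le_nhds
      have t2 : Tendsto (fun t : ℝ => t ^ (N + 1)) (𝓝[≠] 0) (𝓝 0) := by
        have : Tendsto (fun t : ℝ => t ^ (N + 1)) (𝓝 0) (𝓝 (0 ^ (N + 1))) :=
          (continuous_pow (N + 1)).tendsto 0
        simpa using this.mono_left nhdsWithin_le_nhds
      exact tendsto_nhds_unique t1 (h.trans_tendsto t2)
    obtain ⟨w, rfl⟩ := Polynomial.X_dvd_iff.2 h0
    have hw : (fun t => w.eval t) =O[𝓝[≠] 0] fun t : ℝ => t ^ N := by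
      obtain ⟨C, hC⟩ := h.bound
      refine Asymptotics.IsBigO.of_bound C ?_
      filter_upwards [hC, self_mem_nhdsWithin] with t ht ht0
      have hpos : 0 < |t| := abs_pos.2 ht0
      simp only [Polynomial.eval_mul, Polynomial.eval_X, norm_mul, norm_pow, Real.norm_eq_abs,
        pow_succ] at ht ⊢
      have : |t| * |w.eval t| ≤ |t| * (C * |t| ^ N) := by linarith
      exact le_of_mul_le_mul_left this hpos
    intro k hk
    cases k with
    | zero => exact h0
    | succ k => rw [Polynomial.coeff_X_mul]; exact ih w hw k (by omega)

theorem eval_smul_of_isHomogeneous {κ S : Type*} [CommRing S] {k : ℕ} {p : MvPolynomial κ S}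
    (hp : p.IsHomogeneous k) (t : S) (a : κ → S) :
    MvPolynomial.eval (t • a) p = t ^ k * MvPolynomial.eval a p := by
  rw [MvPolynomial.eval_eq, MvPolynomial.eval_eq, Finset.mul_sum]
  refine Finset.sum_congr rfl fun d hd => ?_
  have : ∑ i ∈ d.support, d i = k := by
    have := hp (MvPolynomial.mem_support_iff.1 hd)
    exact (DFunLike.congr_fun (Finsupp.degree_eq_weight_one (R := ℕ)) d).trans this
  simp only [Pi.smul_apply, smul_eq_mul, mul_pow, Finset.prod_mul_distrib, Finset.prod_pow_eq_pow_sum]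
  rw [← this]
  ring

open MvPolynomial in
-- On the line through `a` the coefficient of `t ^ k` is the value at `a` of the homogeneous
-- component of degree `k`. The components of degree less than `N` thus vanish as functions, hence
-- as polynomials, since `ℝ` is infinite.
theorem mem_idealOfVars_pow_of_isBigO {κ : Type*} (q : MvPolynomial κ ℝ) (N : ℕ)
    (h : ∀ a : κ → ℝ, (fun t : ℝ => aeval (t • a) q) =O[𝓝[≠] 0] fun t : ℝ => t ^ N) :
    q ∈ idealOfVars κ ℝ ^ N := by
  rw [mem_pow_idealOfVars_iff']
  suffices hk : ∀ k < N, homogeneousComponent k q = 0 by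
    intro x hx
    have := congrArg (coeff x) (hk _ hx)
    simpa [coeff_homogeneousComponent] using this
  intro k hk
  refine MvPolynomial.funext fun a => ?_
  set u : Polynomial ℝ := ∑ i ∈ Finset.range (q.totalDegree + 1),
    Polynomial.C (eval a (homogeneousComponent i q)) * Polynomial.X ^ i with hu
  have hev : ∀ t : ℝ, u.eval t = aeval (t • a) q := fun t => by
    conv_rhs => rw [← sum_homogeneousComponent q]
    rw [map_sum, hu, Polynomial.eval_finsetSum]
    refine Finset.sum_congr rfl fun i _ => ?_
    rw [Polynomial.eval_mul, Polynomial.eval_C, Polynomial.eval_pow, Polynomial.eval_X,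
      aeval_eq_eval, eval_smul_of_isHomogeneous (homogeneousComponent_isHomogeneous i q), mul_comm]
  have := polynomial_coeff_eq_zero_of_isBigO N u (by simpa only [hev] using h a) k hk
  by_cases hkd : k < q.totalDegree + 1
  · simpa [hu, Polynomial.finsetSum_coeff, Polynomial.coeff_C_mul, Polynomial.coeff_X_pow, hkd]
      using this
  · rw [homogeneousComponent_eq_zero _ _ (by omega)]

variable {V : Type*} [Fintype V]

open MvPolynomial in
-- The partial sums of the power series become polynomials after multilinear expansion in the
-- coordinate vectors.
theorem exists_taylor_polynomial {h : (V → ℂ) → ℝ} {φ : V → ℂ} (hh : AnalyticAt ℝ h φ) (N : ℕ) :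
    ∃ P : MvPolynomial (V × Fin 2) ℝ,
      (fun ψ => h ψ - aeval (coords ψ) P) =O[𝓝 φ] fun ψ => ‖ψ - φ‖ ^ N := by
  classical
  obtain ⟨p, hp⟩ := hh
  refine ⟨∑ k ∈ Finset.range N, ∑ f : Fin k → V × Fin 2,
    C (p k fun i => coordVec (f i)) * ∏ i, (X (f i) - C (coords φ (f i))), ?_⟩
  have h1 := hp.isBigO_sub_partialSum_pow N
  have h2 : Tendsto (fun ψ => ψ - φ) (𝓝 φ) (𝓝 0) := by
    have : ContinuousAt (fun ψ => ψ - φ) φ := by fun_prop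
    simpa [ContinuousAt] using this
  refine (h1.comp_tendsto h2).congr (fun ψ => ?_) fun ψ => rfl
  simp only [Function.comp, add_sub_cancel, FormalMultilinearSeries.partialSum]
  congr 1
  rw [map_sum]
  refine Finset.sum_congr rfl fun k _ => ?_
  conv_lhs => rw [← sum_coords_smul_coordVec (ψ - φ)]
  rw [ContinuousMultilinearMap.map_sum, map_sum]
  refine Finset.sum_congr rfl fun f _ => ?_
  rw [ContinuousMultilinearMap.map_smul_univ]
  simp [coords_sub, map_prod, mul_comm]

open MvPolynomial in
-- Translation of `φ` to the origin (`up`, with the inverse `dn`) reduces this to the ideal of the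
-- variables.
theorem mem_ker_pow_of_isBigO (q : MvPolynomial (V × Fin 2) ℝ) (φ : V → ℂ) (N : ℕ)
    (h : (fun ψ => aeval (coords ψ) q) =O[𝓝 φ] fun ψ => ‖ψ - φ‖ ^ N) :
    q ∈ RingHom.ker (aeval (R := ℝ) (coords φ)) ^ N := by
  classical
  set up : MvPolynomial (V × Fin 2) ℝ →ₐ[ℝ] MvPolynomial (V × Fin 2) ℝ :=
    aeval fun c => X c + C (coords φ c)
  set dn : MvPolynomial (V × Fin 2) ℝ →ₐ[ℝ] MvPolynomial (V × Fin 2) ℝ :=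
    aeval fun c => X c - C (coords φ c)
  have hud : dn (up q) = q := by
    have : dn.comp up = AlgHom.id ℝ _ := by
      ext c; simp [up, dn]
    exact DFunLike.congr_fun this q
  have h1 : up q ∈ idealOfVars (V × Fin 2) ℝ ^ N := by
    refine mem_idealOfVars_pow_of_isBigO _ _ fun a => ?_
    set w : V → ℂ := ∑ c, a c • coordVec c
    have hw : ∀ c, coords w c = a c := by
      rintro ⟨v, i⟩
      have : w v = a (v, 0) + a (v, 1) * Complex.I := by
        simp only [w]
        rw [Fintype.sum_prod_type, Finset.sum_apply, Finset.sum_eq_single v]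
        · simp [coordVec, Fin.sum_univ_two]
        · intro w _ hw
          simp [coordVec, hw.symm]
        · simp
      fin_cases i <;> simp [this]
    have h2 : Tendsto (fun t : ℝ => φ + t • w) (𝓝[≠] 0) (𝓝 φ) := by
      have : ContinuousAt (fun t : ℝ => φ + t • w) 0 := by fun_prop
      have h3 : Tendsto (fun t : ℝ => φ + t • w) (𝓝 0) (𝓝 φ) := by simpa [ContinuousAt] using this
      exact h3.mono_left nhdsWithin_le_nhds
    have h3 := h.comp_tendsto h2
    have h4 : ((fun ψ => ‖ψ - φ‖ ^ N) ∘ fun t : ℝ => φ + t • w) =O[𝓝[≠] 0] fun t : ℝ => t ^ N := by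
      refine Asymptotics.IsBigO.of_bound (‖w‖ ^ N) (Eventually.of_forall fun t => ?_)
      simp [norm_smul, mul_pow, mul_comm]
    refine (h3.trans h4).congr_left fun t => ?_
    simp only [Function.comp, up]
    have : (aeval (R := ℝ) (t • a)).comp (aeval fun c => X c + C (coords φ c)) =
        aeval (R := ℝ) (coords (φ + t • w)) := by
      ext c
      have : coords (φ + t • w) c = coords φ c + t * coords w c := by
        rw [← coordCLM_apply, map_add, map_smul, coordCLM_apply, coordCLM_apply, smul_eq_mul]
      simp [this, hw, add_comm]
    exact (DFunLike.congr_fun this q).symm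
  have h2 : Ideal.map dn.toRingHom (idealOfVars (V × Fin 2) ℝ) ≤ RingHom.ker (aeval (R := ℝ) (coords φ)) := by
    rw [idealOfVars, Ideal.map_span, Ideal.span_le]
    rintro _ ⟨_, ⟨c, rfl⟩, rfl⟩
    simp [dn, RingHom.mem_ker]
  have h3 := Ideal.mem_map_of_mem dn.toRingHom h1
  rw [Ideal.map_pow] at h3
  have h4 := Ideal.pow_right_mono h2 N h3
  rw [← hud]
  exact h4

end Taylor

/-! ### From the analytic ideal back to the algebraic one -/

namespace IOLinkage

variable {V : Type*} [Fintype V] {m n : ℕ} (L : IOLinkage V m n)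

/-- A polynomial in the analytic ideal of a real point is in the ideal of the scheme in a Zariski
neighbourhood of this point. -/
theorem exists_mul_mem_ideal {φ : V → ℂ} {q : MvPolynomial (V × Fin 2) ℝ}
    (h : L.InAnalyticIdeal φ fun ψ => MvPolynomial.aeval (coords ψ) q) :
    ∃ b : MvPolynomial (V × Fin 2) ℝ, MvPolynomial.aeval (coords φ) b ≠ 0 ∧ b * q ∈ L.ideal := by
  obtain ⟨k, a, r, ha, hr, hq⟩ := h
  set 𝔪 := RingHom.ker (MvPolynomial.aeval (R := ℝ) (coords φ)) with h𝔪
  -- Replacing the analytic coefficients by Taylor polynomials gives an element of the ideal that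
  -- differs from `q` by a polynomial of order `N` at `φ`.
  have key : ∀ N, ∃ j ∈ L.ideal, q - j ∈ 𝔪 ^ N := fun N => by
    choose P hP using fun i => exists_taylor_polynomial (ha i) N
    refine ⟨∑ i, P i * r i, Ideal.sum_mem _ fun i _ => Ideal.mul_mem_left _ _ (hr i),
      mem_ker_pow_of_isBigO _ _ _ ?_⟩
    have : (fun ψ => MvPolynomial.aeval (coords ψ) (q - ∑ i, P i * r i)) =ᶠ[𝓝 φ]
        fun ψ => ∑ i, (a i ψ - MvPolynomial.aeval (coords ψ) (P i)) *
          MvPolynomial.aeval (coords ψ) (r i) := by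
      filter_upwards [hq] with ψ hψ
      simp only [map_sub, map_sum, map_mul, sub_mul, Finset.sum_sub_distrib, hψ]
    refine Asymptotics.IsBigO.congr' ?_ this.symm EventuallyEq.rfl
    refine Asymptotics.IsBigO.fun_sum fun i _ => ?_
    have hb : (fun ψ => MvPolynomial.aeval (coords ψ) (r i)) =O[𝓝 φ] fun _ => (1 : ℝ) :=
      (analyticAt_aeval_coords (r i) φ).continuousAt.isBigO_one ℝ
    simpa using (hP i).mul hb
  have hmem : (Ideal.Quotient.mk L.ideal q) ∈
      (⨅ i : ℕ, 𝔪 ^ i • ⊤ : Submodule (MvPolynomial (V × Fin 2) ℝ) L.CoordRing) := by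
    rw [Submodule.mem_iInf]
    intro N
    obtain ⟨j, hj, hqj⟩ := key N
    have : Ideal.Quotient.mk L.ideal q = (q - j) • (1 : L.CoordRing) := by
      show Ideal.Quotient.mk L.ideal q = Ideal.Quotient.mk L.ideal ((q - j) * 1)
      rw [mul_one, ← sub_eq_zero, ← map_sub, sub_sub_cancel]
      exact Ideal.Quotient.eq_zero_iff_mem.2 hj
    rw [this]
    exact Submodule.smul_mem_smul hqj trivial
  -- Krull's intersection theorem: there is `b ∈ 𝔪` with `b q = q` modulo the ideal. So `1 - b` is
  -- the multiplier, with the value `1` at `φ`.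
  obtain ⟨⟨b, hb⟩, hbq⟩ := (Ideal.mem_iInf_smul_pow_eq_bot_iff _ _).1 hmem
  refine ⟨1 - b, ?_, ?_⟩
  · have : MvPolynomial.aeval (coords φ) b = 0 := hb
    rw [map_sub, map_one, this, sub_zero]
    exact one_ne_zero
  · rw [← Ideal.Quotient.eq_zero_iff_mem, map_mul, map_sub, sub_mul, map_one, one_mul, sub_eq_zero,
      ← map_mul]
    exact hbq.symm

end IOLinkage

theorem coords_sum_smul_coordVec {V : Type*} [Fintype V] [DecidableEq V] (a : V × Fin 2 → ℝ)
    (c : V × Fin 2) : coords (∑ c, a c • coordVec c) c = a c := by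
  obtain ⟨v, i⟩ := c
  have : (∑ c, a c • coordVec c) v = a (v, 0) + a (v, 1) * Complex.I := by
    rw [Fintype.sum_prod_type, Finset.sum_apply, Finset.sum_eq_single v]
    · simp [coordVec, Fin.sum_univ_two]
    · intro w _ hw
      simp [coordVec, hw.symm]
    · simp
  fin_cases i <;> simp [this]

/-- `ofComplex` as a linear map. -/
def ofComplexLM (𝕜 : Type*) [RCLike 𝕜] : ℂ →ₗ[ℝ] 𝕜 where
  toFun := ofComplex 𝕜
  map_add' z w := by simp [ofComplex]; ring
  map_smul' a z := by simp [ofComplex, Algebra.smul_def]; ring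

/-! ### The analytic ideal and congruences of germs -/

namespace IOLinkage

variable {V : Type*} {m n : ℕ} (L : IOLinkage V m n)

/-- The input map as a linear map. -/
def inputCLM (𝕜 : Type*) [RCLike 𝕜] [Fintype V] : (V → ℂ) →L[ℝ] EuclideanSpace 𝕜 (Fin m) :=
  LinearMap.toContinuousLinearMap
    ((WithLp.linearEquiv 2 ℝ (Fin m → 𝕜)).symm.toLinearMap ∘ₗ
      LinearMap.pi fun i => ofComplexLM 𝕜 ∘ₗ LinearMap.proj (L.inp i))

@[fun_prop]
theorem analyticAt_inputMap (𝕜 : Type*) [RCLike 𝕜] [Fintype V] (φ : V → ℂ) :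
    AnalyticAt ℝ (L.inputMap 𝕜) φ := (L.inputCLM 𝕜).analyticAt φ

@[fun_prop]
theorem continuous_inputMap (𝕜 : Type*) [RCLike 𝕜] [Fintype V] : Continuous (L.inputMap 𝕜) :=
  (L.inputCLM 𝕜).continuous

variable [Fintype V] {L} {φ : V → ℂ}

namespace InAnalyticIdeal

theorem zero : L.InAnalyticIdeal φ fun _ => 0 :=
  ⟨0, Fin.elim0, Fin.elim0, fun i => i.elim0, fun i => i.elim0, by simp⟩

theorem congr {g g' : (V → ℂ) → ℝ} (h : L.InAnalyticIdeal φ g) (hg : g' =ᶠ[𝓝 φ] g) :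
    L.InAnalyticIdeal φ g' := by
  obtain ⟨N, a, q, ha, hq, e⟩ := h
  exact ⟨N, a, q, ha, hq, hg.trans e⟩

theorem add {g g' : (V → ℂ) → ℝ} (h : L.InAnalyticIdeal φ g) (h' : L.InAnalyticIdeal φ g') :
    L.InAnalyticIdeal φ fun ψ => g ψ + g' ψ := by
  obtain ⟨N, a, q, ha, hq, e⟩ := h
  obtain ⟨N', a', q', ha', hq', e'⟩ := h'
  refine ⟨N + N', Fin.append a a', Fin.append q q', fun i => ?_, fun i => ?_, ?_⟩
  · refine Fin.addCases (fun i => ?_) (fun i => ?_) i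
    · simpa using ha i
    · simpa using ha' i
  · refine Fin.addCases (fun i => ?_) (fun i => ?_) i
    · simpa using hq i
    · simpa using hq' i
  · filter_upwards [e, e'] with ψ h h'
    simp [h, h', Fin.sum_univ_add]

theorem mul_left {g a : (V → ℂ) → ℝ} (h : L.InAnalyticIdeal φ g) (ha : AnalyticAt ℝ a φ) :
    L.InAnalyticIdeal φ fun ψ => a ψ * g ψ := by
  obtain ⟨N, b, q, hb, hq, e⟩ := h
  refine ⟨N, fun i ψ => a ψ * b i ψ, q, fun i => ha.fun_mul (hb i), hq, ?_⟩
  filter_upwards [e] with ψ h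
  simp only [h, Finset.mul_sum, mul_assoc]

theorem neg {g : (V → ℂ) → ℝ} (h : L.InAnalyticIdeal φ g) :
    L.InAnalyticIdeal φ fun ψ => - g ψ := by
  simpa using h.mul_left (a := fun _ => -1) analyticAt_const

theorem sum {ι : Type*} (s : Finset ι) {g : ι → (V → ℂ) → ℝ}
    (h : ∀ i ∈ s, L.InAnalyticIdeal φ (g i)) : L.InAnalyticIdeal φ fun ψ => ∑ i ∈ s, g i ψ := by
  classical
  induction s using Finset.induction_on with
  | empty => simpa using zero
  | insert i s hi ih =>
    simp only [Finset.sum_insert hi]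
    exact (h i (by simp)).add (ih fun j hj => h j (by simp [hj]))

theorem of_mem {q : MvPolynomial (V × Fin 2) ℝ} (hq : q ∈ L.ideal) :
    L.InAnalyticIdeal φ fun ψ => MvPolynomial.aeval (coords ψ) q :=
  ⟨1, fun _ _ => 1, fun _ => q, fun _ => analyticAt_const, fun _ => hq, by simp⟩

/-- The same coefficients represent `g` at all nearby points, so sections at one point serve at its
neighbours as well. -/
theorem eventually {g : (V → ℂ) → ℝ} (h : L.InAnalyticIdeal φ g) :
    ∀ᶠ ψ in 𝓝 φ, L.InAnalyticIdeal ψ g := by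
  obtain ⟨N, b, q, hb, hq, e⟩ := h
  have h1 : ∀ᶠ ψ in 𝓝 φ, ∀ i, AnalyticAt ℝ (b i) ψ :=
    eventually_all.2 fun i => (hb i).eventually_analyticAt
  filter_upwards [h1, e.eventually_nhds] with ψ h1 h2
  exact ⟨N, b, q, h1, hq, h2⟩

theorem eventually_eq_zero {g : (V → ℂ) → ℝ} (h : L.InAnalyticIdeal φ g) :
    ∀ᶠ ψ in 𝓝 φ, ψ ∈ L.Config → g ψ = 0 := by
  obtain ⟨N, b, q, hb, hq, e⟩ := h
  filter_upwards [e] with ψ h hψ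
  rw [h]
  exact Finset.sum_eq_zero fun i _ => by rw [(L.mem_config_iff ψ).1 hψ _ (hq i), mul_zero]

end InAnalyticIdeal

section Cong

variable {E F : Type*} [NormedAddCommGroup E] [NormedSpace ℝ E] [NormedAddCommGroup F]
  [NormedSpace ℝ F]

variable (L φ) in
/-- Two germs of vector valued functions are congruent modulo the equations of the scheme. -/
def Cong (u w : (V → ℂ) → E) : Prop :=
  ∀ l : E →L[ℝ] ℝ, L.InAnalyticIdeal φ fun ψ => l (u ψ - w ψ)

theorem cong_real_iff {u w : (V → ℂ) → ℝ} :
    L.Cong φ u w ↔ L.InAnalyticIdeal φ fun ψ => u ψ - w ψ := by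
  refine ⟨fun h => h (ContinuousLinearMap.id ℝ ℝ), fun h l => ?_⟩
  have : ∀ x : ℝ, l x = l 1 * x := fun x => by
    rw [← mul_one x, ← smul_eq_mul, map_smul, smul_eq_mul, smul_eq_mul]; ring
  exact (h.mul_left (a := fun _ => l 1) analyticAt_const).congr
    (Eventually.of_forall fun ψ => this _)

namespace Cong

theorem refl (u : (V → ℂ) → E) : L.Cong φ u u := fun l => by
  simpa using InAnalyticIdeal.zero

theorem of_eventuallyEq {u w : (V → ℂ) → E} (h : u =ᶠ[𝓝 φ] w) : L.Cong φ u w := fun l =>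
  InAnalyticIdeal.zero.congr <| by
    filter_upwards [h] with ψ hψ
    simp [hψ]

theorem symm {u w : (V → ℂ) → E} (h : L.Cong φ u w) : L.Cong φ w u := fun l =>
  (h l).neg.congr <| Eventually.of_forall fun ψ => by simp

theorem trans {u w y : (V → ℂ) → E} (h : L.Cong φ u w) (h' : L.Cong φ w y) : L.Cong φ u y :=
  fun l => ((h l).add (h' l)).congr <| Eventually.of_forall fun ψ => by
    simp only [← map_add, sub_add_sub_cancel]

theorem clm {u w : (V → ℂ) → E} (h : L.Cong φ u w) (A : E →L[ℝ] F) :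
    L.Cong φ (fun ψ => A (u ψ)) fun ψ => A (w ψ) := fun l =>
  (h (l.comp A)).congr <| Eventually.of_forall fun ψ => by simp

theorem prodMk {u w : (V → ℂ) → E} {u' w' : (V → ℂ) → F} (h : L.Cong φ u w)
    (h' : L.Cong φ u' w') : L.Cong φ (fun ψ => (u ψ, u' ψ)) fun ψ => (w ψ, w' ψ) := fun l =>
  ((h (l.comp (ContinuousLinearMap.inl ℝ E F))).add
    (h' (l.comp (ContinuousLinearMap.inr ℝ E F)))).congr <| Eventually.of_forall fun ψ => by
      simp [← map_add]

theorem pi {ι : Type*} [Fintype ι] {u w : (V → ℂ) → ι → E}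
    (h : ∀ i, L.Cong φ (fun ψ => u ψ i) fun ψ => w ψ i) : L.Cong φ u w := fun l => by
  classical
  refine (InAnalyticIdeal.sum Finset.univ fun i _ =>
    h i (l.comp (ContinuousLinearMap.single ℝ (fun _ : ι => E) i))).congr ?_
  refine Eventually.of_forall fun ψ => ?_
  simp only [ContinuousLinearMap.comp_apply, ← map_sum]
  congr 1
  ext i
  simp [Finset.sum_apply, Pi.single_apply]

theorem apply {ι : Type*} [Fintype ι] {u w : (V → ℂ) → ι → E} (h : L.Cong φ u w) (i : ι) :
    L.Cong φ (fun ψ => u ψ i) fun ψ => w ψ i :=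
  h.clm (ContinuousLinearMap.proj (R := ℝ) (φ := fun _ : ι => E) i)

theorem complex {u w : (V → ℂ) → ℂ} (h0 : L.Cong φ (fun ψ => (u ψ).re) fun ψ => (w ψ).re)
    (h1 : L.Cong φ (fun ψ => (u ψ).im) fun ψ => (w ψ).im) : L.Cong φ u w := fun l => by
  refine (((cong_real_iff.1 h0).mul_left (a := fun _ => l 1) analyticAt_const).add
    ((cong_real_iff.1 h1).mul_left (a := fun _ => l Complex.I) analyticAt_const)).congr ?_
  refine Eventually.of_forall fun ψ => ?_
  have : u ψ - w ψ = ((u ψ).re - (w ψ).re) • (1 : ℂ) + ((u ψ).im - (w ψ).im) • Complex.I := by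
    apply Complex.ext <;> simp
  simp only [this, map_add, map_smul, smul_eq_mul]
  ring

theorem of_coords {u w : (V → ℂ) → V → ℂ}
    (h : ∀ c, L.Cong φ (fun ψ => coords (u ψ) c) fun ψ => coords (w ψ) c) : L.Cong φ u w :=
  pi fun v => complex (by simpa using h (v, 0)) (by simpa using h (v, 1))

theorem eventually {u w : (V → ℂ) → E} [FiniteDimensional ℝ E] (h : L.Cong φ u w) :
    ∀ᶠ ψ in 𝓝 φ, L.Cong ψ u w := by
  let b := Module.finBasis ℝ E
  have h1 := fun i => (h (LinearMap.toContinuousLinearMap (b.coord i))).eventually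
  filter_upwards [eventually_all.2 h1] with ψ hψ l
  refine (InAnalyticIdeal.sum Finset.univ fun i _ =>
    (hψ i).mul_left (a := fun _ => l (b i)) analyticAt_const).congr ?_
  refine Eventually.of_forall fun χ => ?_
  show l (u χ - w χ) = _
  conv_lhs => rw [← b.sum_repr (u χ - w χ)]
  simp [mul_comm]

theorem eventually_eq {u w : (V → ℂ) → E} [FiniteDimensional ℝ E] (h : L.Cong φ u w) :
    ∀ᶠ ψ in 𝓝 φ, ψ ∈ L.Config → u ψ = w ψ := by
  let b := Module.finBasis ℝ E
  have h1 := fun i => (h (LinearMap.toContinuousLinearMap (b.coord i))).eventually_eq_zero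
  filter_upwards [eventually_all.2 h1] with ψ hψ hc
  rw [← sub_eq_zero, ← b.sum_repr (u ψ - w ψ)]
  refine Finset.sum_eq_zero fun i _ => ?_
  have : b.repr (u ψ - w ψ) i = 0 := hψ i hc
  rw [this, zero_smul]

/-- Analytic functions preserve congruences. -/
theorem comp [FiniteDimensional ℝ E] [CompleteSpace F] {u w : (V → ℂ) → E} (h : L.Cong φ u w)
    {f : E → F} (hf : AnalyticAt ℝ f (u φ)) (hu : AnalyticAt ℝ u φ) (hw : AnalyticAt ℝ w φ)
    (huw : u φ = w φ) : L.Cong φ (fun ψ => f (u ψ)) fun ψ => f (w ψ) := fun l => by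
  -- Since `f (u) - f (w) = G (u, w) (u - w)` with an analytic `G`, the difference is a combination,
  -- with analytic coefficients, of the coordinates of `u - w`, which are in the ideal.
  obtain ⟨G, hG, hGe⟩ := exists_analytic_quotient hf
  let b := Module.finBasis ℝ E
  have hd : AnalyticAt ℝ (fun ψ => (u ψ, w ψ)) φ := hu.prod hw
  have hGd : AnalyticAt ℝ (fun ψ => G (u ψ, w ψ)) φ :=
    AnalyticAt.fun_comp (g := G) (by simpa [← huw] using hG) hd
  have ha : ∀ i, AnalyticAt ℝ (fun ψ => l (G (u ψ, w ψ) (b i))) φ := fun i =>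
    ((l.comp (ContinuousLinearMap.apply ℝ F (b i))).analyticAt _).fun_comp hGd
  refine (InAnalyticIdeal.sum Finset.univ fun i _ =>
    (h (LinearMap.toContinuousLinearMap (b.coord i))).mul_left (ha i)).congr ?_
  have ht : Tendsto (fun ψ => (u ψ, w ψ)) (𝓝 φ) (𝓝 (u φ, u φ)) := by
    have := hd.continuousAt
    simpa only [ContinuousAt, ← huw] using this
  filter_upwards [ht.eventually hGe] with ψ hψ
  rw [show f (u ψ) - f (w ψ) = G (u ψ, w ψ) (u ψ - w ψ) from hψ]
  conv_lhs => rw [← b.sum_repr (u ψ - w ψ)]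
  simp [mul_comm]

end Cong

end Cong

end IOLinkage
-- Regular points and analytic sections
namespace IOLinkage

variable {V : Type*} {m n : ℕ} (L : IOLinkage V m n)

section Structure

variable (𝕜 : Type*) [RCLike 𝕜] [Fintype V]

/-- Near `φ` the configuration scheme is the image of an analytic section of the input map. -/
def HasSection (φ : V → ℂ) : Prop :=
  ∃ s : EuclideanSpace 𝕜 (Fin m) → V → ℂ, AnalyticAt ℝ s (L.inputMap 𝕜 φ) ∧
    s (L.inputMap 𝕜 φ) = φ ∧
    (∀ᶠ x in 𝓝 (L.inputMap 𝕜 φ), s x ∈ L.Config ∧ L.inputMap 𝕜 (s x) = x) ∧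
    L.Cong φ (fun ψ => ψ) fun ψ => s (L.inputMap 𝕜 ψ)

variable {L 𝕜} {φ : V → ℂ}

/-- Modulo the equations `g` is congruent to `g ∘ s ∘ p`, a function of the input: this is
surjectivity. A function of the input in the analytic ideal vanishes at the realizations `s x`,
whose input is `x`: this is injectivity. -/
theorem HasSection.isRegularAt (h : L.HasSection 𝕜 φ) : L.IsRegularAt 𝕜 φ := by
  obtain ⟨s, hs, hsφ, hsec, hc⟩ := h
  refine ⟨fun h _ hI => ?_, fun g hg => ?_⟩
  · have h1 := hI.eventually_eq_zero
    have h2 : Tendsto s (𝓝 (L.inputMap 𝕜 φ)) (𝓝 φ) := by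
      simpa [ContinuousAt, hsφ] using hs.continuousAt
    filter_upwards [h2.eventually h1, hsec] with x hx hx'
    simpa [hx'.2] using hx hx'.1
  · refine ⟨fun x => g (s x), AnalyticAt.fun_comp (g := g) (by rwa [hsφ]) hs, ?_⟩
    have hsp : AnalyticAt ℝ (fun ψ => s (L.inputMap 𝕜 ψ)) φ :=
      hs.fun_comp (L.analyticAt_inputMap 𝕜 φ)
    exact cong_real_iff.1 (hc.comp hg analyticAt_id hsp hsφ.symm)

/-- Surjectivity on germs expresses each coordinate by the input, which defines `s`. Injectivity
turns congruences between functions of the input into identities: the equations hold along `s`, and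
`s` is a right inverse of the input map. -/
theorem IsRegularAt.hasSection (hφ : φ ∈ L.Config) (h : L.IsRegularAt 𝕜 φ) :
    L.HasSection 𝕜 φ := by
  classical
  obtain ⟨hinj, hsurj⟩ := h
  choose t ht htc using fun c => hsurj (fun ψ => coords ψ c) (analyticAt_coords c φ)
  set s : EuclideanSpace 𝕜 (Fin m) → V → ℂ := fun x => ∑ c, t c x • coordVec c with hs
  have hcs : ∀ x c, coords (s x) c = t c x := fun x c => coords_sum_smul_coordVec _ c
  have hsa : AnalyticAt ℝ s (L.inputMap 𝕜 φ) := by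
    refine Finset.analyticAt_fun_sum _ fun c _ => ?_
    exact (ht c).fun_smul analyticAt_const
  have hsφ : s (L.inputMap 𝕜 φ) = φ := by
    refine coords_ext fun c => ?_
    have := (htc c).eventually_eq_zero.self_of_nhds hφ
    rw [hcs]
    linarith
  have hc : L.Cong φ (fun ψ => ψ) fun ψ => s (L.inputMap 𝕜 ψ) :=
    Cong.of_coords fun c => cong_real_iff.2 (by simpa only [hcs] using htc c)
  have hsp : AnalyticAt ℝ (fun ψ => s (L.inputMap 𝕜 ψ)) φ :=
    hsa.fun_comp (L.analyticAt_inputMap 𝕜 φ)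
  refine ⟨s, hsa, hsφ, ?_, hc⟩
  have h1 : ∀ᶠ x in 𝓝 (L.inputMap 𝕜 φ), s x ∈ L.Config := by
    -- Finitely many generators, so that their equations hold along `s` on a common neighbourhood.
    obtain ⟨S, hS⟩ := IsNoetherian.noetherian L.ideal
    have : ∀ q ∈ S, ∀ᶠ x in 𝓝 (L.inputMap 𝕜 φ), MvPolynomial.aeval (coords (s x)) q = 0 := by
      intro q hq
      have hq' : q ∈ L.ideal := hS ▸ Submodule.subset_span hq
      refine hinj (fun x => MvPolynomial.aeval (coords (s x)) q)
        (AnalyticAt.fun_comp (g := fun ψ => MvPolynomial.aeval (coords ψ) q)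
          (analyticAt_aeval_coords _ _) hsa) ?_
      have h2 : L.Cong φ (fun ψ => MvPolynomial.aeval (coords ψ) q)
          fun ψ => MvPolynomial.aeval (coords (s (L.inputMap 𝕜 ψ))) q :=
        hc.comp (analyticAt_aeval_coords q φ) analyticAt_id hsp hsφ.symm
      have h3 := (InAnalyticIdeal.of_mem (φ := φ) hq').add (cong_real_iff.1 h2.symm)
      simpa using h3
    filter_upwards [(Finset.eventually_all S).2 this] with x hx
    rw [mem_config_iff]
    intro q hq
    rw [← hS] at hq
    have hle : Submodule.span _ (S : Set (MvPolynomial (V × Fin 2) ℝ)) ≤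
        RingHom.ker (MvPolynomial.aeval (R := ℝ) (coords (s x))) :=
      Submodule.span_le.2 fun q hq => hx q hq
    exact hle hq
  have h2 : ∀ᶠ x in 𝓝 (L.inputMap 𝕜 φ), L.inputMap 𝕜 (s x) = x := by
    let b := Module.finBasis ℝ (EuclideanSpace 𝕜 (Fin m))
    have : ∀ i, ∀ᶠ x in 𝓝 (L.inputMap 𝕜 φ), b.coord i (L.inputMap 𝕜 (s x) - x) = 0 := fun i => by
      let l := LinearMap.toContinuousLinearMap (b.coord i)
      refine hinj (fun x => l (L.inputMap 𝕜 (s x) - x)) ?_ ?_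
      · refine (l.analyticAt _).fun_comp (AnalyticAt.fun_sub ?_ analyticAt_id)
        exact (L.analyticAt_inputMap 𝕜 _).fun_comp hsa
      · exact (hc.clm (L.inputCLM 𝕜)).symm l
    filter_upwards [eventually_all.2 this] with x hx
    rw [← sub_eq_zero, ← b.sum_repr (L.inputMap 𝕜 (s x) - x)]
    refine Finset.sum_eq_zero fun i _ => ?_
    have : b.repr (L.inputMap 𝕜 (s x) - x) i = 0 := hx i
    rw [this, zero_smul]
  exact h1.and h2

/-- A section at `φ` is also a section at each of its values near `φ`, so regular points exist over
a whole neighbourhood of the input. -/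
theorem HasSection.eventually (h : L.HasSection 𝕜 φ) :
    ∀ᶠ x in 𝓝 (L.inputMap 𝕜 φ), ∃ ψ ∈ L.Config, L.inputMap 𝕜 ψ = x ∧ L.HasSection 𝕜 ψ := by
  obtain ⟨s, hs, hsφ, hsec, hc⟩ := h
  have h2 : Tendsto s (𝓝 (L.inputMap 𝕜 φ)) (𝓝 φ) := by
    simpa [ContinuousAt, hsφ] using hs.continuousAt
  filter_upwards [h2.eventually hc.eventually, hsec, hsec.eventually_nhds,
    hs.eventually_analyticAt] with x h1 h3 h4 h5
  refine ⟨s x, h3.1, h3.2, s, ?_, ?_, ?_, h1⟩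
  · rwa [h3.2]
  · rw [h3.2]
  · rwa [h3.2]

/-- A function that vanishes at the real points near a regular point is in the analytic ideal. -/
theorem HasSection.inAnalyticIdeal (h : L.HasSection 𝕜 φ) {g : (V → ℂ) → ℝ}
    (hg : AnalyticAt ℝ g φ) (h0 : ∀ᶠ ψ in 𝓝 φ, ψ ∈ L.Config → g ψ = 0) :
    L.InAnalyticIdeal φ g := by
  obtain ⟨s, hs, hsφ, hsec, hc⟩ := h
  have hsp : AnalyticAt ℝ (fun ψ => s (L.inputMap 𝕜 ψ)) φ :=
    hs.fun_comp (L.analyticAt_inputMap 𝕜 φ)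
  have h1 := cong_real_iff.1 (hc.comp hg analyticAt_id hsp hsφ.symm)
  have h2 : Tendsto s (𝓝 (L.inputMap 𝕜 φ)) (𝓝 φ) := by
    simpa [ContinuousAt, hsφ] using hs.continuousAt
  have h3 := (L.analyticAt_inputMap 𝕜 φ).continuousAt.eventually ((h2.eventually h0).and hsec)
  refine h1.congr ?_
  filter_upwards [h3] with ψ hψ
  rw [hψ.1 hψ.2.1, sub_zero]

end Structure

end IOLinkage
-- The ring of rational functions on the scheme
namespace IOLinkage

section RatRing

variable {V : Type*} {m n : ℕ} (L : IOLinkage V m n)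

/-- The rational function defined by a polynomial. -/
def ofPoly : MvPolynomial (V × Fin 2) ℝ →ₐ[ℝ] L.RatRing :=
  (IsScalarTower.toAlgHom ℝ L.CoordRing L.RatRing).comp (Ideal.Quotient.mkₐ ℝ L.ideal)

theorem ofPoly_X (c : V × Fin 2) : L.ofPoly (MvPolynomial.X c) = L.coordFun c := rfl

theorem ofPoly_eq_aeval (q : MvPolynomial (V × Fin 2) ℝ) :
    L.ofPoly q = MvPolynomial.aeval L.coordFun q := by
  have : L.ofPoly = MvPolynomial.aeval L.coordFun := by
    ext c
    simp [ofPoly_X]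
  rw [this]

theorem ofPoly_eq_zero {q : MvPolynomial (V × Fin 2) ℝ} (hq : q ∈ L.ideal) : L.ofPoly q = 0 := by
  show algebraMap L.CoordRing L.RatRing (Ideal.Quotient.mk L.ideal q) = 0
  rw [Ideal.Quotient.eq_zero_iff_mem.2 hq, map_zero]

theorem evalRat_ofPoly (φ : L.Config) (q : MvPolynomial (V × Fin 2) ℝ) :
    L.evalRat φ (L.ofPoly q) = MvPolynomial.aeval (coords φ.1) q := by
  show L.evalRat φ (algebraMap L.CoordRing L.RatRing (Ideal.Quotient.mk L.ideal q)) = _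
  rw [evalRat, IsLocalization.liftAlgHom_apply, IsLocalization.lift_eq]
  rfl

@[simp] theorem evalRat_coordFun (φ : L.Config) (c : V × Fin 2) :
    L.evalRat φ (L.coordFun c) = coords φ.1 c := by
  rw [← ofPoly_X, evalRat_ofPoly, MvPolynomial.aeval_X]

theorem exists_ofPoly_mul_eq (r : L.RatRing) : ∃ a b : MvPolynomial (V × Fin 2) ℝ,
    (∀ φ ∈ L.Config, MvPolynomial.aeval (coords φ) b ≠ 0) ∧ r * L.ofPoly b = L.ofPoly a := by
  obtain ⟨⟨a, b⟩, h⟩ := IsLocalization.surj L.nonvanishing r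
  obtain ⟨a, rfl⟩ := Ideal.Quotient.mk_surjective a
  obtain ⟨b, hb⟩ := b
  obtain ⟨b, rfl⟩ := Ideal.Quotient.mk_surjective b
  exact ⟨a, b, fun φ hφ => hb ⟨φ, hφ⟩, h⟩

theorem ofPoly_eq_zero_iff {q : MvPolynomial (V × Fin 2) ℝ} : L.ofPoly q = 0 ↔
    ∃ b : MvPolynomial (V × Fin 2) ℝ,
      (∀ φ ∈ L.Config, MvPolynomial.aeval (coords φ) b ≠ 0) ∧ b * q ∈ L.ideal := by
  show algebraMap L.CoordRing L.RatRing (Ideal.Quotient.mk L.ideal q) = 0 ↔ _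
  refine (IsLocalization.map_eq_zero_iff L.nonvanishing L.RatRing _).trans ?_
  constructor
  · rintro ⟨⟨b, hb⟩, h⟩
    obtain ⟨b, rfl⟩ := Ideal.Quotient.mk_surjective b
    exact ⟨b, fun φ hφ => hb ⟨φ, hφ⟩, Ideal.Quotient.eq_zero_iff_mem.1 (by rw [map_mul]; exact h)⟩
  · rintro ⟨b, hb, h⟩
    exact ⟨⟨Ideal.Quotient.mk _ b, fun φ => hb φ.1 φ.2⟩,
      by rw [← map_mul]; exact Ideal.Quotient.eq_zero_iff_mem.2 h⟩

/-- A polynomial without real zeros on the configuration space is invertible. -/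
theorem isUnit_ofPoly {b : MvPolynomial (V × Fin 2) ℝ}
    (hb : ∀ φ ∈ L.Config, MvPolynomial.aeval (coords φ) b ≠ 0) : IsUnit (L.ofPoly b) :=
  IsLocalization.map_units L.RatRing
    (⟨Ideal.Quotient.mk _ b, fun φ => hb φ.1 φ.2⟩ : L.nonvanishing)

/-- The numerator of `r` has no real zeros either, so it has been inverted too. By this lemma
nondegeneracy at real points acquires a scheme-theoretic meaning. -/
theorem isUnit_of_evalRat_ne_zero {r : L.RatRing} (h : ∀ φ, L.evalRat φ r ≠ 0) : IsUnit r := by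
  obtain ⟨a, b, hb, hab⟩ := L.exists_ofPoly_mul_eq r
  have ha : IsUnit (L.ofPoly a) := L.isUnit_ofPoly fun φ hφ => by
    have := congrArg (L.evalRat ⟨φ, hφ⟩) hab
    rw [map_mul, evalRat_ofPoly, evalRat_ofPoly] at this
    rw [← this]
    exact mul_ne_zero (h _) (hb φ hφ)
  rw [← hab] at ha
  obtain ⟨u, hu⟩ := ha
  have h1 : r * (L.ofPoly b * (u⁻¹ : L.RatRingˣ)) = 1 := by
    rw [← mul_assoc, ← hu, Units.mul_inv]
  have h2 : L.ofPoly b * (u⁻¹ : L.RatRingˣ) * r = 1 := by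
    rw [← h1]; ring
  exact ⟨⟨r, L.ofPoly b * (u⁻¹ : L.RatRingˣ), h1, h2⟩, rfl⟩

/-- A homomorphism from the ring of rational functions is determined by the coordinates. -/
theorem ratRing_algHom_ext {A : Type*} [CommRing A] [Algebra ℝ A] {f g : L.RatRing →ₐ[ℝ] A}
    (h : ∀ c, f (L.coordFun c) = g (L.coordFun c)) : f = g := by
  have h1 : f.comp L.ofPoly = g.comp L.ofPoly := by
    ext c
    exact h c
  refine AlgHom.ext fun r => ?_
  obtain ⟨a, b, hb, hab⟩ := L.exists_ofPoly_mul_eq r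
  have hu := (L.isUnit_ofPoly hb).map f
  have e1 := congrArg f hab
  have e2 := congrArg g hab
  have h2 : ∀ q, f (L.ofPoly q) = g (L.ofPoly q) := DFunLike.congr_fun h1
  rw [map_mul] at e1 e2
  rw [← h2, ← h2, ← e1] at e2
  exact (hu.mul_right_cancel e2).symm

/-- The homomorphism from the ring of rational functions with given values on the coordinates. -/
def ratLift {V' : Type*} {m' n' : ℕ} {L' : IOLinkage V' m' n'} (F : V × Fin 2 → L'.RatRing)
    (hF : ∀ q ∈ L.ideal, MvPolynomial.aeval (R := ℝ) F q = 0) : L.RatRing →ₐ[ℝ] L'.RatRing :=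
  IsLocalization.liftAlgHom (A := ℝ) (R := L.CoordRing) (S := L.RatRing) (P := L'.RatRing)
    (M := L.nonvanishing) (f := Ideal.Quotient.liftₐ L.ideal (MvPolynomial.aeval (R := ℝ) F) hF) <| by
      rintro ⟨b, hb⟩
      obtain ⟨b, rfl⟩ := Ideal.Quotient.mk_surjective b
      refine L'.isUnit_of_evalRat_ne_zero fun φ => ?_
      show L'.evalRat φ (MvPolynomial.aeval (R := ℝ) F b) ≠ 0
      -- The values of `F` at a real point of `L'` form a real point of `L`, where the denominator
      -- does not vanish; hence its image is a unit.
      set ψ : V → ℂ := fun v => ⟨L'.evalRat φ (F (v, 0)), L'.evalRat φ (F (v, 1))⟩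
      have h1 : ∀ q, L'.evalRat φ (MvPolynomial.aeval (R := ℝ) F q) = MvPolynomial.aeval (coords ψ) q := by
        intro q
        have : (L'.evalRat φ).comp (MvPolynomial.aeval (R := ℝ) F) =
            MvPolynomial.aeval (coords ψ) := by
          ext ⟨v, i⟩
          fin_cases i <;> simp [ψ]
        exact DFunLike.congr_fun this q
      have hψ : ψ ∈ L.Config := (L.mem_config_iff ψ).2 fun q hq => by
        rw [← h1, hF q hq, map_zero]
      rw [h1]
      exact hb ⟨ψ, hψ⟩

@[simp] theorem ratLift_coordFun {V' : Type*} {m' n' : ℕ} {L' : IOLinkage V' m' n'}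
    (F : V × Fin 2 → L'.RatRing) (hF : ∀ q ∈ L.ideal, MvPolynomial.aeval (R := ℝ) F q = 0)
    (c : V × Fin 2) : L.ratLift F hF (L.coordFun c) = F c := by
  rw [ratLift, coordFun, IsLocalization.liftAlgHom_apply, IsLocalization.lift_eq]
  exact MvPolynomial.aeval_X F c

/-- An element that vanishes in a neighbourhood of every real point is zero. -/
theorem ratRing_eq_zero [Finite V] {r : L.RatRing}
    (h : ∀ φ, ∃ b, L.evalRat φ b ≠ 0 ∧ b * r = 0) : r = 0 := by
  have : IsNoetherianRing L.RatRing :=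
    IsLocalization.isNoetherianRing L.nonvanishing L.RatRing inferInstance
  obtain ⟨S, hS⟩ := IsNoetherian.noetherian (LinearMap.ker (LinearMap.toSpanSingleton L.RatRing L.RatRing r))
  have hann : ∀ b, b ∈ LinearMap.ker (LinearMap.toSpanSingleton L.RatRing L.RatRing r) ↔ b * r = 0 := fun b => by
    rw [LinearMap.mem_ker, LinearMap.toSpanSingleton_apply, smul_eq_mul]
  -- At a real zero of the sum of squares all generators of the annihilator of `r` would vanish,
  -- against the hypothesis. So the annihilator contains a unit.
  have hu : IsUnit (∑ b ∈ S, b * b) := by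
    refine L.isUnit_of_evalRat_ne_zero fun φ h0 => ?_
    rw [map_sum] at h0
    simp only [map_mul] at h0
    rw [Finset.sum_eq_zero_iff_of_nonneg fun _ _ => mul_self_nonneg _] at h0
    obtain ⟨b, hb, hbr⟩ := h φ
    refine hb ?_
    rw [← hann, ← hS] at hbr
    have hle : Submodule.span L.RatRing (S : Set L.RatRing) ≤ RingHom.ker (L.evalRat φ) :=
      Submodule.span_le.2 fun q hq => mul_self_eq_zero.1 (h0 q hq)
    exact hle hbr
  refine hu.mul_right_eq_zero.1 ?_
  rw [Finset.sum_mul]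
  refine Finset.sum_eq_zero fun b hb => ?_
  have hb' : b ∈ LinearMap.ker (LinearMap.toSpanSingleton L.RatRing L.RatRing r) := hS ▸ Submodule.subset_span hb
  rw [mul_assoc, (hann b).1 hb', mul_zero]

end RatRing

/-! ### Rational functions as analytic functions modulo the equations -/

section Function

variable {V : Type*} {m n : ℕ} (L : IOLinkage V m n)

/-- The function on the maps from the vertices to the plane defined by a fraction that represents
a rational function on the scheme. -/
def ratFun (r : L.RatRing) (φ : V → ℂ) : ℝ :=
  MvPolynomial.aeval (coords φ) (L.exists_ofPoly_mul_eq r).choose /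
    MvPolynomial.aeval (coords φ) (L.exists_ofPoly_mul_eq r).choose_spec.choose

theorem ratFun_spec (r : L.RatRing) : ∃ a b : MvPolynomial (V × Fin 2) ℝ,
    (∀ φ ∈ L.Config, MvPolynomial.aeval (coords φ) b ≠ 0) ∧ r * L.ofPoly b = L.ofPoly a ∧
    L.ratFun r = fun φ => MvPolynomial.aeval (coords φ) a / MvPolynomial.aeval (coords φ) b :=
  ⟨_, _, (L.exists_ofPoly_mul_eq r).choose_spec.choose_spec.1,
    (L.exists_ofPoly_mul_eq r).choose_spec.choose_spec.2, rfl⟩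

theorem ratFun_eq_evalRat (r : L.RatRing) (φ : L.Config) : L.ratFun r φ = L.evalRat φ r := by
  obtain ⟨a, b, hb, hab, e⟩ := L.ratFun_spec r
  rw [e, div_eq_iff (hb φ φ.2), ← evalRat_ofPoly, ← evalRat_ofPoly, ← hab, map_mul]

variable [Fintype V] {L}

theorem analyticAt_ratFun (r : L.RatRing) {φ : V → ℂ} (hφ : φ ∈ L.Config) :
    AnalyticAt ℝ (L.ratFun r) φ := by
  obtain ⟨a, b, hb, -, e⟩ := L.ratFun_spec r
  rw [e]
  exact (analyticAt_aeval_coords a φ).fun_div (analyticAt_aeval_coords b φ) (hb φ hφ)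

theorem inAnalyticIdeal_of_ofPoly_eq_zero {q : MvPolynomial (V × Fin 2) ℝ} (hq : L.ofPoly q = 0)
    {φ : V → ℂ} (hφ : φ ∈ L.Config) :
    L.InAnalyticIdeal φ fun ψ => MvPolynomial.aeval (coords ψ) q := by
  obtain ⟨b, hb, h⟩ := L.ofPoly_eq_zero_iff.1 hq
  have hb0 := hb φ hφ
  refine ((InAnalyticIdeal.of_mem h).mul_left
    (a := fun ψ => (MvPolynomial.aeval (coords ψ) b)⁻¹)
      ((analyticAt_aeval_coords b φ).fun_inv hb0)).congr ?_
  filter_upwards [(analyticAt_aeval_coords b φ).continuousAt.eventually_ne hb0] with ψ hψ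
  rw [map_mul, inv_mul_cancel_left₀ hψ]

/-- A fraction with a vanishing numerator is in the analytic ideal. -/
theorem inAnalyticIdeal_of_mul_eq {q b : MvPolynomial (V × Fin 2) ℝ} (hq : L.ofPoly q = 0)
    {φ : V → ℂ} (hφ : φ ∈ L.Config) (hb : MvPolynomial.aeval (coords φ) b ≠ 0)
    {g : (V → ℂ) → ℝ} (hg : ∀ᶠ ψ in 𝓝 φ, g ψ * MvPolynomial.aeval (coords ψ) b =
      MvPolynomial.aeval (coords ψ) q) : L.InAnalyticIdeal φ g := by
  refine ((inAnalyticIdeal_of_ofPoly_eq_zero hq hφ).mul_left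
    (a := fun ψ => (MvPolynomial.aeval (coords ψ) b)⁻¹)
      ((analyticAt_aeval_coords b φ).fun_inv hb)).congr ?_
  filter_upwards [(analyticAt_aeval_coords b φ).continuousAt.eventually_ne hb, hg] with ψ hψ h
  rw [← h, mul_comm, mul_inv_cancel_right₀ hψ]

theorem cong_ratFun_mul_ofPoly (r : L.RatRing) {a b : MvPolynomial (V × Fin 2) ℝ}
    (h : r * L.ofPoly b = L.ofPoly a) {φ : V → ℂ} (hφ : φ ∈ L.Config) :
    L.Cong φ (fun ψ => L.ratFun r ψ * MvPolynomial.aeval (coords ψ) b)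
      fun ψ => MvPolynomial.aeval (coords ψ) a := by
  obtain ⟨a', b', hb', hab', e⟩ := L.ratFun_spec r
  rw [cong_real_iff, e]
  refine inAnalyticIdeal_of_mul_eq (q := a' * b - a * b') (b := b') ?_ hφ (hb' φ hφ) ?_
  · rw [map_sub, map_mul, map_mul, ← h, ← hab']; ring
  · filter_upwards [(analyticAt_aeval_coords b' φ).continuousAt.eventually_ne (hb' φ hφ)] with ψ hψ
    simp only [map_sub, map_mul]
    field_simp

theorem cong_ratFun_ofPoly (q : MvPolynomial (V × Fin 2) ℝ) {φ : V → ℂ} (hφ : φ ∈ L.Config) :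
    L.Cong φ (L.ratFun (L.ofPoly q)) fun ψ => MvPolynomial.aeval (coords ψ) q := by
  simpa using cong_ratFun_mul_ofPoly (L.ofPoly q) (a := q) (b := 1) (by simp) hφ

/-- The fractions chosen for `r`, `t` and `r + t` are unrelated, so there is no equality of
functions. Multiplication by all denominators leaves a polynomial that is zero in the ring. -/
theorem cong_ratFun_add (r t : L.RatRing) {φ : V → ℂ} (hφ : φ ∈ L.Config) :
    L.Cong φ (L.ratFun (r + t)) fun ψ => L.ratFun r ψ + L.ratFun t ψ := by
  obtain ⟨a, b, hb, hab, e⟩ := L.ratFun_spec r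
  obtain ⟨a', b', hb', hab', e'⟩ := L.ratFun_spec t
  obtain ⟨a₀, b₀, hb₀, hab₀, e₀⟩ := L.ratFun_spec (r + t)
  rw [cong_real_iff, e, e', e₀]
  refine inAnalyticIdeal_of_mul_eq (q := a₀ * (b * b') - (a * b' + a' * b) * b₀)
    (b := b₀ * (b * b')) ?_ hφ ?_ ?_
  · simp only [map_sub, map_mul, map_add, ← hab, ← hab', ← hab₀]; ring
  · simpa only [map_mul] using mul_ne_zero (hb₀ φ hφ) (mul_ne_zero (hb φ hφ) (hb' φ hφ))
  · filter_upwards [(analyticAt_aeval_coords b φ).continuousAt.eventually_ne (hb φ hφ),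
      (analyticAt_aeval_coords b' φ).continuousAt.eventually_ne (hb' φ hφ),
      (analyticAt_aeval_coords b₀ φ).continuousAt.eventually_ne (hb₀ φ hφ)] with ψ h1 h2 h3
    simp only [map_sub, map_mul, map_add]
    field_simp

theorem cong_ratFun_mul (r t : L.RatRing) {φ : V → ℂ} (hφ : φ ∈ L.Config) :
    L.Cong φ (L.ratFun (r * t)) fun ψ => L.ratFun r ψ * L.ratFun t ψ := by
  obtain ⟨a, b, hb, hab, e⟩ := L.ratFun_spec r
  obtain ⟨a', b', hb', hab', e'⟩ := L.ratFun_spec t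
  obtain ⟨a₀, b₀, hb₀, hab₀, e₀⟩ := L.ratFun_spec (r * t)
  rw [cong_real_iff, e, e', e₀]
  refine inAnalyticIdeal_of_mul_eq (q := a₀ * (b * b') - (a * a') * b₀)
    (b := b₀ * (b * b')) ?_ hφ ?_ ?_
  · simp only [map_sub, map_mul, ← hab, ← hab', ← hab₀]; ring
  · simpa only [map_mul] using mul_ne_zero (hb₀ φ hφ) (mul_ne_zero (hb φ hφ) (hb' φ hφ))
  · filter_upwards [(analyticAt_aeval_coords b φ).continuousAt.eventually_ne (hb φ hφ),
      (analyticAt_aeval_coords b' φ).continuousAt.eventually_ne (hb' φ hφ),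
      (analyticAt_aeval_coords b₀ φ).continuousAt.eventually_ne (hb₀ φ hφ)] with ψ h1 h2 h3
    simp only [map_sub, map_mul]
    field_simp

/-- A rational function in the analytic ideal of a real point vanishes near this point. -/
theorem exists_mul_eq_zero {r : L.RatRing} {φ : L.Config} (h : L.InAnalyticIdeal φ (L.ratFun r)) :
    ∃ b, L.evalRat φ b ≠ 0 ∧ b * r = 0 := by
  obtain ⟨a, b, hb, hab, e⟩ := L.ratFun_spec r
  have h1 : L.InAnalyticIdeal φ fun ψ => MvPolynomial.aeval (coords ψ) a := by
    refine (h.mul_left (analyticAt_aeval_coords b φ.1)).congr ?_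
    filter_upwards [(analyticAt_aeval_coords b φ.1).continuousAt.eventually_ne (hb φ φ.2)] with ψ hψ
    rw [e]
    field_simp
  obtain ⟨d, hd, hda⟩ := L.exists_mul_mem_ideal h1
  refine ⟨L.ofPoly d * L.ofPoly b, ?_, ?_⟩
  · rw [map_mul, evalRat_ofPoly, evalRat_ofPoly]
    exact mul_ne_zero hd (hb φ φ.2)
  · rw [mul_assoc, mul_comm _ r, hab, ← map_mul]
    exact L.ofPoly_eq_zero hda

end Function

end IOLinkage
-- Homomorphisms of rational functions as maps of realizations
namespace IOLinkage

section Pullback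

variable {V V' : Type*} {m n m' n' : ℕ} {L : IOLinkage V m n}
  {L' : IOLinkage V' m' n'} (σ : L.RatRing →ₐ[ℝ] L'.RatRing)

/-- The map of realizations defined by a homomorphism of the rings of rational functions. -/
def pullMap (ψ : V' → ℂ) (v : V) : ℂ :=
  ⟨L'.ratFun (σ (L.coordFun (v, 0))) ψ, L'.ratFun (σ (L.coordFun (v, 1))) ψ⟩

theorem coords_pullMap (ψ : V' → ℂ) (c : V × Fin 2) :
    coords (pullMap σ ψ) c = L'.ratFun (σ (L.coordFun c)) ψ := by
  obtain ⟨v, i⟩ := c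
  fin_cases i <;> simp [pullMap]

theorem aeval_coords_pullMap (φ : L'.Config) (q : MvPolynomial (V × Fin 2) ℝ) :
    MvPolynomial.aeval (coords (pullMap σ φ.1)) q = L'.evalRat φ (σ (L.ofPoly q)) := by
  have : MvPolynomial.aeval (R := ℝ) (coords (pullMap σ φ.1)) =
      ((L'.evalRat φ).comp σ).comp L.ofPoly := by
    ext c
    simp [coords_pullMap, ratFun_eq_evalRat, ofPoly_X]
  rw [this]
  rfl

theorem pullMap_mem_config {φ : V' → ℂ} (hφ : φ ∈ L'.Config) : pullMap σ φ ∈ L.Config := by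
  rw [mem_config_iff]
  intro q hq
  rw [aeval_coords_pullMap σ ⟨φ, hφ⟩, L.ofPoly_eq_zero hq, map_zero, map_zero]

theorem evalRat_pullMap (φ : L'.Config) (r : L.RatRing) :
    L.evalRat ⟨pullMap σ φ.1, pullMap_mem_config σ φ.2⟩ r = L'.evalRat φ (σ r) := by
  have : L.evalRat ⟨pullMap σ φ.1, pullMap_mem_config σ φ.2⟩ = (L'.evalRat φ).comp σ := by
    refine L.ratRing_algHom_ext fun c => ?_
    simp [coords_pullMap, ratFun_eq_evalRat]
  rw [this]
  rfl

variable [Fintype V] [Fintype V'] {φ : V' → ℂ} (hφ : φ ∈ L'.Config)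

include hφ in
theorem analyticAt_pullMap : AnalyticAt ℝ (pullMap σ) φ := by
  have : pullMap σ = fun ψ v => (L'.ratFun (σ (L.coordFun (v, 0))) ψ : ℂ) +
      L'.ratFun (σ (L.coordFun (v, 1))) ψ * Complex.I := by
    funext ψ v
    apply Complex.ext <;> simp [pullMap]
  rw [this]
  refine AnalyticAt.pi fun v => ?_
  have h : ∀ r, AnalyticAt ℝ (fun ψ => (L'.ratFun r ψ : ℂ)) φ := fun r =>
    (Complex.ofRealCLM.analyticAt _).fun_comp (analyticAt_ratFun r hφ)
  exact (h _).fun_add ((h _).fun_mul analyticAt_const)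

include hφ in
-- Induction on `q`, since `ratFun` respects sums and products only modulo the equations.
theorem cong_aeval_pullMap (q : MvPolynomial (V × Fin 2) ℝ) :
    L'.Cong φ (fun ψ => MvPolynomial.aeval (coords (pullMap σ ψ)) q)
      (L'.ratFun (σ (L.ofPoly q))) := by
  have hc : ∀ q : MvPolynomial (V × Fin 2) ℝ,
      AnalyticAt ℝ (fun ψ => MvPolynomial.aeval (coords (pullMap σ ψ)) q) φ := fun q =>
    AnalyticAt.fun_comp (g := fun ψ => MvPolynomial.aeval (coords ψ) q)
      (analyticAt_aeval_coords q _) (analyticAt_pullMap σ hφ)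
  have hval : ∀ q : MvPolynomial (V × Fin 2) ℝ,
      MvPolynomial.aeval (coords (pullMap σ φ)) q = L'.ratFun (σ (L.ofPoly q)) φ := fun q => by
    rw [aeval_coords_pullMap σ ⟨φ, hφ⟩, ← ratFun_eq_evalRat]
  have hr : ∀ r, AnalyticAt ℝ (L'.ratFun r) φ := fun r => analyticAt_ratFun r hφ
  induction q using MvPolynomial.induction_on with
  | C a =>
    have h := (cong_ratFun_ofPoly (L := L') (MvPolynomial.C a) hφ).symm
    have e : σ (L.ofPoly (MvPolynomial.C a)) = L'.ofPoly (MvPolynomial.C a) := by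
      rw [← MvPolynomial.algebraMap_eq, AlgHom.commutes, AlgHom.commutes,
        ← MvPolynomial.algebraMap_eq, AlgHom.commutes]
    rw [e]
    simpa using h
  | add p q hp hq =>
    simp only [map_add]
    have h := (hp.prodMk hq).comp (f := fun z : ℝ × ℝ => z.1 + z.2)
      (analyticAt_fst.fun_add analyticAt_snd) ((hc p).prod (hc q)) ((hr _).prod (hr _))
      (Prod.ext (hval p) (hval q))
    exact h.trans (cong_ratFun_add _ _ hφ).symm
  | mul_X p c hp =>
    simp only [map_mul]
    have hX : L'.Cong φ (fun ψ => MvPolynomial.aeval (R := ℝ) (coords (pullMap σ ψ))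
        (MvPolynomial.X c))
        (L'.ratFun (σ (L.ofPoly (MvPolynomial.X c)))) := by
      simp only [MvPolynomial.aeval_X, coords_pullMap, ofPoly_X]
      exact Cong.refl _
    have h := (hp.prodMk hX).comp (f := fun z : ℝ × ℝ => z.1 * z.2)
      (analyticAt_fst.fun_mul analyticAt_snd) ((hc p).prod (hc _)) ((hr _).prod (hr _))
      (Prod.ext (hval p) (hval _))
    exact h.trans (cong_ratFun_mul _ _ hφ).symm

include hφ in
theorem cong_ratFun_pullMap (r : L.RatRing) :
    L'.Cong φ (fun ψ => L.ratFun r (pullMap σ ψ)) (L'.ratFun (σ r)) := by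
  obtain ⟨a, b, hb, hab, e⟩ := L.ratFun_spec r
  have hp := analyticAt_pullMap σ hφ
  have ha := cong_aeval_pullMap σ hφ a
  have hb' := cong_aeval_pullMap σ hφ b
  have hr : ∀ r, AnalyticAt ℝ (L'.ratFun r) φ := fun r => analyticAt_ratFun r hφ
  have hc : ∀ q : MvPolynomial (V × Fin 2) ℝ,
      AnalyticAt ℝ (fun ψ => MvPolynomial.aeval (coords (pullMap σ ψ)) q) φ := fun q =>
    AnalyticAt.fun_comp (g := fun ψ => MvPolynomial.aeval (coords ψ) q)
      (analyticAt_aeval_coords q _) hp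
  have hval : ∀ q : MvPolynomial (V × Fin 2) ℝ,
      MvPolynomial.aeval (coords (pullMap σ φ)) q = L'.ratFun (σ (L.ofPoly q)) φ := fun q => by
    rw [aeval_coords_pullMap σ ⟨φ, hφ⟩, ← ratFun_eq_evalRat]
  have hb0 : MvPolynomial.aeval (coords (pullMap σ φ)) b ≠ 0 := hb _ (pullMap_mem_config σ hφ)
  have h1 := (ha.prodMk hb').comp (f := fun z : ℝ × ℝ => z.1 / z.2)
    (analyticAt_fst.fun_div analyticAt_snd hb0) ((hc a).prod (hc b)) ((hr _).prod (hr _))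
    (Prod.ext (hval a) (hval b))
  have h2 := (cong_ratFun_mul (σ r) (σ (L.ofPoly b)) hφ)
  rw [← map_mul, hab] at h2
  have hb1 : L'.ratFun (σ (L.ofPoly b)) φ ≠ 0 := by rwa [← hval]
  have h3 := (h2.prodMk (Cong.refl (L'.ratFun (σ (L.ofPoly b))))).comp
    (f := fun z : ℝ × ℝ => z.1 / z.2) (analyticAt_fst.fun_div analyticAt_snd hb1)
    ((hr _).prod (hr _)) (((hr _).fun_mul (hr _)).prod (hr _)) (by
      have := h2.eventually_eq.self_of_nhds hφ
      exact Prod.ext this rfl)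
  rw [e]
  refine (h1.trans h3).trans (Cong.of_eventuallyEq ?_)
  filter_upwards [(hr (σ (L.ofPoly b))).continuousAt.eventually_ne hb1] with ψ hψ
  field_simp

include hφ in
-- The homomorphism `σ` sends the equations of `L` to zero, so after composition with the associated
-- map they lie in the analytic ideal of `L'`; analytic coefficients stay analytic.
theorem InAnalyticIdeal.pullMap {g : (V → ℂ) → ℝ}
    (h : L.InAnalyticIdeal (pullMap σ φ) g) :
    L'.InAnalyticIdeal φ fun ψ => g (IOLinkage.pullMap σ ψ) := by
  obtain ⟨N, a, q, ha, hq, e⟩ := h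
  have hp := analyticAt_pullMap σ hφ
  have h1 : L'.InAnalyticIdeal φ fun ψ => ∑ i, a i (IOLinkage.pullMap σ ψ) *
      MvPolynomial.aeval (coords (IOLinkage.pullMap σ ψ)) (q i) := by
    refine InAnalyticIdeal.sum _ fun i _ => InAnalyticIdeal.mul_left ?_ ((ha i).fun_comp hp)
    have h2 := cong_aeval_pullMap σ hφ (q i)
    rw [L.ofPoly_eq_zero (hq i), map_zero] at h2
    have h3 := cong_ratFun_ofPoly (L := L') 0 hφ
    rw [map_zero] at h3
    simpa using cong_real_iff.1 (h2.trans h3)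
  exact h1.congr (hp.continuousAt.eventually e)

include hφ in
theorem Cong.pullMap {E : Type*} [NormedAddCommGroup E] [NormedSpace ℝ E] {u w : (V → ℂ) → E}
    (h : L.Cong (pullMap σ φ) u w) :
    L'.Cong φ (fun ψ => u (IOLinkage.pullMap σ ψ)) fun ψ => w (IOLinkage.pullMap σ ψ) :=
  fun l => (h l).pullMap σ hφ

end Pullback

/-! ### Symmetries and regular points -/

section Transfer

variable {V : Type*} {m n : ℕ} {L : IOLinkage V m n} {𝕜 : Type*} [RCLike 𝕜]

theorem inputMap_apply (φ : V → ℂ) (i : Fin m) :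
    L.inputMap 𝕜 φ i = ofComplex 𝕜 (φ (L.inp i)) := rfl

/-- A symmetry, as a homomorphism, takes each realization to one with the same input. -/
theorem inputMap_pullMap {σ : L.RatRing ≃ₐ[ℝ] L.RatRing} (hσ : σ ∈ L.Sym) {φ : V → ℂ}
    (hφ : φ ∈ L.Config) : L.inputMap 𝕜 (pullMap σ.toAlgHom φ) = L.inputMap 𝕜 φ := by
  have h : ∀ i j, coords (pullMap σ.toAlgHom φ) (L.inp i, j) = coords φ (L.inp i, j) :=
    fun i j => by
      have h1 : σ.toAlgHom (L.coordFun (L.inp i, j)) = L.coordFun (L.inp i, j) := hσ i j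
      rw [coords_pullMap, ratFun_eq_evalRat _ _ ⟨φ, hφ⟩, h1, evalRat_coordFun]
  ext i
  rw [inputMap_apply, inputMap_apply]
  congr 1
  exact Complex.ext (by simpa using h i 0) (by simpa using h i 1)

theorem cong_inputMap_pullMap [Fintype V] {σ : L.RatRing ≃ₐ[ℝ] L.RatRing} (hσ : σ ∈ L.Sym) {φ : V → ℂ}
    (hφ : φ ∈ L.Config) :
    L.Cong φ (fun ψ => L.inputMap 𝕜 (pullMap σ.toAlgHom ψ)) (L.inputMap 𝕜) := by
  have h : ∀ i j, L.Cong φ (fun ψ => coords (pullMap σ.toAlgHom ψ) (L.inp i, j))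
      fun ψ => coords ψ (L.inp i, j) := fun i j => by
    have h1 : σ.toAlgHom (L.coordFun (L.inp i, j)) = L.coordFun (L.inp i, j) := hσ i j
    have h2 := cong_ratFun_ofPoly (L := L) (MvPolynomial.X (L.inp i, j)) hφ
    simp only [MvPolynomial.aeval_X, ofPoly_X] at h2
    have h3 : (fun ψ => coords (pullMap σ.toAlgHom ψ) (L.inp i, j)) =
        L.ratFun (L.coordFun (L.inp i, j)) := funext fun ψ => by
      rw [coords_pullMap, h1]
    rwa [h3]
  have h2 : L.Cong φ (fun ψ i => pullMap σ.toAlgHom ψ (L.inp i)) fun ψ i => ψ (L.inp i) :=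
    Cong.pi fun i => Cong.complex (by simpa using h i 0) (by simpa using h i 1)
  exact h2.clm (LinearMap.toContinuousLinearMap
    ((WithLp.linearEquiv 2 ℝ (Fin m → 𝕜)).symm.toLinearMap ∘ₗ
      LinearMap.pi fun i => ofComplexLM 𝕜 ∘ₗ LinearMap.proj i))

theorem pullMap_eq_of_evalRat {σ : L.RatRing →ₐ[ℝ] L.RatRing} {φ ψ : L.Config}
    (h : ∀ g, L.evalRat φ (σ g) = L.evalRat ψ g) : pullMap σ φ.1 = ψ.1 :=
  coords_ext fun c => by rw [coords_pullMap, ratFun_eq_evalRat, h, evalRat_coordFun]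

/-- Symmetries of the scheme preserve the regular points. -/
theorem HasSection.of_mem_Sym [Fintype V] {σ : L.RatRing ≃ₐ[ℝ] L.RatRing} (hσ : σ ∈ L.Sym) {φ ψ : L.Config}
    (h : ∀ g, L.evalRat φ (σ g) = L.evalRat ψ g) (hφ : L.HasSection 𝕜 φ) :
    L.HasSection 𝕜 ψ.1 := by
  have hσ' : σ.symm ∈ L.Sym := L.Sym.inv_mem hσ
  set T := pullMap σ.toAlgHom with hT
  set T' := pullMap σ.symm.toAlgHom with hT'
  have e : T φ.1 = ψ.1 := pullMap_eq_of_evalRat h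
  have e' : T' ψ.1 = φ.1 := pullMap_eq_of_evalRat fun g => by
    have h1 := h (σ.symm g)
    rw [AlgEquiv.apply_symm_apply] at h1
    exact h1.symm
  have hp : L.inputMap 𝕜 ψ.1 = L.inputMap 𝕜 φ.1 := by
    rw [← e]; exact inputMap_pullMap hσ φ.2
  have aT : AnalyticAt ℝ T φ := analyticAt_pullMap _ φ.2
  have aT' : AnalyticAt ℝ T' ψ := analyticAt_pullMap _ ψ.2
  obtain ⟨s, hs, hsφ, hsec, hc⟩ := hφ
  have aTs : AnalyticAt ℝ (fun x => T (s x)) (L.inputMap 𝕜 φ.1) :=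
    AnalyticAt.fun_comp (by rwa [hsφ]) hs
  refine ⟨fun x => T (s x), by rwa [hp], by rw [hp]; exact (congrArg T hsφ).trans e, ?_, ?_⟩
  · rw [hp]
    filter_upwards [hsec] with x hx
    exact ⟨pullMap_mem_config _ hx.1, (inputMap_pullMap hσ hx.1).trans hx.2⟩
  -- The new section is `T ∘ s`. With `p` the input map, the chain of congruences is `χ ≡ T (T' χ) ≡
  -- T (s (p (T' χ))) ≡ T (s (p χ))`; the last one holds because symmetries fix the inputs.
  · have c1 : L.Cong ψ.1 (fun χ => T (T' χ)) fun χ => χ := Cong.of_coords fun c => by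
      have h1 := cong_ratFun_pullMap σ.symm.toAlgHom ψ.2 (σ (L.coordFun c))
      have h2 : σ.symm.toAlgHom (σ (L.coordFun c)) = L.ofPoly (MvPolynomial.X c) :=
        σ.symm_apply_apply _
      rw [h2] at h1
      have h3 := h1.trans (cong_ratFun_ofPoly _ ψ.2)
      simp only [MvPolynomial.aeval_X] at h3
      have h4 : (fun χ => coords (T (T' χ)) c) = fun χ => L.ratFun (σ (L.coordFun c)) (T' χ) :=
        funext fun χ => coords_pullMap _ _ _
      rw [h4]
      exact h3
    have c2 : L.Cong ψ.1 T' fun χ => s (L.inputMap 𝕜 (T' χ)) := by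
      refine Cong.pullMap σ.symm.toAlgHom ψ.2 (u := fun χ => χ)
        (w := fun χ => s (L.inputMap 𝕜 χ)) ?_
      rw [← hT', e']
      exact hc
    have aS : AnalyticAt ℝ s (L.inputMap 𝕜 ψ.1) := by rwa [hp]
    have aS' : AnalyticAt ℝ (fun χ => s (L.inputMap 𝕜 χ)) ψ.1 :=
      AnalyticAt.fun_comp aS (L.analyticAt_inputMap 𝕜 ψ.1)
    have aP : AnalyticAt ℝ (fun χ => L.inputMap 𝕜 (T' χ)) ψ.1 :=
      AnalyticAt.fun_comp (L.analyticAt_inputMap 𝕜 _) aT'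
    have c3 : L.Cong ψ.1 (fun χ => s (L.inputMap 𝕜 (T' χ))) fun χ => s (L.inputMap 𝕜 χ) :=
      (cong_inputMap_pullMap (𝕜 := 𝕜) hσ' ψ.2).comp (by rw [← hT', e']; exact hs) aP
        (L.analyticAt_inputMap 𝕜 ψ.1) (by rw [← hT', e', hp])
    have c4 := (c2.trans c3).comp (f := T) (by rwa [e']) aT' aS' (by rw [e', hp, hsφ])
    exact c1.symm.trans c4

/-- Near a regular value that is the base point of a functional linkage all points of the
configuration space are regular, and the fibers are not empty. -/
theorem IsFunctional.exists_ball [Fintype V] {f : EuclideanSpace 𝕜 (Fin m) → EuclideanSpace 𝕜 (Fin n)}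
    {O : EuclideanSpace 𝕜 (Fin m)} (hL : L.IsFunctional 𝕜 f O) :
    ∃ ε > 0, ∀ x ∈ Metric.ball O ε, (∃ ψ ∈ L.Config, L.inputMap 𝕜 ψ = x) ∧
      ∀ ψ ∈ L.Config, L.inputMap 𝕜 ψ = x → L.HasSection 𝕜 ψ := by
  obtain ⟨φ, ⟨hφ, hcrit⟩, rfl⟩ := hL.base_mem
  have hreg : L.IsRegularAt 𝕜 φ := by
    by_contra h
    exact hcrit ⟨hφ, h⟩
  obtain ⟨ε, hε, h⟩ := Metric.eventually_nhds_iff.1 (hreg.hasSection hφ).eventually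
  refine ⟨ε, hε, fun x hx => ?_⟩
  obtain ⟨χ, hχ, hχx, hsec⟩ := h hx
  refine ⟨⟨χ, hχ, hχx⟩, fun ψ hψ hψx => ?_⟩
  -- The section gives one regular point in the fiber; transitivity of the symmetries carries
  -- regularity to the others.
  obtain ⟨σ, hσ, he⟩ := hL.regular ⟨χ, hχ⟩ ⟨ψ, hψ⟩ (hχx.trans hψx.symm)
  exact HasSection.of_mem_Sym hσ he hsec

end Transfer

end IOLinkage

/-! ### Points of the configuration scheme over arbitrary rings -/

section Points

variable {V : Type*} {m n : ℕ} {A : Type*} [CommRing A]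

/-- The squared distance of two vertices, over an arbitrary ring. -/
def dsq (F : V × Fin 2 → A) (v w : V) : A := (F (v, 0) - F (w, 0)) ^ 2 + (F (v, 1) - F (w, 1)) ^ 2

theorem dsq_comm (F : V × Fin 2 → A) (v w : V) : dsq F v w = dsq F w v := by
  simp only [dsq]; ring

variable [Algebra ℝ A]

/-- The points of the configuration scheme with values in an arbitrary ring. -/
structure IOLinkage.IsPoint (L : IOLinkage V m n) (F : V × Fin 2 → A) : Prop where
  edge : ∀ v w, L.graph.Adj v w → dsq F v w = algebraMap ℝ A (L.len s(v, w) ^ 2)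
  mark : ∀ j, F (L.fixed j, 0) = algebraMap ℝ A (L.Z j).re ∧
    F (L.fixed j, 1) = algebraMap ℝ A (L.Z j).im
  bar : ∀ a b c, (a, b, c) ∈ L.bars → ∀ i, F (b, i) =
    algebraMap ℝ A (L.len s(b, c) / L.len s(a, c)) * F (a, i) +
      algebraMap ℝ A (L.len s(a, b) / L.len s(a, c)) * F (c, i)

/-- With this, one computation treats the realizations (`A = ℝ`), the coordinate functions
themselves (`A = RatRing`) and candidates for symmetries. -/
theorem IOLinkage.isPoint_iff (L : IOLinkage V m n) (F : V × Fin 2 → A) :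
    L.IsPoint F ↔ ∀ q ∈ L.ideal, MvPolynomial.aeval F q = 0 := by
  have key : (∀ q ∈ L.ideal, MvPolynomial.aeval F q = 0) ↔
      ∀ q ∈ L.edgePolys ∪ L.markPolys ∪ L.barPolys, MvPolynomial.aeval F q = 0 := by
    refine ⟨fun h q hq => h q (Ideal.subset_span hq), fun h q hq => ?_⟩
    have : L.ideal ≤ RingHom.ker (MvPolynomial.aeval (R := ℝ) F) := Ideal.span_le.2 fun q hq => h q hq
    exact this hq
  rw [key]
  constructor
  · rintro ⟨h1, h2, h3⟩ q ((⟨v, w, hvw, rfl⟩ | ⟨j, rfl | rfl⟩) | ⟨a, b, c, habc, i, rfl⟩)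
    · have := h1 v w hvw
      simp only [dsq] at this
      simp [this]
    · simp [(h2 j).1]
    · simp [(h2 j).2]
    · rw [map_sub, MvPolynomial.aeval_X, h3 a b c habc i]
      simp
  · intro h
    refine ⟨fun v w hvw => ?_, fun j => ?_, fun a b c habc i => ?_⟩
    · have := h _ (Or.inl (Or.inl ⟨v, w, hvw, rfl⟩))
      simp only [map_sub, map_add, map_pow, MvPolynomial.aeval_X, MvPolynomial.aeval_C,
        sub_eq_zero] at this
      simp only [dsq, this, map_pow]
    · have h1 := h _ (Or.inl (Or.inr ⟨j, Or.inl rfl⟩))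
      have h2 := h _ (Or.inl (Or.inr ⟨j, Or.inr rfl⟩))
      simp only [map_sub, MvPolynomial.aeval_X, MvPolynomial.aeval_C, sub_eq_zero] at h1 h2
      exact ⟨h1, h2⟩
    · have := h _ (Or.inr ⟨a, b, c, habc, i, rfl⟩)
      simpa only [map_sub, map_add, map_mul, MvPolynomial.aeval_X, MvPolynomial.aeval_C,
        sub_eq_zero] using this

theorem IOLinkage.mem_config_iff_isPoint (L : IOLinkage V m n) (φ : V → ℂ) :
    φ ∈ L.Config ↔ L.IsPoint (coords φ) := by
  rw [L.mem_config_iff, L.isPoint_iff]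

theorem IOLinkage.isPoint_coordFun (L : IOLinkage V m n) : L.IsPoint L.coordFun := by
  rw [L.isPoint_iff]
  intro q hq
  rw [← L.ofPoly_eq_aeval, L.ofPoly_eq_zero hq]

theorem IOLinkage.IsPoint.map {L : IOLinkage V m n} {F : V × Fin 2 → A} (h : L.IsPoint F)
    {B : Type*} [CommRing B] [Algebra ℝ B] (f : A →ₐ[ℝ] B) : L.IsPoint (f ∘ F) := by
  rw [L.isPoint_iff] at h ⊢
  intro q hq
  show MvPolynomial.aeval (fun c => f (F c)) q = 0
  rw [← MvPolynomial.comp_aeval_apply, h q hq, map_zero]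

end Points

/-! ### The pantograph -/

section Gadget

variable {A : Type*} [CommRing A] [Algebra ℝ A]

/-- The pantograph relation: the equations of the three parallel bars imply the linear relation
of the terminals. -/
theorem pantograph_relation {u v w T P B N : Fin 2 → A} {s : ℝ} {l : A} (hs : s ≠ 0) (hs1 : s ≠ 1)
    (hP : ∀ i, P i = algebraMap ℝ A (1 - s) * u i + algebraMap ℝ A s * T i)
    (hw : ∀ i, w i = algebraMap ℝ A (1 - s) * N i + algebraMap ℝ A s * B i)
    (hB : ∀ i, B i = algebraMap ℝ A (1 - s) * T i + algebraMap ℝ A s * v i)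
    (h1 : (T 0 - u 0) ^ 2 + (T 1 - u 1) ^ 2 = l ^ 2)
    (h2 : (N 0 - B 0) ^ 2 + (N 1 - B 1) ^ 2 = l ^ 2)
    (h3 : (T 0 - B 0) ^ 2 + (T 1 - B 1) ^ 2 = (algebraMap ℝ A s * l) ^ 2)
    (h4 : (N 0 - u 0) ^ 2 + (N 1 - u 1) ^ 2 = (algebraMap ℝ A s * l) ^ 2)
    (h5 : (P 0 - w 0) ^ 2 + (P 1 - w 1) ^ 2 = (algebraMap ℝ A s * l) ^ 2)
    (hreg : ∀ x y : A, x ^ 2 + y ^ 2 = 0 → (u 0 - T 0) * x + (u 1 - T 1) * y = 0 →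
      (v 0 - T 0) * x + (v 1 - T 1) * y = 0 → x = 0 ∧ y = 0) (i : Fin 2) :
    N i = u i + B i - T i ∧
      w i = algebraMap ℝ A (1 - s) * u i + algebraMap ℝ A s * v i := by
  have unit : ∀ r : ℝ, r ≠ 0 → ∀ x : A, algebraMap ℝ A r * x = 0 → x = 0 := fun r hr x hx =>
    (((isUnit_iff_ne_zero.2 hr).map (algebraMap ℝ A)).mul_right_eq_zero).1 hx
  set σ : A := algebraMap ℝ A s with hσ
  have e1 : algebraMap ℝ A (1 - s) = 1 - σ := by rw [map_sub, map_one]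
  rw [e1] at hP hw hB ⊢
  -- The vector `(x, y)` measures the failure of `u`, `T`, `B`, `N` to form a parallelogram.
  obtain ⟨x, hx⟩ : ∃ x, x = N 0 - B 0 - (u 0 - T 0) := ⟨_, rfl⟩
  obtain ⟨y, hy⟩ : ∃ y, y = N 1 - B 1 - (u 1 - T 1) := ⟨_, rfl⟩
  have hN0 : N 0 = x + B 0 + (u 0 - T 0) := by rw [hx]; ring
  have hN1 : N 1 = y + B 1 + (u 1 - T 1) := by rw [hy]; ring
  have f1 : 2 * ((u 0 - T 0) * x + (u 1 - T 1) * y) + (x ^ 2 + y ^ 2) = 0 := by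
    rw [hN0, hN1] at h2
    linear_combination h2 - h1
  have f2 : 2 * ((B 0 - T 0) * x + (B 1 - T 1) * y) + (x ^ 2 + y ^ 2) = 0 := by
    rw [hN0, hN1] at h4
    linear_combination h4 - h3
  have f3 : 2 * ((B 0 - T 0) * x + (B 1 - T 1) * y) + (1 - σ) * (x ^ 2 + y ^ 2) = 0 := by
    refine unit (1 - s) (sub_ne_zero.2 hs1.symm) _ ?_
    rw [e1]
    rw [hw 0, hw 1, hP 0, hP 1, hN0, hN1] at h5
    linear_combination h5 - h3
  -- The bar from `P` to `w` excludes the antiparallelogram: it gives the same linear term as `f2`,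
  -- but the quadratic term with the factor `1 - σ`. The difference is `σ (x² + y²)`. Over `ℝ` this
  -- ends the proof; in general `hreg` is needed for the remaining linear equations.
  have f4 : x ^ 2 + y ^ 2 = 0 := unit s hs _ (by rw [← hσ]; linear_combination f2 - f3)
  have two : ∀ z : A, 2 * z = 0 → z = 0 := fun z hz => unit 2 two_ne_zero z (by rw [map_ofNat]; exact hz)
  have f5 : (u 0 - T 0) * x + (u 1 - T 1) * y = 0 := two _ (by linear_combination f1 - f4)
  have f6 : (v 0 - T 0) * x + (v 1 - T 1) * y = 0 := by
    refine unit s hs _ (two _ ?_)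
    rw [hB 0, hB 1] at f2
    linear_combination f2 - f4
  obtain ⟨hx0, hy0⟩ := hreg x y f4 f5 f6
  have hN : ∀ i, N i = u i + B i - T i := by
    intro i
    fin_cases i
    · show N 0 = u 0 + B 0 - T 0
      rw [hN0, hx0]; ring
    · show N 1 = u 1 + B 1 - T 1
      rw [hN1, hy0]; ring
  refine ⟨hN i, ?_⟩
  rw [hw i, hN i, hB i]
  ring

end Gadget

/-! ### Design of the expanded linkage -/

/-- The terminals of the expanded linkage that are not vertices of one of the copies of the given
linkage: inputs, rescaled inputs, partial sums, outputs and centers. -/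
inductive Pt (m n N : ℕ)
  | inp (j : Fin m)
  | mid (i : Fin N) (j : Fin m)
  | acc (q : Fin n) (k : Fin (N + 2))
  | out (q : Fin n)
  | near (i : Fin N)
  | far
  | base
  deriving Fintype, DecidableEq

/-- The pantographs of the expanded linkage. -/
inductive Gad (m n N : ℕ)
  | scale (i : Fin N) (j : Fin m)
  | shift (i : Fin N) (j : Fin m)
  | sum (q : Fin n) (k : Fin (N + 1))
  deriving Fintype, DecidableEq

/-- The numerical data of the expanded linkage. -/
structure Plan where
  N : ℕ
  /-- the input of the copy `i` is multiplied by `τ i ^ 2` -/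
  τ : Fin N → ℝ
  τ_pos : ∀ i, 0 < τ i
  τ_lt_one : ∀ i, τ i < 1
  /-- the coefficients in the linear combination of outputs -/
  c : Fin (N + 1) → ℝ
  c_ne : ∀ k, c k ≠ 0
  /-- the total weights of the partial sums -/
  μ : Fin (N + 2) → ℝ
  μ_pos : ∀ k, 0 < μ k
  μ_succ : ∀ k, μ k.succ = μ k.castSucc + c k
  -- The radius of the ball about `0` that the regular domain has to contain; it is also the unit
  -- for the positions and lengths of the scaling pantographs and of the limiting arms.
  R : ℝ
  R_pos : 0 < R
  /-- the initial value of the partial sums -/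
  far : ℝ
  /-- the length of the bars of the pantographs in the partial sums -/
  bar : ℝ
  bar_pos : 0 < bar

namespace Plan

variable (P : Plan) {V : Type*} [Fintype V] {m n : ℕ} (L : IOLinkage V m n)

/-- The terminals of the expanded linkage. -/
abbrev Term : Type := (Fin P.N × Fin (Fintype.card V)) ⊕ Pt m n P.N

/-- The vertices of the expanded linkage. -/
abbrev Vtx : Type :=
  ((Fin P.N × Fin (Fintype.card V)) ⊕ Pt m n P.N) ⊕ ((Gad m n P.N × Fin 4) ⊕ Fin m)

/-- The vertices of the copies of the given linkage. -/
def copyT (i : Fin P.N) (v : V) : (Fin P.N × Fin (Fintype.card V)) ⊕ Pt m n P.N :=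
  Sum.inl (i, Fintype.equivFin V v)

theorem copyT_injective (i : Fin P.N) :
    Function.Injective (P.copyT i : V → (Fin P.N × Fin (Fintype.card V)) ⊕ Pt m n P.N) := by
  intro v w h
  simpa [copyT] using h

/-- The vertex with the value that is added to the partial sum in step `k`. -/
def summand (q : Fin n) (k : Fin (P.N + 1)) : (Fin P.N × Fin (Fintype.card V)) ⊕ Pt m n P.N :=
  Fin.lastCases (motive := fun _ => (Fin P.N × Fin (Fintype.card V)) ⊕ Pt m n P.N)
    (Sum.inr (Pt.out q)) (fun i => P.copyT i (L.out q)) k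

/-- The center of a pantograph. -/
def gu : Gad m n P.N → (Fin P.N × Fin (Fintype.card V)) ⊕ Pt m n P.N
  | .scale _ _ => .inr .far
  | .shift i _ => .inr (.near i)
  -- The relation is `μ_{k+1} acc_{k+1} = μ_k acc_k + c_k y_k`. For negative `c_k` it is read as
  -- `μ_k acc_k = μ_{k+1} acc_{k+1} + (-c_k) y_k`: the two sums change roles, and the ratio stays in
  -- `(0, 1)`.
  | .sum q k => if 0 < P.c k then .inr (.acc q k.castSucc) else .inr (.acc q k.succ)

/-- The far end of a pantograph. -/
def gv : Gad m n P.N → (Fin P.N × Fin (Fintype.card V)) ⊕ Pt m n P.N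
  | .scale _ j => .inr (.inp j)
  | .shift i j => .inr (.mid i j)
  | .sum q k => P.summand L q k

/-- The intermediate point of a pantograph. -/
def gw : Gad m n P.N → (Fin P.N × Fin (Fintype.card V)) ⊕ Pt m n P.N
  | .scale i j => .inr (.mid i j)
  | .shift i j => P.copyT i (L.inp j)
  | .sum q k => if 0 < P.c k then .inr (.acc q k.succ) else .inr (.acc q k.castSucc)

/-- The ratio of a pantograph. -/
def gs : Gad m n P.N → ℝ
  | .scale i _ => P.τ i
  | .shift i _ => P.τ i
  | .sum _ k => if 0 < P.c k then P.c k / P.μ k.succ else - P.c k / P.μ k.castSucc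

/-- The length of the bars of a pantograph. -/
def gl : Gad m n P.N → ℝ
  | .scale _ _ => 6 * P.R
  | .shift _ _ => 6 * P.R
  | .sum _ _ => P.bar

theorem gs_pos (g : Gad m n P.N) : 0 < P.gs g := by
  cases g with
  | scale i j => exact P.τ_pos i
  | shift i j => exact P.τ_pos i
  | sum q k =>
    simp only [gs]
    split_ifs with h
    · exact div_pos h (P.μ_pos _)
    · exact div_pos (neg_pos.2 (lt_of_le_of_ne (not_lt.1 h) (P.c_ne k))) (P.μ_pos _)

theorem gs_lt_one (g : Gad m n P.N) : P.gs g < 1 := by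
  cases g with
  | scale i j => exact P.τ_lt_one i
  | shift i j => exact P.τ_lt_one i
  | sum q k =>
    simp only [gs]
    have h1 := P.μ_succ k
    have h2 := P.μ_pos k.castSucc
    have h3 := P.μ_pos k.succ
    split_ifs with h
    · rw [div_lt_one h3]; linarith
    · rw [div_lt_one h2]; linarith

theorem gl_pos (g : Gad m n P.N) : 0 < P.gl g := by
  have := P.R_pos
  cases g with
  | scale i j => simp only [gl]; positivity
  | shift i j => simp only [gl]; positivity
  | sum q k => exact P.bar_pos

/-- The lengths of the edges between terminals. -/
def termLen : (Fin P.N × Fin (Fintype.card V)) ⊕ Pt m n P.N →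
    (Fin P.N × Fin (Fintype.card V)) ⊕ Pt m n P.N → ℝ
  | .inl (i, a), .inl (i', b) =>
    open scoped Classical in
    if i = i' ∧ L.graph.Adj ((Fintype.equivFin V).symm a) ((Fintype.equivFin V).symm b) then
      L.len s((Fintype.equivFin V).symm a, (Fintype.equivFin V).symm b) else 0
  | .inl _, .inr _ => 0
  | .inr _, .inl _ => 0
  | .inr _, .inr _ => 0

open scoped Classical in
/-- The lengths of the edges between the inner vertices of a pantograph or the vertices of the arms
that restrict the domain and terminals. -/
def outerLen : (Gad m n P.N × Fin 4) ⊕ Fin m →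
    (Fin P.N × Fin (Fintype.card V)) ⊕ Pt m n P.N → ℝ
  | .inl (g, 0), t => if t = P.gu g ∨ t = P.gv L g then P.gl g else 0
  | .inl (g, 1), t => if t = P.gu g ∨ t = P.gw L g then P.gs g * P.gl g else 0
  | .inl (g, 2), t => if t = P.gv L g ∨ t = P.gw L g then (1 - P.gs g) * P.gl g else 0
  | .inl (g, 3), t => if t = P.gu g ∨ t = P.gw L g then P.gs g * P.gl g else 0
  -- With the base at `-2R` these two bars restrict the input exactly to `R ≤ |x_j + 2R| ≤ 3R`.
  | .inr j, t => if t = .inr .base then 2 * P.R else if t = .inr (.inp j) then P.R else 0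

/-- The lengths of the edges between inner vertices. -/
def innerLen : (Gad m n P.N × Fin 4) ⊕ Fin m → (Gad m n P.N × Fin 4) ⊕ Fin m → ℝ
  -- The vertices `0, 1, 2, 3` are the elbow `T`, the hole on the bar `uT`, the hole `B` on the bar
  -- `Tv`, and the end `N` of the bar `NB` whose hole is `w`.
  | .inl (g, a), .inl (g', b) => if g = g' then
      (![![0, (1 - P.gs g) * P.gl g, P.gs g * P.gl g, 0], ![(1 - P.gs g) * P.gl g, 0, 0, 0],
        ![P.gs g * P.gl g, 0, 0, P.gl g], ![0, 0, P.gl g, 0]] : Fin 4 → Fin 4 → ℝ) a b else 0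
  | .inl _, .inr _ => 0
  | .inr _, .inl _ => 0
  | .inr _, .inr _ => 0

/-- The symmetric function of the lengths of the edges; `0` if there is no edge. -/
def lenFun : P.Vtx (V := V) (m := m) (n := n) → P.Vtx (V := V) (m := m) (n := n) → ℝ
  | .inl t, .inl t' => P.termLen L t t'
  | .inl t, .inr x => P.outerLen L x t
  | .inr x, .inl t => P.outerLen L x t
  | .inr x, .inr y => P.innerLen x y

theorem lenFun_comm (v w) : P.lenFun L v w = P.lenFun L w v := by
  rcases v with (⟨i, a⟩ | p) | (⟨g, a⟩ | j) <;> rcases w with (⟨i', b⟩ | p') | (⟨g', b⟩ | j') <;>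
    simp only [lenFun, termLen, innerLen]
  · have : (i = i' ∧ L.graph.Adj ((Fintype.equivFin V).symm a) ((Fintype.equivFin V).symm b)) ↔
        (i' = i ∧ L.graph.Adj ((Fintype.equivFin V).symm b) ((Fintype.equivFin V).symm a)) :=
      and_congr eq_comm (L.graph.adj_comm _ _)
    rw [Sym2.eq_swap (a := (Fintype.equivFin V).symm a)]
    split_ifs with h1 h2 h2
    · rfl
    · exact absurd (this.1 h1) h2
    · exact absurd (this.2 h2) h1
    · rfl
  · by_cases h : g = g'
    · subst h
      fin_cases a <;> fin_cases b <;> rfl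
    · rw [if_neg h, if_neg (Ne.symm h)]

theorem lenFun_self (v) : P.lenFun L v v = 0 := by
  rcases v with (⟨i, a⟩ | p) | (⟨g, a⟩ | j) <;> simp only [lenFun, termLen, innerLen]
  · simp
  · fin_cases a <;> simp

/-- The fixed vertices. -/
def IsFixed : P.Vtx (V := V) (m := m) (n := n) → Prop
  | .inl (.inl (_, a)) => ∃ j, L.fixed j = (Fintype.equivFin V).symm a
  -- Both ends of the chain of partial sums are fixed at the same point; closing the chain is what
  -- determines the output.
  | .inl (.inr (.acc _ k)) => k = 0 ∨ k = Fin.last _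
  | .inl (.inr (.near _)) => True
  | .inl (.inr .far) => True
  | .inl (.inr .base) => True
  | _ => False

/-- The positions of the fixed vertices. -/
def pos : P.Vtx (V := V) (m := m) (n := n) → ℂ
  | .inl (.inl (_, a)) => Function.extend L.fixed L.Z 0 ((Fintype.equivFin V).symm a)
  | .inl (.inr (.acc _ _)) => P.far
  -- The center that undoes the translation of the first scaling: `(1 - τ)(-τ a) + τ ((1 - τ) a + τ
  -- z) = τ² z` for `a = 6R`.
  | .inl (.inr (.near i)) => ((- (P.τ i * (6 * P.R)) : ℝ) : ℂ)
  | .inl (.inr .far) => ((6 * P.R : ℝ) : ℂ)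
  | .inl (.inr .base) => ((- (2 * P.R) : ℝ) : ℂ)
  | _ => 0

/-- An inner vertex of a pantograph: the elbow `0`, the three holes and ends `1`, `2`, `3`. -/
abbrev inner (g : Gad m n P.N) (a : Fin 4) : P.Vtx (V := V) (m := m) (n := n) := .inr (.inl (g, a))

/-- The elbow of an arm that restricts the domain. -/
abbrev lim (j : Fin m) : P.Vtx (V := V) (m := m) (n := n) := .inr (.inr j)

/-- The bars with holes. -/
def barSet : Set (P.Vtx (V := V) (m := m) (n := n) × P.Vtx (V := V) (m := m) (n := n) ×
    P.Vtx (V := V) (m := m) (n := n)) :=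
  {x | (∃ i a b c, (a, b, c) ∈ L.bars ∧
      x = (.inl (P.copyT i a), .inl (P.copyT i b), .inl (P.copyT i c))) ∨
    ∃ g, x = (.inl (P.gu g), P.inner g 1, P.inner g 0) ∨
      x = (P.inner g 3, .inl (P.gw L g), P.inner g 2) ∨
      x = (P.inner g 0, P.inner g 2, .inl (P.gv L g))}

theorem lenFun_copy (i : Fin P.N) {v w : V} (h : L.graph.Adj v w) :
    P.lenFun L (.inl (P.copyT i v)) (.inl (P.copyT i w)) = L.len s(v, w) := by
  simp [lenFun, termLen, copyT, h]

section lengths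

variable (g : Gad m n P.N)

theorem lenFun_T_u : P.lenFun L (P.inner g 0) (.inl (P.gu g)) = P.gl g := by
  simp [lenFun, outerLen]
theorem lenFun_T_v : P.lenFun L (P.inner g 0) (.inl (P.gv L g)) = P.gl g := by
  simp [lenFun, outerLen]
theorem lenFun_A_u : P.lenFun L (P.inner g 1) (.inl (P.gu g)) = P.gs g * P.gl g := by
  simp [lenFun, outerLen]
theorem lenFun_A_w : P.lenFun L (P.inner g 1) (.inl (P.gw L g)) = P.gs g * P.gl g := by
  simp [lenFun, outerLen]
theorem lenFun_B_v : P.lenFun L (P.inner g 2) (.inl (P.gv L g)) = (1 - P.gs g) * P.gl g := by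
  simp [lenFun, outerLen]
theorem lenFun_B_w : P.lenFun L (P.inner g 2) (.inl (P.gw L g)) = (1 - P.gs g) * P.gl g := by
  simp [lenFun, outerLen]
theorem lenFun_N_u : P.lenFun L (P.inner g 3) (.inl (P.gu g)) = P.gs g * P.gl g := by
  simp [lenFun, outerLen]
theorem lenFun_N_w : P.lenFun L (P.inner g 3) (.inl (P.gw L g)) = P.gs g * P.gl g := by
  simp [lenFun, outerLen]
theorem lenFun_T_A : P.lenFun L (P.inner g 0) (P.inner g 1) = (1 - P.gs g) * P.gl g := by
  simp [lenFun, innerLen]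
theorem lenFun_T_B : P.lenFun L (P.inner g 0) (P.inner g 2) = P.gs g * P.gl g := by
  simp [lenFun, innerLen]
theorem lenFun_N_B : P.lenFun L (P.inner g 3) (P.inner g 2) = P.gl g := by
  simp [lenFun, innerLen]

end lengths

/-- The expanded linkage. -/
def linkage : IOLinkage (P.Vtx (V := V) (m := m) (n := n)) m n where
  graph :=
    { Adj := fun v w => 0 < P.lenFun L v w
      symm := ⟨fun v w h => by rwa [P.lenFun_comm L]⟩
      loopless := ⟨fun v h => by rw [P.lenFun_self L] at h; exact lt_irrefl _ h⟩ }
  len := Sym2.lift ⟨P.lenFun L, P.lenFun_comm L⟩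
  len_pos := by
    intro e
    induction e using Sym2.ind with
    | _ v w => exact fun h => h
  numFixed := Nat.card {v // P.IsFixed L v}
  fixed := (Finite.equivFin {v // P.IsFixed L v}).symm.toEmbedding.trans (Function.Embedding.subtype _)
  Z := fun j => P.pos L ((Finite.equivFin {v // P.IsFixed L v}).symm j)
  inp := ⟨fun j => .inl (.inr (.inp j)), fun j j' h => by simpa using h⟩
  out := ⟨fun q => .inl (.inr (.out q)), fun q q' h => by simpa using h⟩
  bars := P.barSet L
  bars_spec := by
    have hcomm := P.lenFun_comm L
    rintro a b c (⟨i, a', b', c', h, e⟩ | ⟨g, e | e | e⟩) <;> cases e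
    · obtain ⟨h1, h2, h3, h4⟩ := L.bars_spec _ _ _ h
      simp only [Sym2.lift_mk, lenFun_copy, h1, h2, h3]
      exact ⟨L.len_pos _ h1, L.len_pos _ h2, L.len_pos _ h3, h4⟩
    all_goals
      have h1 := P.gs_pos g
      have h2 := P.gs_lt_one g
      have h3 := P.gl_pos g
      have h4 := mul_pos h1 h3
      have h5 := mul_pos (sub_pos.2 h2) h3
      simp only [Sym2.lift_mk]
    · rw [hcomm (.inl _), hcomm (P.inner g 1) (P.inner g 0), hcomm (.inl _), lenFun_A_u, lenFun_T_A,
        lenFun_T_u]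
      exact ⟨h4, h5, h3, by ring⟩
    · rw [hcomm (.inl _), lenFun_N_w, lenFun_B_w, lenFun_N_B]
      exact ⟨h4, h5, h3, by ring⟩
    · rw [lenFun_T_B, lenFun_B_v, lenFun_T_v]
      exact ⟨h4, h5, h3, by ring⟩

theorem linkage_len (v w) : (P.linkage L).len s(v, w) = P.lenFun L v w := rfl

theorem linkage_adj (v w) : (P.linkage L).graph.Adj v w ↔ 0 < P.lenFun L v w := Iff.rfl

theorem exists_fixed_iff (v) : (∃ j, (P.linkage L).fixed j = v) ↔ P.IsFixed L v := by
  constructor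
  · rintro ⟨j, rfl⟩
    exact ((Finite.equivFin {v // P.IsFixed L v}).symm j).2
  · intro h
    exact ⟨Finite.equivFin {v // P.IsFixed L v} ⟨v, h⟩,
      congrArg Subtype.val (Equiv.symm_apply_apply _ _)⟩

theorem linkage_Z (j) : (P.linkage L).Z j = P.pos L ((P.linkage L).fixed j) := rfl

theorem pos_copyT (i : Fin P.N) (j) : P.pos L (.inl (P.copyT i (L.fixed j))) = L.Z j := by
  simp [pos, copyT, L.fixed.injective.extend_apply]

theorem isFixed_copyT (i : Fin P.N) (v : V) :
    P.IsFixed L (.inl (P.copyT i v)) ↔ ∃ j, L.fixed j = v := by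
  simp [IsFixed, copyT]

theorem isSublinkage (i : Fin P.N) : L.IsSublinkage (P.linkage L)
    ⟨fun v => .inl (P.copyT i v), fun _ _ h => P.copyT_injective i (Sum.inl_injective h)⟩ where
  adj v w h := by
    have h1 := P.lenFun_copy L i h
    exact ⟨by rw [linkage_adj]; exact h1.symm ▸ L.len_pos _ h, h1⟩
  bars a b c h := Or.inl ⟨i, a, b, c, h, rfl⟩
  fixed v := by
    rw [exists_fixed_iff]
    exact (P.isFixed_copyT L i v).symm
  image j j' h := by
    rw [linkage_Z, h]
    exact P.pos_copyT L i j

/-! ### Linear form of the equations -/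

variable (P : Plan) {V : Type*} [Fintype V] {m n : ℕ} (L : IOLinkage V m n)
variable {A : Type*} [CommRing A] [Algebra ℝ A]

theorem dsq_of_sub_eq {U : Type*} {F : U × Fin 2 → A} {a b c d : U} {r : ℝ}
    (h : ∀ i, F (a, i) - F (b, i) = algebraMap ℝ A r * (F (c, i) - F (d, i))) :
    dsq F a b = algebraMap ℝ A (r ^ 2) * dsq F c d := by
  simp only [dsq, h, map_pow]; ring

/-- The linear form of the equations of the expanded linkage. -/
structure IsReduced (F : P.Vtx (V := V) (m := m) (n := n) × Fin 2 → A) : Prop where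
  copy : ∀ i, L.IsPoint fun c => F (.inl (P.copyT i c.1), c.2)
  mark : ∀ v, P.IsFixed L v → F (v, 0) = algebraMap ℝ A (P.pos L v).re ∧
    F (v, 1) = algebraMap ℝ A (P.pos L v).im
  rel : ∀ g i, F (.inl (P.gw L g), i) = algebraMap ℝ A (1 - P.gs g) * F (.inl (P.gu g), i) +
    algebraMap ℝ A (P.gs g) * F (.inl (P.gv L g), i)
  elbow_u : ∀ g, dsq F (P.inner g 0) (.inl (P.gu g)) = algebraMap ℝ A (P.gl g ^ 2)
  elbow_v : ∀ g, dsq F (P.inner g 0) (.inl (P.gv L g)) = algebraMap ℝ A (P.gl g ^ 2)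
  inner_one : ∀ g i, F (P.inner g 1, i) = algebraMap ℝ A (1 - P.gs g) * F (.inl (P.gu g), i) +
    algebraMap ℝ A (P.gs g) * F (P.inner g 0, i)
  inner_two : ∀ g i, F (P.inner g 2, i) = algebraMap ℝ A (1 - P.gs g) * F (P.inner g 0, i) +
    algebraMap ℝ A (P.gs g) * F (.inl (P.gv L g), i)
  inner_three : ∀ g i, F (P.inner g 3, i) = F (.inl (P.gu g), i) + F (P.inner g 2, i) -
    F (P.inner g 0, i)
  lim_base : ∀ j, dsq F (P.lim j) (.inl (.inr .base)) = algebraMap ℝ A ((2 * P.R) ^ 2)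
  lim_inp : ∀ j, dsq F (P.lim j) (.inl (.inr (.inp j))) = algebraMap ℝ A (P.R ^ 2)

variable {P L} {F : P.Vtx (V := V) (m := m) (n := n) × Fin 2 → A}

theorem isPoint_linkage_iff_mark :
    (∀ j, F ((P.linkage L).fixed j, 0) = algebraMap ℝ A ((P.linkage L).Z j).re ∧
      F ((P.linkage L).fixed j, 1) = algebraMap ℝ A ((P.linkage L).Z j).im) ↔
    ∀ v, P.IsFixed L v → F (v, 0) = algebraMap ℝ A (P.pos L v).re ∧
      F (v, 1) = algebraMap ℝ A (P.pos L v).im := by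
  constructor
  · intro h v hv
    obtain ⟨j, rfl⟩ := (P.exists_fixed_iff L v).2 hv
    exact h j
  · exact fun h j => h _ ((P.exists_fixed_iff L _).1 ⟨j, rfl⟩)

/-- By the linear relations every bar of a pantograph is a multiple of one of the two sides of its
elbow, so its length need not be imposed separately. -/
theorem IsReduced.dsq_outer (h : P.IsReduced L F) (x t) (hx : 0 < P.outerLen L x t) :
    dsq F (.inr x) (.inl t) = algebraMap ℝ A (P.outerLen L x t ^ 2) := by
  have e : ∀ g : Gad m n P.N, algebraMap ℝ A (1 - P.gs g) = 1 - algebraMap ℝ A (P.gs g) := fun g => by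
    rw [map_sub, map_one]
  rcases x with ⟨g, a⟩ | j
  · have hu := h.elbow_u g
    have hv := h.elbow_v g
    have h1 := h.inner_one g
    have h2 := h.inner_two g
    have h3 := h.inner_three g
    have hw := h.rel g
    simp only [e] at h1 h2 hw
    fin_cases a <;> simp only [outerLen] at hx ⊢ <;> split_ifs at hx ⊢ with ht
    any_goals exact absurd hx (lt_irrefl _)
    · change dsq F (P.inner g 0) _ = _
      rcases ht with rfl | rfl
      · exact hu
      · exact hv
    · change dsq F (P.inner g 1) _ = _
      rcases ht with rfl | rfl
      · rw [mul_pow, map_mul, ← hu]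
        exact dsq_of_sub_eq fun i => by linear_combination h1 i
      · rw [mul_pow, map_mul, ← hv]
        exact dsq_of_sub_eq fun i => by linear_combination h1 i - hw i
    · change dsq F (P.inner g 2) _ = _
      rcases ht with rfl | rfl
      · rw [mul_pow, map_mul, ← hv]
        exact dsq_of_sub_eq fun i => by rw [e]; linear_combination h2 i
      · rw [mul_pow, map_mul, ← hu]
        exact dsq_of_sub_eq fun i => by rw [e]; linear_combination h2 i - hw i
    · change dsq F (P.inner g 3) _ = _
      rcases ht with rfl | rfl
      · rw [mul_pow, map_mul, ← hv, dsq_comm F (P.inner g 0)]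
        exact dsq_of_sub_eq fun i => by linear_combination h3 i + h2 i
      · rw [mul_pow, map_mul, ← hu, dsq_comm F (P.inner g 0)]
        exact dsq_of_sub_eq fun i => by linear_combination h3 i + h2 i - hw i
  · simp only [outerLen] at hx ⊢
    split_ifs at hx ⊢ with h1 h2
    · subst h1; exact h.lim_base j
    · subst h2; exact h.lim_inp j
    · exact absurd hx (lt_irrefl _)

theorem IsReduced.dsq_inner (h : P.IsReduced L F) (x y) (hx : 0 < P.innerLen x y) :
    dsq F (.inr x) (.inr y) = algebraMap ℝ A (P.innerLen x y ^ 2) := by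
  have e : ∀ g : Gad m n P.N, algebraMap ℝ A (1 - P.gs g) = 1 - algebraMap ℝ A (P.gs g) := fun g => by
    rw [map_sub, map_one]
  have hlt := lt_irrefl (0 : ℝ)
  rcases x with ⟨g, a⟩ | j <;> rcases y with ⟨g', b⟩ | j'
  · simp only [innerLen] at hx ⊢
    by_cases hg : g = g'
    · subst hg
      rw [if_pos rfl] at hx ⊢
      have hu := h.elbow_u g
      have hv := h.elbow_v g
      have h1 := h.inner_one g
      have h2 := h.inner_two g
      have h3 := h.inner_three g
      have e1 : dsq F (P.inner g 0) (P.inner g 1) =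
          algebraMap ℝ A (((1 - P.gs g) * P.gl g) ^ 2) := by
        rw [mul_pow, map_mul, ← hu]
        exact dsq_of_sub_eq fun i => by simp only [e] at h1 ⊢; linear_combination - h1 i
      have e2 : dsq F (P.inner g 0) (P.inner g 2) = algebraMap ℝ A ((P.gs g * P.gl g) ^ 2) := by
        rw [mul_pow, map_mul, ← hv]
        exact dsq_of_sub_eq fun i => by simp only [e] at h2; linear_combination - h2 i
      have e3 : dsq F (P.inner g 3) (P.inner g 2) = algebraMap ℝ A (P.gl g ^ 2) := by
        rw [← hu, dsq_comm F (P.inner g 0)]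
        simp only [dsq, h3]
        ring
      fin_cases a <;> fin_cases b
      all_goals first | exact absurd hx hlt | skip
      · exact e1
      · exact e2
      · exact (dsq_comm F _ _).trans e1
      · exact (dsq_comm F _ _).trans e2
      · exact (dsq_comm F _ _).trans e3
      · exact e3
    · rw [if_neg hg] at hx
      exact absurd hx hlt
  all_goals exact absurd hx hlt

theorem IsReduced.isPoint (h : P.IsReduced L F) : (P.linkage L).IsPoint F := by
  refine ⟨fun v w hvw => ?_, isPoint_linkage_iff_mark.2 h.mark, ?_⟩
  · rw [linkage_adj] at hvw
    rw [linkage_len]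
    rcases v with t | x <;> rcases w with t' | y
    · rcases t with ⟨i, a⟩ | p <;> rcases t' with ⟨i', b⟩ | p' <;>
        simp only [lenFun, termLen] at hvw ⊢
      any_goals exact absurd hvw (lt_irrefl _)
      split_ifs at hvw ⊢ with hi
      · obtain ⟨rfl, hab⟩ := hi
        have := (h.copy i).edge _ _ hab
        simpa [dsq, copyT] using this
      · exact absurd hvw (lt_irrefl _)
    · rw [dsq_comm]
      exact h.dsq_outer y t hvw
    · exact h.dsq_outer x t' hvw
    · exact h.dsq_inner x y hvw
  · have hcomm := P.lenFun_comm L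
    rintro a b c (⟨i, a', b', c', h', e⟩ | ⟨g, e | e | e⟩) i' <;> cases e
    · obtain ⟨h1, h2, h3, h4⟩ := L.bars_spec _ _ _ h'
      simp only [linkage_len, lenFun_copy, h1, h2, h3]
      exact (h.copy i).bar _ _ _ h' i'
    all_goals
      have hl := (P.gl_pos g).ne'
      simp only [linkage_len]
    · rw [hcomm (.inl _), hcomm (P.inner g 1) (P.inner g 0), hcomm (.inl _), lenFun_A_u, lenFun_T_A,
        lenFun_T_u, mul_div_cancel_right₀ _ hl, mul_div_cancel_right₀ _ hl]
      exact h.inner_one g i'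
    · rw [hcomm (.inl _), lenFun_N_w, lenFun_B_w, lenFun_N_B, mul_div_cancel_right₀ _ hl,
        mul_div_cancel_right₀ _ hl, h.rel, h.inner_three, h.inner_two]
      simp only [map_sub, map_one]
      ring
    · rw [lenFun_T_B, lenFun_B_v, lenFun_T_v, mul_div_cancel_right₀ _ hl,
        mul_div_cancel_right₀ _ hl]
      exact h.inner_two g i'

/-- Over rings in which the pantographs are not degenerate the equations are equivalent to their
linear form. -/
theorem isReduced_of_isPoint (h : (P.linkage L).IsPoint F)
    (hreg : ∀ g, ∀ x y : A, x ^ 2 + y ^ 2 = 0 →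
      (F (.inl (P.gu g), 0) - F (P.inner g 0, 0)) * x +
        (F (.inl (P.gu g), 1) - F (P.inner g 0, 1)) * y = 0 →
      (F (.inl (P.gv L g), 0) - F (P.inner g 0, 0)) * x +
        (F (.inl (P.gv L g), 1) - F (P.inner g 0, 1)) * y = 0 → x = 0 ∧ y = 0) :
    P.IsReduced L F := by
  have hedge : ∀ v w, 0 < P.lenFun L v w → dsq F v w = algebraMap ℝ A (P.lenFun L v w ^ 2) :=
    fun v w hvw => h.edge v w hvw
  have hcomm := P.lenFun_comm L
  have hs := fun g : Gad m n P.N => P.gs_pos g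
  have hs1 := fun g : Gad m n P.N => P.gs_lt_one g
  have hl := fun g : Gad m n P.N => P.gl_pos g
  have hsl := fun g : Gad m n P.N => mul_pos (hs g) (hl g)
  have hTu : ∀ g, dsq F (P.inner g 0) (.inl (P.gu g)) = algebraMap ℝ A (P.gl g ^ 2) := fun g => by
    have := hedge (P.inner g 0) (.inl (P.gu g)); rw [lenFun_T_u] at this; exact this (hl g)
  have hTv : ∀ g, dsq F (P.inner g 0) (.inl (P.gv L g)) = algebraMap ℝ A (P.gl g ^ 2) := fun g => by
    have := hedge (P.inner g 0) (.inl (P.gv L g)); rw [lenFun_T_v] at this; exact this (hl g)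
  have hNB : ∀ g, dsq F (P.inner g 3) (P.inner g 2) = algebraMap ℝ A (P.gl g ^ 2) := fun g => by
    have := hedge (P.inner g 3) (P.inner g 2); rw [lenFun_N_B] at this; exact this (hl g)
  have hTB : ∀ g, dsq F (P.inner g 0) (P.inner g 2) = algebraMap ℝ A ((P.gs g * P.gl g) ^ 2) :=
    fun g => by
      have := hedge (P.inner g 0) (P.inner g 2); rw [lenFun_T_B] at this; exact this (hsl g)
  have hNu : ∀ g, dsq F (P.inner g 3) (.inl (P.gu g)) = algebraMap ℝ A ((P.gs g * P.gl g) ^ 2) :=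
    fun g => by
      have := hedge (P.inner g 3) (.inl (P.gu g)); rw [lenFun_N_u] at this; exact this (hsl g)
  have hAw : ∀ g, dsq F (P.inner g 1) (.inl (P.gw L g)) = algebraMap ℝ A ((P.gs g * P.gl g) ^ 2) :=
    fun g => by
      have := hedge (P.inner g 1) (.inl (P.gw L g)); rw [lenFun_A_w] at this; exact this (hsl g)
  have hA : ∀ g i, F (P.inner g 1, i) = algebraMap ℝ A (1 - P.gs g) * F (.inl (P.gu g), i) +
      algebraMap ℝ A (P.gs g) * F (P.inner g 0, i) := fun g i => by
    have := h.bar _ _ _ (Or.inr ⟨g, Or.inl rfl⟩) i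
    rwa [linkage_len, linkage_len, linkage_len, hcomm (.inl _), hcomm (P.inner g 1) (P.inner g 0),
      hcomm (.inl _), lenFun_A_u, lenFun_T_A, lenFun_T_u, mul_div_cancel_right₀ _ (hl g).ne',
      mul_div_cancel_right₀ _ (hl g).ne'] at this
  have hw : ∀ g i, F (.inl (P.gw L g), i) = algebraMap ℝ A (1 - P.gs g) * F (P.inner g 3, i) +
      algebraMap ℝ A (P.gs g) * F (P.inner g 2, i) := fun g i => by
    have := h.bar _ _ _ (Or.inr ⟨g, Or.inr (Or.inl rfl)⟩) i
    rwa [linkage_len, linkage_len, linkage_len, hcomm (.inl _), lenFun_N_w, lenFun_B_w, lenFun_N_B,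
      mul_div_cancel_right₀ _ (hl g).ne', mul_div_cancel_right₀ _ (hl g).ne'] at this
  have hB : ∀ g i, F (P.inner g 2, i) = algebraMap ℝ A (1 - P.gs g) * F (P.inner g 0, i) +
      algebraMap ℝ A (P.gs g) * F (.inl (P.gv L g), i) := fun g i => by
    have := h.bar _ _ _ (Or.inr ⟨g, Or.inr (Or.inr rfl)⟩) i
    rwa [linkage_len, linkage_len, linkage_len, lenFun_T_B, lenFun_B_v, lenFun_T_v,
      mul_div_cancel_right₀ _ (hl g).ne', mul_div_cancel_right₀ _ (hl g).ne'] at this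
  have hpan := fun g => pantograph_relation (A := A) (l := algebraMap ℝ A (P.gl g))
    (u := fun i => F (.inl (P.gu g), i)) (v := fun i => F (.inl (P.gv L g), i))
    (w := fun i => F (.inl (P.gw L g), i)) (T := fun i => F (P.inner g 0, i))
    (P := fun i => F (P.inner g 1, i)) (B := fun i => F (P.inner g 2, i))
    (N := fun i => F (P.inner g 3, i)) (hs g).ne' (hs1 g).ne (hA g) (hw g) (hB g)
    (by rw [← map_pow]; exact hTu g) (by rw [← map_pow]; exact hNB g)
    (by rw [← map_mul, ← map_pow]; exact hTB g) (by rw [← map_mul, ← map_pow]; exact hNu g)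
    (by rw [← map_mul, ← map_pow]; exact hAw g) (hreg g)
  refine ⟨fun i => ⟨fun v w hvw => ?_, fun j => ?_, fun a b c hb i' => ?_⟩,
    isPoint_linkage_iff_mark.1 h.mark, fun g i => (hpan g i).2, hTu, hTv, hA, hB,
    fun g i => (hpan g i).1, fun j => ?_, fun j => ?_⟩
  · have := hedge (.inl (P.copyT i v)) (.inl (P.copyT i w))
    rw [lenFun_copy _ _ _ hvw] at this
    exact this (L.len_pos _ hvw)
  · have := isPoint_linkage_iff_mark.1 h.mark (.inl (P.copyT i (L.fixed j)))
      ((P.isFixed_copyT L i _).2 ⟨j, rfl⟩)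
    rwa [pos_copyT] at this
  · have := h.bar _ _ _ (Or.inl ⟨i, a, b, c, hb, rfl⟩) i'
    obtain ⟨h1, h2, h3, h4⟩ := L.bars_spec _ _ _ hb
    rwa [linkage_len, linkage_len, linkage_len, lenFun_copy _ _ _ h1, lenFun_copy _ _ _ h2,
      lenFun_copy _ _ _ h3] at this
  · have := hedge (P.lim j) (.inl (.inr .base))
    have e : P.lenFun L (P.lim j) (.inl (.inr .base)) = 2 * P.R := by simp [lenFun, outerLen]
    rw [e] at this
    exact this (by have := P.R_pos; positivity)
  · have := hedge (P.lim j) (.inl (.inr (.inp j)))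
    have e : P.lenFun L (P.lim j) (.inl (.inr (.inp j))) = P.R := by simp [lenFun, outerLen]
    rw [e] at this
    exact this P.R_pos

/-! ### Real points in linear form -/

variable (P : Plan) {V : Type*} [Fintype V] {m n : ℕ} (L : IOLinkage V m n)

/-- The equations of the realizations of the expanded linkage. -/
structure IsRealized (φ : P.Vtx (V := V) (m := m) (n := n) → ℂ) : Prop where
  copy : ∀ i, (fun v => φ (.inl (P.copyT i v))) ∈ L.Config
  mark : ∀ v, P.IsFixed L v → φ v = P.pos L v
  rel : ∀ g, φ (.inl (P.gw L g)) =
    (1 - P.gs g) • φ (.inl (P.gu g)) + P.gs g • φ (.inl (P.gv L g))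
  elbow_u : ∀ g, ‖φ (P.inner g 0) - φ (.inl (P.gu g))‖ ^ 2 = P.gl g ^ 2
  elbow_v : ∀ g, ‖φ (P.inner g 0) - φ (.inl (P.gv L g))‖ ^ 2 = P.gl g ^ 2
  inner_one : ∀ g, φ (P.inner g 1) =
    (1 - P.gs g) • φ (.inl (P.gu g)) + P.gs g • φ (P.inner g 0)
  inner_two : ∀ g, φ (P.inner g 2) =
    (1 - P.gs g) • φ (P.inner g 0) + P.gs g • φ (.inl (P.gv L g))
  inner_three : ∀ g, φ (P.inner g 3) =
    φ (.inl (P.gu g)) + φ (P.inner g 2) - φ (P.inner g 0)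
  lim_base : ∀ j, ‖φ (P.lim j) - φ (.inl (.inr .base))‖ ^ 2 = (2 * P.R) ^ 2
  lim_inp : ∀ j, ‖φ (P.lim j) - φ (.inl (.inr (.inp j)))‖ ^ 2 = P.R ^ 2

variable {P L} {φ : P.Vtx (V := V) (m := m) (n := n) → ℂ}

theorem _root_.Linkages.dsq_coords {U : Type*} (φ : U → ℂ) (v w : U) :
    dsq (coords φ) v w = ‖φ v - φ w‖ ^ 2 := by
  rw [← Complex.normSq_eq_norm_sq, Complex.normSq_apply]
  simp only [dsq, coords, if_pos, one_ne_zero, if_false, Complex.sub_re, Complex.sub_im]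
  ring

theorem _root_.Linkages.coords_eq_iff {U : Type*} (φ : U → ℂ) (v : U) (z : ℂ) :
    φ v = z ↔ ∀ i : Fin 2, coords φ (v, i) = if i = 0 then z.re else z.im := by
  constructor
  · rintro rfl i
    rfl
  · intro h
    exact Complex.ext (by simpa [coords] using h 0) (by simpa [coords] using h 1)

theorem isReduced_coords_iff : P.IsReduced L (coords φ) ↔ P.IsRealized L φ := by
  constructor
  · intro h
    refine ⟨fun i => (L.mem_config_iff_isPoint _).2 (h.copy i), fun v hv => ?_, fun g => ?_,
      fun g => ?_, fun g => ?_, fun g => ?_, fun g => ?_, fun g => ?_, fun j => ?_, fun j => ?_⟩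
    · exact Complex.ext (h.mark v hv).1 (h.mark v hv).2
    · exact Complex.ext (by simpa [coords] using h.rel g 0) (by simpa [coords] using h.rel g 1)
    · simpa [dsq_coords] using h.elbow_u g
    · simpa [dsq_coords] using h.elbow_v g
    · exact Complex.ext (by simpa [coords] using h.inner_one g 0)
        (by simpa [coords] using h.inner_one g 1)
    · exact Complex.ext (by simpa [coords] using h.inner_two g 0)
        (by simpa [coords] using h.inner_two g 1)
    · exact Complex.ext (by simpa [coords] using h.inner_three g 0)
        (by simpa [coords] using h.inner_three g 1)
    · simpa [dsq_coords] using h.lim_base j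
    · simpa [dsq_coords] using h.lim_inp j
  · intro h
    refine ⟨fun i => (L.mem_config_iff_isPoint _).1 (h.copy i), fun v hv => ?_, fun g => ?_,
      fun g => ?_, fun g => ?_, fun g => ?_, fun g => ?_, fun g => ?_, fun j => ?_, fun j => ?_⟩
    · simp [coords, h.mark v hv]
    · intro i; fin_cases i <;> simp [coords, h.rel g]
    · simpa [dsq_coords] using h.elbow_u g
    · simpa [dsq_coords] using h.elbow_v g
    · intro i; fin_cases i <;> simp [coords, h.inner_one g]
    · intro i; fin_cases i <;> simp [coords, h.inner_two g]
    · intro i; fin_cases i <;> simp [coords, h.inner_three g]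
    · simpa [dsq_coords] using h.lim_base j
    · simpa [dsq_coords] using h.lim_inp j

/-- Over `ℝ` no nondegeneracy is needed, since `x² + y² = 0` already forces `x = y = 0`. The
estimates for the arms can thus be derived afterwards from the linear form. -/
theorem mem_config_linkage_iff : φ ∈ (P.linkage L).Config ↔ P.IsRealized L φ := by
  rw [IOLinkage.mem_config_iff_isPoint, ← isReduced_coords_iff]
  refine ⟨fun h => isReduced_of_isPoint h fun g x y hxy _ _ => ?_, fun h => h.isPoint⟩
  constructor <;> nlinarith [sq_nonneg x, sq_nonneg y]

/-! ### Solving the linear equations in an arbitrary real vector space -/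

section Linear

variable {M : Type*} [AddCommGroup M] [Module ℝ M]

variable (P) in
/-- The values of the partial sums. -/
def accVal (a : M) (y : Fin (P.N + 1) → M) (k : Fin (P.N + 2)) : M :=
  (P.μ k)⁻¹ • (P.μ 0 • a + ∑ i : Fin (P.N + 1), if i.castSucc < k then P.c i • y i else 0)

variable (P) in
/-- The values at the outputs of the copies and their combination. -/
def sumVal (y : Fin P.N → M) : Fin (P.N + 1) → M :=
  Fin.lastCases (motive := fun _ => M) (∑ i : Fin P.N, P.c i.castSucc • y i) y

variable (P L) in
/-- The terminals, expressed by the inputs, the copies of the given linkage, and the constants. -/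
def termVal (z : Fin m → M) (ψ : Fin P.N → V → M) (a b d : M) : P.Term (V := V) (m := m) (n := n) → M
  | .inl (i, v) => ψ i ((Fintype.equivFin V).symm v)
  | .inr (.inp j) => z j
  | .inr (.mid i j) => (1 - P.τ i) • a + P.τ i • z j
  | .inr (.acc q k) => P.accVal b (P.sumVal fun i => ψ i (L.out q)) k
  | .inr (.out q) => ∑ i : Fin P.N, P.c i.castSucc • ψ i (L.out q)
  | .inr (.near i) => - P.τ i • a
  | .inr .far => a
  | .inr .base => d

theorem accVal_zero (a : M) (y : Fin (P.N + 1) → M) : P.accVal a y 0 = a := by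
  simp [accVal, (P.μ_pos 0).ne']

theorem accVal_succ (a : M) (y : Fin (P.N + 1) → M) (k : Fin (P.N + 1)) :
    P.μ k.succ • P.accVal a y k.succ = P.μ k.castSucc • P.accVal a y k.castSucc + P.c k • y k := by
  have h1 := (P.μ_pos k.succ).ne'
  have h2 := (P.μ_pos k.castSucc).ne'
  rw [accVal, accVal, smul_inv_smul₀ h1, smul_inv_smul₀ h2, add_assoc (P.μ 0 • a)]
  congr 1
  have : ∀ i : Fin (P.N + 1), (if i.castSucc < k.succ then P.c i • y i else 0) =
      (if i.castSucc < k.castSucc then P.c i • y i else 0) + if i = k then P.c i • y i else 0 := by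
    intro i
    rcases lt_trichotomy i k with h | rfl | h
    · have h' : i.castSucc < k.succ := Fin.castSucc_lt_succ_iff.2 h.le
      simp [h, h.ne, h']
    · simp
    · have h' : ¬ i.castSucc < k.succ := by simpa [Fin.castSucc_lt_succ_iff] using h
      simp [h', h.ne', h.le]
  simp only [this, Finset.sum_add_distrib, Finset.sum_ite_eq', Finset.mem_univ, if_true]

/-- Multiplication by the weight of the intermediate point brings both cases for the sign of `c k`
to the same balance of weights. -/
theorem rel_sum_iff (e : P.Term (V := V) (m := m) (n := n) → M) (q : Fin n) (k : Fin (P.N + 1)) :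
    (e (P.gw L (.sum q k)) = (1 - P.gs (.sum q k : Gad m n P.N)) • e (P.gu (.sum q k)) +
      P.gs (.sum q k : Gad m n P.N) • e (P.gv L (.sum q k))) ↔
    P.μ k.succ • e (.inr (.acc q k.succ)) =
      P.μ k.castSucc • e (.inr (.acc q k.castSucc)) + P.c k • e (P.summand L q k) := by
  have h1 := (P.μ_pos k.succ).ne'
  have h2 := (P.μ_pos k.castSucc).ne'
  have h3 := P.μ_succ k
  simp only [gw, gu, gv, gs]
  split_ifs with hc
  · rw [← (smul_right_injective M h1).eq_iff]
    have e1 : P.μ k.succ * (1 - P.c k / P.μ k.succ) = P.μ k.castSucc := by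
      field_simp; linarith
    have e2 : P.μ k.succ * (P.c k / P.μ k.succ) = P.c k := by field_simp
    simp only [smul_add, smul_smul, e1, e2]
  · rw [← (smul_right_injective M h2).eq_iff]
    have e1 : P.μ k.castSucc * (1 - -P.c k / P.μ k.castSucc) = P.μ k.succ := by
      field_simp; linarith
    have e2 : P.μ k.castSucc * (-P.c k / P.μ k.castSucc) = - P.c k := by field_simp
    simp only [smul_add, smul_smul, e1, e2, neg_smul]
    rw [← sub_eq_add_neg, eq_sub_iff_add_eq, eq_comm]

theorem sumVal_castSucc (y : Fin P.N → M) (i : Fin P.N) : P.sumVal y i.castSucc = y i := by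
  simp [sumVal]

theorem sumVal_last (y : Fin P.N → M) :
    P.sumVal y (Fin.last P.N) = ∑ i : Fin P.N, P.c i.castSucc • y i := by
  simp [sumVal]

theorem termVal_copyT (z : Fin m → M) (ψ : Fin P.N → V → M) (a b d : M) (i : Fin P.N) (v : V) :
    P.termVal L z ψ a b d (P.copyT i v) = ψ i v := by
  simp [termVal, copyT]

theorem termVal_summand (z : Fin m → M) (ψ : Fin P.N → V → M) (a b d : M) (q : Fin n)
    (k : Fin (P.N + 1)) :
    P.termVal L z ψ a b d (P.summand L q k) = P.sumVal (fun i => ψ i (L.out q)) k := by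
  refine Fin.lastCases ?_ (fun i => ?_) k
  · simp [summand, sumVal, termVal]
  · simp [summand, sumVal, termVal_copyT]

theorem termVal_rel (z : Fin m → M) (ψ : Fin P.N → V → M) (a b d : M)
    (h : ∀ i j, ψ i (L.inp j) = P.τ i ^ 2 • z j) (g : Gad m n P.N) :
    P.termVal L z ψ a b d (P.gw L g) = (1 - P.gs g) • P.termVal L z ψ a b d (P.gu g) +
      P.gs g • P.termVal L z ψ a b d (P.gv L g) := by
  cases g with
  | scale i j => rfl
  | shift i j =>
    simp only [gw, gu, gv, gs, termVal_copyT, h]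
    simp only [termVal]
    module
  | sum q k =>
    rw [rel_sum_iff, termVal_summand]
    exact accVal_succ _ _ _

/-- The last summand is the combination of the others and enters with the coefficient `-1`, so
everything but the initial term cancels. -/
theorem accVal_last (hc : P.c (Fin.last P.N) = -1) (hμ : P.μ (Fin.last (P.N + 1)) = P.μ 0) (a : M)
    (y : Fin P.N → M) : P.accVal a (P.sumVal y) (Fin.last (P.N + 1)) = a := by
  have : ∑ i : Fin (P.N + 1), (if i.castSucc < Fin.last (P.N + 1) then P.c i • P.sumVal y i else 0)
      = 0 := by
    rw [Fin.sum_univ_castSucc]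
    simp [sumVal_castSucc, sumVal_last, hc, Fin.castSucc_lt_last]
  rw [accVal, this, hμ, add_zero, inv_smul_smul₀ (P.μ_pos 0).ne']

theorem eq_accVal {a : M} {y : Fin (P.N + 1) → M} {w : Fin (P.N + 2) → M} (h0 : w 0 = a)
    (h : ∀ k : Fin (P.N + 1), P.μ k.succ • w k.succ = P.μ k.castSucc • w k.castSucc + P.c k • y k)
    (k : Fin (P.N + 2)) : w k = P.accVal a y k := by
  refine Fin.induction ?_ (fun k ih => ?_) k
  · rw [h0, accVal_zero]
  · have h1 := h k
    rw [ih, ← accVal_succ] at h1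
    exact smul_right_injective M (P.μ_pos k.succ).ne' h1

/-- The linear equations determine the terminals. -/
theorem eq_termVal (hc : P.c (Fin.last P.N) = -1) (hμ : P.μ (Fin.last (P.N + 1)) = P.μ 0)
    {e : P.Term (V := V) (m := m) (n := n) → M} {b : M}
    (h : ∀ g, e (P.gw L g) = (1 - P.gs g) • e (P.gu g) + P.gs g • e (P.gv L g))
    (hnear : ∀ i, e (.inr (.near i)) = - P.τ i • e (.inr .far))
    (h0 : ∀ q, e (.inr (.acc q 0)) = b) (h1 : ∀ q, e (.inr (.acc q (Fin.last _))) = b) :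
    e = P.termVal L (fun j => e (.inr (.inp j))) (fun i v => e (P.copyT i v)) (e (.inr .far)) b
      (e (.inr .base)) ∧ ∀ i j, e (P.copyT i (L.inp j)) = P.τ i ^ 2 • e (.inr (.inp j)) := by
  have hmid : ∀ i j, e (.inr (.mid i j)) =
      (1 - P.τ i) • e (.inr .far) + P.τ i • e (.inr (.inp j)) := fun i j => h (.scale i j)
  have hacc : ∀ q k, e (.inr (.acc q k)) = P.accVal b (fun k => e (P.summand L q k)) k := fun q =>
    eq_accVal (w := fun k => e (.inr (.acc q k))) (h0 q) fun k => (rel_sum_iff e q k).1 (h (.sum q k))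
  have hout : ∀ q, e (.inr (.out q)) = ∑ i : Fin P.N, P.c i.castSucc • e (P.copyT i (L.out q)) := by
    intro q
    have h2 := h1 q
    -- The chain returns to `b` with the initial weight, so the sum of all weighted summands is
    -- zero; the coefficient `-1` isolates the output.
    rw [hacc, accVal, hμ, inv_smul_eq_iff₀ (P.μ_pos 0).ne', add_eq_left, Fin.sum_univ_castSucc]
      at h2
    simp only [Fin.castSucc_lt_last, if_true, hc, summand, Fin.lastCases_castSucc,
      Fin.lastCases_last, neg_smul, one_smul, ← sub_eq_add_neg] at h2
    exact (sub_eq_zero.1 h2).symm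
  constructor
  · ext t
    rcases t with ⟨i, v⟩ | p
    · simp [termVal, copyT]
    · cases p with
      | inp j => rfl
      | mid i j => exact hmid i j
      | acc q k =>
        rw [hacc]
        show P.accVal _ _ _ = P.accVal _ _ _
        congr 1
        ext k
        refine Fin.lastCases ?_ (fun i => ?_) k
        · simp [summand, sumVal, hout]
        · simp [summand, sumVal]
      | out q => exact hout q
      | near i => exact hnear i
      | far => rfl
      | base => rfl
  · intro i j
    have := h (.shift i j)
    simp only [gw, gu, gv, gs, hmid, hnear] at this
    rw [this]
    module

theorem map_termVal {M' : Type*} [AddCommGroup M'] [Module ℝ M'] (l : M →ₗ[ℝ] M') (z : Fin m → M)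
    (ψ : Fin P.N → V → M) (a b d : M) (t) : l (P.termVal L z ψ a b d t) =
      P.termVal L (fun j => l (z j)) (fun i v => l (ψ i v)) (l a) (l b) (l d) t := by
  rcases t with ⟨i, v⟩ | p
  · rfl
  · have hs : ∀ (q : Fin n) k, l (P.sumVal (fun i => ψ i (L.out q)) k) =
        P.sumVal (fun i => l (ψ i (L.out q))) k := fun q k => by
      refine Fin.lastCases ?_ (fun i => ?_) k <;> simp [sumVal]
    cases p <;> simp [termVal, accVal, hs, apply_ite l]

end Linear

end Plan

/-! ### Passage between the field and the plane -/

section Field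

variable {𝕜 : Type*} [RCLike 𝕜]

/-- The inclusion of `𝕜` in the complex numbers as a linear map. -/
def toComplexLM (𝕜 : Type*) [RCLike 𝕜] : 𝕜 →ₗ[ℝ] ℂ where
  toFun := toComplex
  map_add' x y := by apply Complex.ext <;> simp [toComplex]
  map_smul' a x := by apply Complex.ext <;> simp [toComplex, RCLike.smul_re, RCLike.smul_im]

theorem toComplex_smul (a : ℝ) (x : 𝕜) : toComplex (a • x) = a • toComplex x :=
  (toComplexLM 𝕜).map_smul a x

theorem ofComplex_smul (a : ℝ) (z : ℂ) : ofComplex 𝕜 (a • z) = a • ofComplex 𝕜 z :=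
  (ofComplexLM 𝕜).map_smul a z

theorem ofComplex_toComplex (x : 𝕜) : ofComplex 𝕜 (toComplex x) = x := RCLike.re_add_im x

theorem norm_toComplex (x : 𝕜) : ‖toComplex x‖ = ‖x‖ := by
  rw [← sq_eq_sq₀ (norm_nonneg _) (norm_nonneg _), ← Complex.normSq_eq_norm_sq,
    Complex.normSq_apply, RCLike.norm_sq_eq_def]
  rfl

end Field

/-! ### Arms: triangles with two given sides -/

section Arm

/-- Four times the square of the area of the triangle with the sides `a`, `b`, `√D`. -/
def armDisc (a b D : ℝ) : ℝ := D * a ^ 2 - ((D + a ^ 2 - b ^ 2) / 2) ^ 2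

/-- The elbow of an arm with the ends `u`, `v`, in terms of the signed area. -/
def elbowPt (A B β : ℝ) (u v : ℂ) : ℂ :=
  u + (v - u) * (⟨(Complex.normSq (v - u) + A - B) / 2, β⟩ / (Complex.normSq (v - u) : ℂ))

/-- The two positions of the elbow of an arm with the lengths `a`, `b`. -/
def armPt (a b ς : ℝ) (u v : ℂ) : ℂ :=
  elbowPt (a ^ 2) (b ^ 2) (ς * √(armDisc a b (Complex.normSq (v - u)))) u v

/-- Twice the signed area of a triangle. -/
def area (u v T : ℂ) : ℝ := (T - u).im * (v - u).re - (T - u).re * (v - u).im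

/-- In the frame of `v - u`, the component of `T - u` along the base is given by the squared sides
and the normal component by the signed area. -/
theorem eq_elbowPt {u v : ℂ} (h : u ≠ v) (T : ℂ) :
    T = elbowPt (Complex.normSq (T - u)) (Complex.normSq (T - v)) (area u v T) u v := by
  have hD : Complex.normSq (v - u) ≠ 0 := by simpa [sub_eq_zero] using h.symm
  rw [elbowPt, ← sub_eq_iff_eq_add']
  have hD' : ((Complex.normSq (v - u) : ℝ) : ℂ) ≠ 0 := by exact_mod_cast hD
  rw [← mul_div_assoc, eq_div_iff hD']
  apply Complex.ext <;> simp [Complex.normSq_apply, area] <;> ring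

theorem area_sq (u v T : ℂ) : area u v T ^ 2 = Complex.normSq (v - u) * Complex.normSq (T - u) -
    ((Complex.normSq (v - u) + Complex.normSq (T - u) - Complex.normSq (T - v)) / 2) ^ 2 := by
  simp [Complex.normSq_apply, area]; ring

theorem normSq_elbowPt {A B β : ℝ} {u v : ℂ} (h : u ≠ v)
    (hβ : β ^ 2 = Complex.normSq (v - u) * A - ((Complex.normSq (v - u) + A - B) / 2) ^ 2) :
    Complex.normSq (elbowPt A B β u v - u) = A ∧ Complex.normSq (elbowPt A B β u v - v) = B := by
  have hD : Complex.normSq (v - u) ≠ 0 := by simpa [sub_eq_zero] using h.symm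
  have e : elbowPt A B β u v - v = (v - u) * (⟨(Complex.normSq (v - u) + A - B) / 2 -
      Complex.normSq (v - u), β⟩ / (Complex.normSq (v - u) : ℂ)) := by
    have hD' : ((Complex.normSq (v - u) : ℝ) : ℂ) ≠ 0 := by exact_mod_cast hD
    have : (⟨(Complex.normSq (v - u) + A - B) / 2 - Complex.normSq (v - u), β⟩ : ℂ) =
      ⟨(Complex.normSq (v - u) + A - B) / 2, β⟩ - (Complex.normSq (v - u) : ℂ) := by
        apply Complex.ext <;> simp
    rw [this, sub_div, div_self hD', elbowPt]
    ring
  rw [e, elbowPt, add_sub_cancel_left]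
  simp only [Complex.normSq_mul, Complex.normSq_div, Complex.normSq_ofReal]
  generalize Complex.normSq (v - u) = D at *
  simp only [Complex.normSq_mk]
  constructor
  · field_simp
    linear_combination 4 * hβ
  · field_simp
    linear_combination 4 * hβ

/-- The sides determine the square of the signed area, so only its sign is left free. -/
theorem exists_eq_armPt {a b : ℝ} {u v T : ℂ} (h : u ≠ v) (ha : ‖T - u‖ ^ 2 = a ^ 2)
    (hb : ‖T - v‖ ^ 2 = b ^ 2) : ∃ ς : ℤˣ, T = armPt a b (ς : ℤ) u v := by
  rw [← Complex.normSq_eq_norm_sq] at ha hb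
  have h1 := eq_elbowPt h T
  have h2 := area_sq u v T
  rw [ha, hb] at h1 h2
  have h3 : armDisc a b (Complex.normSq (v - u)) = area u v T ^ 2 := h2.symm
  rcases abs_choice (area u v T) with h4 | h4
  · refine ⟨1, ?_⟩
    rw [armPt, h3, Real.sqrt_sq_eq_abs, h4]
    simpa using h1
  · refine ⟨-1, ?_⟩
    rw [armPt, h3, Real.sqrt_sq_eq_abs, h4]
    simpa using h1

theorem norm_armPt {a b : ℝ} {u v : ℂ} (h : u ≠ v)
    (h0 : 0 ≤ armDisc a b (Complex.normSq (v - u))) (ς : ℤˣ) :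
    ‖armPt a b (ς : ℤ) u v - u‖ ^ 2 = a ^ 2 ∧ ‖armPt a b (ς : ℤ) u v - v‖ ^ 2 = b ^ 2 := by
  rw [← Complex.normSq_eq_norm_sq, ← Complex.normSq_eq_norm_sq]
  refine normSq_elbowPt h ?_
  have h1 : ((ς : ℤ) : ℝ) ^ 2 = 1 := by
    rcases Int.units_eq_one_or ς with rfl | rfl <;> norm_num
  rw [mul_pow, h1, Real.sq_sqrt h0, one_mul, armDisc]

/-- Heron's factorization: the sign of the discriminant is governed by the triangle inequalities. -/
theorem armDisc_eq (a b d : ℝ) : armDisc a b (d ^ 2) =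
    (d + a + b) * (d + a - b) * ((b + d - a) * (a + b - d)) / 4 := by
  rw [armDisc]; ring

theorem armDisc_nonneg {a b d : ℝ} (h1 : a ≤ b + d) (h2 : b ≤ d + a) (h3 : d ≤ a + b)
    (hd : 0 ≤ d) (ha : 0 ≤ a) (hb : 0 ≤ b) : 0 ≤ armDisc a b (d ^ 2) := by
  have := sub_nonneg.2 h1
  have := sub_nonneg.2 h2
  have := sub_nonneg.2 h3
  rw [armDisc_eq]
  positivity

theorem armDisc_pos {a b d : ℝ} (h1 : a < b + d) (h2 : b < d + a) (h3 : d < a + b)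
    (hd : 0 < d) (ha : 0 < a) (hb : 0 < b) : 0 < armDisc a b (d ^ 2) := by
  have := sub_pos.2 h1
  have := sub_pos.2 h2
  have := sub_pos.2 h3
  rw [armDisc_eq]
  positivity

end Arm

/-! ### Parametrization of the realizations -/

namespace Plan

variable (P : Plan) {V : Type*} [Fintype V] {m n : ℕ} (L : IOLinkage V m n)
variable {𝕜 : Type*} [RCLike 𝕜]

/-- The terminals of the realizations of the expanded linkage. -/
def term (z : Fin m → ℂ) (ψ : Fin P.N → V → ℂ) : P.Term (V := V) (m := m) (n := n) → ℂ :=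
  P.termVal L z ψ ((6 * P.R : ℝ) : ℂ) P.far ((- (2 * P.R) : ℝ) : ℂ)

/-- The arms of the expanded linkage. -/
abbrev Arm (m n N : ℕ) : Type := Gad m n N ⊕ Fin m

/-- The first end of an arm. -/
def au : Arm m n P.N → P.Term (V := V) (m := m) (n := n)
  | .inl g => P.gu g
  | .inr _ => .inr .base

/-- The second end of an arm. -/
def av : Arm m n P.N → P.Term (V := V) (m := m) (n := n)
  | .inl g => P.gv L g
  | .inr j => .inr (.inp j)

/-- The first length of an arm. -/
def aa : Arm m n P.N → ℝ
  | .inl g => P.gl g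
  | .inr _ => 2 * P.R

/-- The second length of an arm. -/
def ab : Arm m n P.N → ℝ
  | .inl g => P.gl g
  | .inr _ => P.R

/-- The elbow of an arm. -/
def elbow : Arm m n P.N → P.Vtx (V := V) (m := m) (n := n)
  | .inl g => P.inner g 0
  | .inr j => P.lim j

/-- The map with given terminals and elbows that satisfies the linear equations. -/
def assemble {M : Type*} [AddCommGroup M] [Module ℝ M]
    (e : P.Term (V := V) (m := m) (n := n) → M) (T : Arm m n P.N → M) :
    P.Vtx (V := V) (m := m) (n := n) → M
  | .inl t => e t
  | .inr (.inl (g, 0)) => T (.inl g)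
  | .inr (.inl (g, 1)) => (1 - P.gs g) • e (P.gu g) + P.gs g • T (.inl g)
  | .inr (.inl (g, 2)) => (1 - P.gs g) • T (.inl g) + P.gs g • e (P.gv L g)
  | .inr (.inl (g, 3)) =>
    e (P.gu g) + ((1 - P.gs g) • T (.inl g) + P.gs g • e (P.gv L g)) - T (.inl g)
  | .inr (.inr j) => T (.inr j)

/-- The realization with given inputs, copies of the given linkage, and signs of the arms. -/
def build (ς : Arm m n P.N → ℤˣ) (z : Fin m → ℂ) (ψ : Fin P.N → V → ℂ) :
    P.Vtx (V := V) (m := m) (n := n) → ℂ :=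
  P.assemble L (P.term L z ψ) fun a =>
    armPt (P.aa a) (P.ab a) (ς a : ℤ) (P.term L z ψ (P.au a)) (P.term L z ψ (P.av L a))

/-- The requirements on the numerical data. -/
structure IsGood (F : EuclideanSpace 𝕜 (Fin m) → EuclideanSpace 𝕜 (Fin n)) : Prop where
  N_pos : 0 < P.N
  c_last : P.c (Fin.last P.N) = -1
  μ_last : P.μ (Fin.last (P.N + 1)) = P.μ 0
  -- The bound `5R` follows from `|x_j + 2R| ≤ 3R`; the conditions are imposed on this larger
  -- polydisc.
  exists_lift : ∀ x : EuclideanSpace 𝕜 (Fin m), (∀ j, ‖x j‖ ≤ 5 * P.R) → ∀ i,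
    ∃ ψ ∈ L.Config, L.inputMap 𝕜 ψ = P.τ i ^ 2 • x
  hasSection : ∀ x : EuclideanSpace 𝕜 (Fin m), (∀ j, ‖x j‖ ≤ 5 * P.R) → ∀ i,
    ∀ ψ ∈ L.Config, L.inputMap 𝕜 ψ = P.τ i ^ 2 • x → L.HasSection 𝕜 ψ
  sum_eq : ∀ x q, F x q = ∑ i : Fin P.N, P.c i.castSucc • F (P.τ i ^ 2 • x) q
  nondeg : ∀ x : EuclideanSpace 𝕜 (Fin m), (∀ j, ‖x j‖ ≤ 5 * P.R) → ∀ q k l,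
    let y := P.sumVal fun i => toComplex (F (P.τ i ^ 2 • x) q)
    0 < ‖P.accVal (P.far : ℂ) y k - y l‖ ∧ ‖P.accVal (P.far : ℂ) y k - y l‖ < 2 * P.bar

/-- The domain of the expanded linkage. -/
def InDom (x : EuclideanSpace 𝕜 (Fin m)) : Prop :=
  ∀ j, P.R ≤ ‖toComplex (x j) + (2 * P.R : ℝ)‖ ∧ ‖toComplex (x j) + (2 * P.R : ℝ)‖ ≤ 3 * P.R

/-- The copies of the given linkage are realized over the rescaled inputs. -/
def Lifts (x : EuclideanSpace 𝕜 (Fin m)) (ψ : Fin P.N → V → ℂ) : Prop :=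
  ∀ i, ψ i ∈ L.Config ∧ L.inputMap 𝕜 (ψ i) = P.τ i ^ 2 • x

variable {P L} {F : EuclideanSpace 𝕜 (Fin m) → EuclideanSpace 𝕜 (Fin n)}
  {φ : P.Vtx (V := V) (m := m) (n := n) → ℂ} {x : EuclideanSpace 𝕜 (Fin m)}
  {ψ : Fin P.N → V → ℂ}

theorem norm_le_of_add_le {z : ℂ} (h : ‖z + (2 * P.R : ℝ)‖ ≤ 3 * P.R) : ‖z‖ ≤ 5 * P.R := by
  have h1 := norm_sub_le (z + (2 * P.R : ℝ)) ((2 * P.R : ℝ) : ℂ)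
  have h2 : ‖((2 * P.R : ℝ) : ℂ)‖ = 2 * P.R := by
    rw [Complex.norm_real, Real.norm_of_nonneg]
    have := P.R_pos
    positivity
  rw [add_sub_cancel_right, h2] at h1
  linarith

theorem InDom.norm_le (h : P.InDom x) (j : Fin m) : ‖x j‖ ≤ 5 * P.R := by
  rw [← norm_toComplex]
  exact norm_le_of_add_le (h j).2

theorem Lifts.apply_inp {O} (hL : L.IsFunctional 𝕜 F O) (h : P.Lifts L x ψ) (i : Fin P.N) (j) :
    ψ i (L.inp j) = P.τ i ^ 2 • toComplex (x j) := by
  rw [hL.input_mem _ (h i).1, (h i).2, ← toComplex_smul]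
  rfl

theorem Lifts.apply_out {O} (hL : L.IsFunctional 𝕜 F O) (h : P.Lifts L x ψ) (i : Fin P.N) (q) :
    ψ i (L.out q) = toComplex (F (P.τ i ^ 2 • x) q) := by
  rw [hL.output_eq _ (h i).1, (h i).2]

theorem Lifts.term_out {O} (hL : L.IsFunctional 𝕜 F O) (hP : P.IsGood L F) (h : P.Lifts L x ψ)
    (z : Fin m → ℂ) (q : Fin n) : P.term L z ψ (.inr (.out q)) = toComplex (F x q) := by
  rw [hP.sum_eq]
  simp only [term, termVal, h.apply_out hL, ← toComplex_smul]
  exact (map_sum (toComplexLM 𝕜) _ _).symm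

/-- The arms are not degenerate. -/
theorem arm_bounds {O} (hL : L.IsFunctional 𝕜 F O) (hP : P.IsGood L F) (hx : P.InDom x)
    (h : P.Lifts L x ψ) (g : Gad m n P.N) :
    0 < ‖P.term L (fun j => toComplex (x j)) ψ (P.gv L g) -
      P.term L (fun j => toComplex (x j)) ψ (P.gu g)‖ ∧
    ‖P.term L (fun j => toComplex (x j)) ψ (P.gv L g) -
      P.term L (fun j => toComplex (x j)) ψ (P.gu g)‖ < 2 * P.gl g := by
  have hR := P.R_pos
  -- This is why the centers use `6R`: the distance of the ends stays between `R` and `11R`, while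
  -- the arm reaches to `12R`.
  have key : ∀ z : ℂ, ‖z‖ ≤ 5 * P.R → ∀ t : ℝ, 0 ≤ t → t ≤ 1 →
      0 < ‖((6 * P.R : ℝ) : ℂ) + t • z‖ ∧ ‖((6 * P.R : ℝ) : ℂ) + t • z‖ < 2 * (6 * P.R) := by
    intro z hz t h0 h1
    have h2 : ‖((6 * P.R : ℝ) : ℂ)‖ = 6 * P.R := by
      rw [Complex.norm_real, Real.norm_of_nonneg (by positivity)]
    have h3 : ‖t • z‖ ≤ 5 * P.R := by
      rw [norm_smul, Real.norm_of_nonneg h0]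
      nlinarith [norm_nonneg z]
    have h4 := norm_add_le ((6 * P.R : ℝ) : ℂ) (t • z)
    have h5 := norm_sub_le_norm_add ((6 * P.R : ℝ) : ℂ) (t • z)
    rw [h2] at h4 h5
    constructor <;> linarith
  cases g with
  | scale i j =>
    have hj := hx j
    have e : P.term L (fun j => toComplex (x j)) ψ (P.gv L (.scale i j)) -
        P.term L (fun j => toComplex (x j)) ψ (P.gu (.scale i j)) =
        (toComplex (x j) + (2 * P.R : ℝ)) - ((8 * P.R : ℝ) : ℂ) := by
      simp only [term, gu, gv, termVal]
      push_cast
      ring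
    have h2 : ‖((8 * P.R : ℝ) : ℂ)‖ = 8 * P.R := by
      rw [Complex.norm_real, Real.norm_of_nonneg (by positivity)]
    rw [e, gl]
    have h4 := norm_sub_le (toComplex (x j) + (2 * P.R : ℝ)) ((8 * P.R : ℝ) : ℂ)
    have h5 := norm_sub_norm_le ((8 * P.R : ℝ) : ℂ) (toComplex (x j) + (2 * P.R : ℝ))
    rw [norm_sub_rev] at h5
    rw [h2] at h4 h5
    constructor <;> linarith
  | shift i j =>
    have e : P.term L (fun j => toComplex (x j)) ψ (P.gv L (.shift i j)) -
        P.term L (fun j => toComplex (x j)) ψ (P.gu (.shift i j)) =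
        ((6 * P.R : ℝ) : ℂ) + P.τ i • toComplex (x j) := by
      simp only [term, gu, gv, termVal]
      module
    rw [e]
    refine key _ ?_ _ (P.τ_pos i).le (P.τ_lt_one i).le
    rw [norm_toComplex]
    exact hx.norm_le j
  | sum q k =>
    have hy : (fun i => ψ i (L.out q)) = fun i => toComplex (F (P.τ i ^ 2 • x) q) :=
      funext fun i => h.apply_out hL i q
    have := fun k' => hP.nondeg x hx.norm_le q k' k
    simp only [← hy] at this
    have hv : P.term L (fun j => toComplex (x j)) ψ (P.gv L (.sum q k)) =
      P.sumVal (fun i => ψ i (L.out q)) k := termVal_summand _ _ _ _ _ _ _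
    rw [hv, norm_sub_rev]
    simp only [gu]
    split_ifs
    · exact this _
    · exact this _

theorem term_sub_ne {O} (hL : L.IsFunctional 𝕜 F O) (hP : P.IsGood L F) (hx : P.InDom x)
    (h : P.Lifts L x ψ) (a : Arm m n P.N) :
    P.term L (fun j => toComplex (x j)) ψ (P.au a) ≠
      P.term L (fun j => toComplex (x j)) ψ (P.av L a) := by
  intro e
  rcases a with g | j
  · have := (arm_bounds hL hP hx h g).1
    simp only [au, av] at e
    rw [e, sub_self, norm_zero] at this
    exact lt_irrefl _ this
  · have h1 := (hx j).1
    simp only [term, au, av, termVal] at e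
    rw [← e] at h1
    simp only [Complex.ofReal_neg, neg_add_cancel, norm_zero] at h1
    exact absurd P.R_pos (not_lt.2 h1)

theorem armDisc_term_nonneg {O} (hL : L.IsFunctional 𝕜 F O) (hP : P.IsGood L F) (hx : P.InDom x)
    (h : P.Lifts L x ψ) (a : Arm m n P.N) :
    0 ≤ armDisc (P.aa a) (P.ab a) (Complex.normSq (P.term L (fun j => toComplex (x j)) ψ (P.av L a) -
      P.term L (fun j => toComplex (x j)) ψ (P.au a))) := by
  have hR := P.R_pos
  rw [Complex.normSq_eq_norm_sq]
  rcases a with g | j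
  · obtain ⟨h1, h2⟩ := arm_bounds hL hP hx h g
    have := P.gl_pos g
    simp only [au, av, aa, ab]
    exact armDisc_nonneg (by linarith) (by linarith) (by linarith) h1.le this.le this.le
  · obtain ⟨h1, h2⟩ := hx j
    simp only [au, av, aa, ab, term, termVal, Complex.ofReal_neg, sub_neg_eq_add]
    exact armDisc_nonneg (by linarith) (by linarith) (by linarith) (by linarith) (by linarith)
      hR.le

/-- The arms of the pantographs are never degenerate; the limiting arms fold or stretch only on the
boundary of the domain, which `hx'` excludes. -/
theorem armDisc_term_pos {O} (hL : L.IsFunctional 𝕜 F O) (hP : P.IsGood L F) (hx : P.InDom x)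
    (h : P.Lifts L x ψ) (hx' : ∀ j, P.R < ‖toComplex (x j) + (2 * P.R : ℝ)‖ ∧
      ‖toComplex (x j) + (2 * P.R : ℝ)‖ < 3 * P.R) (a : Arm m n P.N) :
    0 < armDisc (P.aa a) (P.ab a) (Complex.normSq (P.term L (fun j => toComplex (x j)) ψ (P.av L a) -
      P.term L (fun j => toComplex (x j)) ψ (P.au a))) := by
  have hR := P.R_pos
  rw [Complex.normSq_eq_norm_sq]
  rcases a with g | j
  · obtain ⟨h1, h2⟩ := arm_bounds hL hP hx h g
    have := P.gl_pos g
    simp only [au, av, aa, ab]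
    exact armDisc_pos (by linarith) (by linarith) (by linarith) h1 this this
  · obtain ⟨h1, h2⟩ := hx' j
    simp only [au, av, aa, ab, term, termVal, Complex.ofReal_neg, sub_neg_eq_add]
    exact armDisc_pos (by linarith) (by linarith) (by linarith) (by linarith) (by linarith) hR

theorem term_mark (h : P.Lifts L x ψ) (hP : P.IsGood L F) (z : Fin m → ℂ)
    (t : P.Term (V := V) (m := m) (n := n)) (ht : P.IsFixed L (.inl t)) :
    P.term L z ψ t = P.pos L (.inl t) := by
  rcases t with ⟨i, v⟩ | p
  · obtain ⟨j, hj⟩ := ht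
    simp only [term, termVal, pos]
    rw [← hj, (h i).1.2, L.fixed.injective.extend_apply]
  · cases p with
    | inp j => exact ht.elim
    | mid i j => exact ht.elim
    | acc q k =>
      simp only [term, termVal, pos]
      rcases ht with rfl | rfl
      · exact accVal_zero _ _
      · exact accVal_last hP.c_last hP.μ_last _ _
    | out q => exact ht.elim
    | near i =>
      simp only [term, termVal, pos]
      push_cast
      rw [neg_smul, Complex.real_smul]
    | far => rfl
    | base => rfl

theorem build_copyT (ς : Arm m n P.N → ℤˣ) (z : Fin m → ℂ) (ψ : Fin P.N → V → ℂ) (i : Fin P.N) :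
    (fun v => P.build L ς z ψ (.inl (P.copyT i v))) = ψ i := by
  ext v
  simp only [build, assemble, term, termVal_copyT]

theorem isRealized_build {O} (hL : L.IsFunctional 𝕜 F O) (hP : P.IsGood L F) (hx : P.InDom x)
    (h : P.Lifts L x ψ) (ς : Arm m n P.N → ℤˣ) :
    P.IsRealized L (P.build L ς (fun j => toComplex (x j)) ψ) := by
  have hT := fun a => norm_armPt (term_sub_ne hL hP hx h a) (armDisc_term_nonneg hL hP hx h a) (ς a)
  refine ⟨fun i => ?_, fun v hv => ?_, fun g => ?_, fun g => (hT (.inl g)).1, fun g => (hT (.inl g)).2,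
    fun g => rfl, fun g => rfl, fun g => rfl, fun j => (hT (.inr j)).1, fun j => (hT (.inr j)).2⟩
  · rw [build_copyT]
    exact (h i).1
  · rcases v with t | t
    · exact term_mark h hP _ t hv
    · simp [IsFixed] at hv
  · exact termVal_rel _ _ _ _ _ (fun i j => h.apply_inp hL i j) g

theorem inputMap_build (ς : Arm m n P.N → ℤˣ) (x : EuclideanSpace 𝕜 (Fin m)) (ψ : Fin P.N → V → ℂ) :
    (P.linkage L).inputMap 𝕜 (P.build L ς (fun j => toComplex (x j)) ψ) = x := by
  ext j
  exact ofComplex_toComplex _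

theorem IsRealized.term_eq (hP : P.IsGood L F) (h : P.IsRealized L φ) :
    (fun t => φ (.inl t)) = P.term L (fun j => φ (.inl (.inr (.inp j))))
        (fun i v => φ (.inl (P.copyT i v))) ∧
      ∀ i j, φ (.inl (P.copyT i (L.inp j))) = P.τ i ^ 2 • φ (.inl (.inr (.inp j))) := by
  have hf : φ (.inl (.inr .far)) = ((6 * P.R : ℝ) : ℂ) := h.mark (.inl (.inr .far)) trivial
  have hb : φ (.inl (.inr .base)) = ((- (2 * P.R) : ℝ) : ℂ) := h.mark (.inl (.inr .base)) trivial
  have := eq_termVal (L := L) hP.c_last hP.μ_last (e := fun t => φ (.inl t)) (b := (P.far : ℂ)) h.rel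
    (fun i => ?_) (fun q => h.mark (.inl (.inr (.acc q 0))) (Or.inl rfl))
    (fun q => h.mark (.inl (.inr (.acc q (Fin.last _)))) (Or.inr rfl))
  · simp only [hf, hb] at this
    exact this
  · have h1 : φ (.inl (.inr (.near i))) = ((- (P.τ i * (6 * P.R)) : ℝ) : ℂ) :=
      h.mark (.inl (.inr (.near i))) trivial
    simp only [h1, hf]
    rw [neg_smul, Complex.real_smul]
    push_cast
    ring

/-- The linear equations determine the other vertices. -/
theorem IsRealized.eq_assemble (h : P.IsRealized L φ) : φ = P.assemble L (fun t => φ (.inl t)) fun a => φ (P.elbow a) := by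
  ext v
  rcases v with t | ⟨g, a⟩ | j
  · rfl
  · match a with
    | 0 => rfl
    | 1 => exact h.inner_one g
    | 2 => exact h.inner_two g
    | 3 => exact (h.inner_three g).trans (by rw [h.inner_two g]; rfl)
  · rfl

/-- The inputs, the copies of the given linkage, and signs determine the realizations. -/
theorem IsRealized.exists_build {O} (hL : L.IsFunctional 𝕜 F O) (hP : P.IsGood L F)
    (h : P.IsRealized L φ) :
    (∀ j, φ (.inl (.inr (.inp j))) = toComplex ((P.linkage L).inputMap 𝕜 φ j)) ∧
    P.InDom ((P.linkage L).inputMap 𝕜 φ) ∧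
    P.Lifts L ((P.linkage L).inputMap 𝕜 φ) (fun i v => φ (.inl (P.copyT i v))) ∧
    ∃ ς, φ = P.build L ς (fun j => toComplex ((P.linkage L).inputMap 𝕜 φ j))
      (fun i v => φ (.inl (P.copyT i v))) := by
  obtain ⟨h1, h2⟩ := h.term_eq hP
  have hin : ∀ j, φ (.inl (.inr (.inp j))) = toComplex ((P.linkage L).inputMap 𝕜 φ j) := by
    intro j
    -- The expanded linkage has no device of its own that keeps its inputs in `𝕜`. A positive
    -- multiple of the input is an input of the first copy, whose inputs are in `𝕜`; this needs at
    -- least one copy.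
    have h3 := hL.input_mem _ (h.copy ⟨0, hP.N_pos⟩) j
    have hτ := (pow_pos (P.τ_pos ⟨0, hP.N_pos⟩) 2).ne'
    rw [IOLinkage.inputMap_apply, h2, ofComplex_smul, toComplex_smul] at h3
    exact smul_right_injective ℂ hτ h3
  have hR := P.R_pos
  have hdom : P.InDom ((P.linkage L).inputMap 𝕜 φ) := by
    intro j
    rw [← hin]
    have hb : φ (.inl (.inr .base)) = ((- (2 * P.R) : ℝ) : ℂ) := h.mark (.inl (.inr .base)) trivial
    have h3 := (pow_left_inj₀ (norm_nonneg _) (by positivity) two_ne_zero).1 (h.lim_base j)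
    have h4 := (pow_left_inj₀ (norm_nonneg _) hR.le two_ne_zero).1 (h.lim_inp j)
    have e : φ (.inl (.inr (.inp j))) + (2 * P.R : ℝ) =
        (φ (P.lim j) - φ (.inl (.inr .base))) - (φ (P.lim j) - φ (.inl (.inr (.inp j)))) := by
      rw [hb]; push_cast; ring
    have h5 := norm_sub_le (φ (P.lim j) - φ (.inl (.inr .base)))
      (φ (P.lim j) - φ (.inl (.inr (.inp j))))
    have h6 := norm_sub_norm_le (φ (P.lim j) - φ (.inl (.inr .base)))
      (φ (P.lim j) - φ (.inl (.inr (.inp j))))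
    rw [← e, h3, h4] at h5 h6
    constructor <;> linarith
  have hlift : P.Lifts L ((P.linkage L).inputMap 𝕜 φ) (fun i v => φ (.inl (P.copyT i v))) := by
    refine fun i => ⟨h.copy i, ?_⟩
    ext j
    rw [IOLinkage.inputMap_apply]
    simp only [h2, ofComplex_smul]
    rfl
  simp only [hin] at h1
  refine ⟨hin, hdom, hlift, ?_⟩
  have hu : ∀ t, φ (.inl t) = _ := fun t => congrFun h1 t
  have hne := term_sub_ne hL hP hdom hlift
  have harm : ∀ a : Arm m n P.N, ∃ ς : ℤˣ, φ (P.elbow a) =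
      armPt (P.aa a) (P.ab a) (ς : ℤ) (φ (.inl (P.au a))) (φ (.inl (P.av L a))) := by
    intro a
    have := hne a
    rw [← hu, ← hu] at this
    rcases a with g | j
    · exact exists_eq_armPt this (h.elbow_u g) (h.elbow_v g)
    · exact exists_eq_armPt this (h.lim_base j) (h.lim_inp j)
  choose ς hς using harm
  refine ⟨ς, ?_⟩
  have hT : ∀ a, armPt (P.aa a) (P.ab a) (ς a : ℤ)
      (P.term L (fun j => toComplex ((P.linkage L).inputMap 𝕜 φ j))
        (fun i v => φ (.inl (P.copyT i v))) (P.au a))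
      (P.term L (fun j => toComplex ((P.linkage L).inputMap 𝕜 φ j))
        (fun i v => φ (.inl (P.copyT i v))) (P.av L a)) = φ (P.elbow a) := fun a => by
    rw [hς, ← hu, ← hu]
  rw [build]
  simp only [hT]
  rw [← h1]
  exact h.eq_assemble

end Plan

/-! ### Equations of the scheme as congruences -/

/-- The retraction of `ℂ^m` onto `𝕜^m`. -/
def ofComplexCLM (𝕜 : Type*) [RCLike 𝕜] (m : ℕ) : (Fin m → ℂ) →L[ℝ] EuclideanSpace 𝕜 (Fin m) :=
  LinearMap.toContinuousLinearMap
    ((WithLp.linearEquiv 2 ℝ (Fin m → 𝕜)).symm.toLinearMap ∘ₗ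
      LinearMap.pi fun i => ofComplexLM 𝕜 ∘ₗ LinearMap.proj i)

/-- The inclusion of `𝕜^m` in `ℂ^m`. -/
def toComplexCLM (𝕜 : Type*) [RCLike 𝕜] (m : ℕ) : EuclideanSpace 𝕜 (Fin m) →L[ℝ] (Fin m → ℂ) :=
  LinearMap.toContinuousLinearMap
    ((LinearMap.pi fun i => toComplexLM 𝕜 ∘ₗ LinearMap.proj i) ∘ₗ
      (WithLp.linearEquiv 2 ℝ (Fin m → 𝕜)).toLinearMap)

namespace IOLinkage

variable {V : Type*} [Fintype V] {m n : ℕ} {L : IOLinkage V m n} {φ : V → ℂ}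

theorem cong_of_ofPoly_eq {p q : MvPolynomial (V × Fin 2) ℝ} (h : L.ofPoly p = L.ofPoly q)
    (hφ : φ ∈ L.Config) : L.Cong φ (fun ψ => MvPolynomial.aeval (coords ψ) p)
      fun ψ => MvPolynomial.aeval (coords ψ) q := by
  rw [cong_real_iff]
  simpa using inAnalyticIdeal_of_ofPoly_eq_zero (q := p - q) (by rw [map_sub, h, sub_self]) hφ

theorem cong_linear {v a b c : V} {r s t : ℝ} (hφ : φ ∈ L.Config)
    (h : ∀ i, L.coordFun (v, i) = algebraMap ℝ _ r * L.coordFun (a, i) +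
      algebraMap ℝ _ s * L.coordFun (b, i) + algebraMap ℝ _ t * L.coordFun (c, i)) :
    L.Cong φ (fun ψ => ψ v) fun ψ => r • ψ a + s • ψ b + t • ψ c := by
  have := fun i => cong_of_ofPoly_eq (L := L) (p := MvPolynomial.X (v, i))
    (q := MvPolynomial.C r * MvPolynomial.X (a, i) + MvPolynomial.C s * MvPolynomial.X (b, i) +
      MvPolynomial.C t * MvPolynomial.X (c, i))
    (by simpa [ofPoly_eq_aeval] using h i) hφ
  exact Cong.complex (by simpa [Linkages.coords] using this 0)
    (by simpa [Linkages.coords] using this 1)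

theorem cong_const {v : V} {z : ℂ} (hφ : φ ∈ L.Config)
    (h : L.coordFun (v, 0) = algebraMap ℝ _ z.re ∧ L.coordFun (v, 1) = algebraMap ℝ _ z.im) :
    L.Cong φ (fun ψ => ψ v) fun _ => z := by
  have h0 := cong_of_ofPoly_eq (L := L) (p := MvPolynomial.X (v, 0)) (q := MvPolynomial.C z.re)
    (by simpa [ofPoly_eq_aeval] using h.1) hφ
  have h1 := cong_of_ofPoly_eq (L := L) (p := MvPolynomial.X (v, 1)) (q := MvPolynomial.C z.im)
    (by simpa [ofPoly_eq_aeval] using h.2) hφ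
  exact Cong.complex (by simpa [Linkages.coords] using h0) (by simpa [Linkages.coords] using h1)

theorem cong_normSq {v w : V} {r : ℝ} (hφ : φ ∈ L.Config)
    (h : dsq L.coordFun v w = algebraMap ℝ _ r) :
    L.Cong φ (fun ψ => Complex.normSq (ψ v - ψ w)) fun _ => r := by
  have := cong_of_ofPoly_eq (L := L) (q := MvPolynomial.C r)
    (p := (MvPolynomial.X (v, 0) - MvPolynomial.X (w, 0)) ^ 2 +
      (MvPolynomial.X (v, 1) - MvPolynomial.X (w, 1)) ^ 2)
    (by simpa [ofPoly_eq_aeval, dsq] using h) hφ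
  simpa [Linkages.coords, Complex.normSq_apply, ← sq] using this

variable (L φ) in
/-- The functions that vanish on the scheme near `φ`. -/
def congSubmodule : Submodule ℝ ((V → ℂ) → ℂ) where
  carrier := {u | L.Cong φ u 0}
  zero_mem' := Cong.refl 0
  add_mem' {u w} hu hw l := ((hu l).add (hw l)).congr <| Eventually.of_forall fun ψ => by simp
  smul_mem' a u hu l := ((hu l).mul_left (a := fun _ => a) analyticAt_const).congr <|
    Eventually.of_forall fun ψ => by
      show l (a • u ψ - 0) = a * l (u ψ - 0)
      rw [sub_zero, sub_zero, map_smul, smul_eq_mul]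

/-- Congruences become equalities in a real vector space, so that `eq_termVal` applies to functions
modulo the equations. -/
theorem cong_iff_mkQ_eq {u w : (V → ℂ) → ℂ} : L.Cong φ u w ↔
    (L.congSubmodule φ).mkQ u = (L.congSubmodule φ).mkQ w := by
  rw [Submodule.mkQ_apply, Submodule.mkQ_apply, Submodule.Quotient.eq]
  show _ ↔ L.Cong φ (u - w) 0
  simp [Cong]

end IOLinkage

/-! ### Analytic and continuous dependence of the elbow on its ends -/

section ArmAnalytic

theorem analyticAt_normSq {E : Type*} [NormedAddCommGroup E] [NormedSpace ℝ E] {f : E → ℂ} {x : E}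
    (hf : AnalyticAt ℝ f x) : AnalyticAt ℝ (fun y => Complex.normSq (f y)) x := by
  have h0 : AnalyticAt ℝ (fun y => (f y).re) x := (Complex.reCLM.analyticAt _).comp hf
  have h1 : AnalyticAt ℝ (fun y => (f y).im) x := (Complex.imCLM.analyticAt _).comp hf
  simp only [Complex.normSq_apply]
  exact (h0.fun_mul h0).fun_add (h1.fun_mul h1)

theorem analyticAt_elbowPt {E : Type*} [NormedAddCommGroup E] [NormedSpace ℝ E] {A B β : E → ℝ}
    {u v : E → ℂ} {x : E} (hA : AnalyticAt ℝ A x) (hB : AnalyticAt ℝ B x) (hβ : AnalyticAt ℝ β x)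
    (hu : AnalyticAt ℝ u x) (hv : AnalyticAt ℝ v x) (h : u x ≠ v x) :
    AnalyticAt ℝ (fun y => elbowPt (A y) (B y) (β y) (u y) (v y)) x := by
  have hD := analyticAt_normSq (hv.fun_sub hu)
  have hof : ∀ {f : E → ℝ}, AnalyticAt ℝ f x → AnalyticAt ℝ (fun y => (f y : ℂ)) x := fun hf =>
    (Complex.ofRealCLM.analyticAt _).comp hf
  have hn : ((Complex.normSq (v x - u x) : ℝ) : ℂ) ≠ 0 := by
    simpa [sub_eq_zero] using h.symm
  have hre : AnalyticAt ℝ (fun y => (Complex.normSq (v y - u y) + A y - B y) / 2) x :=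
    ((hD.fun_add hA).fun_sub hB).fun_div analyticAt_const two_ne_zero
  simp only [elbowPt, Complex.mk_eq_add_mul_I]
  exact hu.fun_add ((hv.fun_sub hu).fun_mul
    (((hof hre).fun_add ((hof hβ).fun_mul analyticAt_const)).fun_div (hof hD) hn))

theorem analyticAt_area {E : Type*} [NormedAddCommGroup E] [NormedSpace ℝ E]
    {u v T : E → ℂ} {x : E} (hu : AnalyticAt ℝ u x) (hv : AnalyticAt ℝ v x)
    (hT : AnalyticAt ℝ T x) : AnalyticAt ℝ (fun y => area (u y) (v y) (T y)) x := by
  have hre : ∀ {f : E → ℂ}, AnalyticAt ℝ f x → AnalyticAt ℝ (fun y => (f y).re) x := fun hf =>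
    (Complex.reCLM.analyticAt _).comp hf
  have him : ∀ {f : E → ℂ}, AnalyticAt ℝ f x → AnalyticAt ℝ (fun y => (f y).im) x := fun hf =>
    (Complex.imCLM.analyticAt _).comp hf
  exact ((him (hT.fun_sub hu)).fun_mul (hre (hv.fun_sub hu))).fun_sub
    ((hre (hT.fun_sub hu)).fun_mul (him (hv.fun_sub hu)))

theorem analyticAt_armDisc {E : Type*} [NormedAddCommGroup E] [NormedSpace ℝ E] {a b : ℝ}
    {D : E → ℝ} {x : E} (hD : AnalyticAt ℝ D x) : AnalyticAt ℝ (fun y => armDisc a b (D y)) x := by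
  simp only [armDisc]
  exact (hD.fun_mul analyticAt_const).fun_sub
    ((((hD.fun_add analyticAt_const).fun_sub analyticAt_const).fun_div analyticAt_const
      two_ne_zero).fun_pow 2)

theorem analyticAt_sqrt {E : Type*} [NormedAddCommGroup E] [NormedSpace ℝ E]
    {f : E → ℝ} {x : E} (hf : AnalyticAt ℝ f x) (h : f x ≠ 0) :
    AnalyticAt ℝ (fun y => √(f y)) x :=
  ((Real.contDiffAt_sqrt h).analyticAt).fun_comp hf

theorem analyticAt_armPt {E : Type*} [NormedAddCommGroup E] [NormedSpace ℝ E] {a b ς : ℝ}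
    {u v : E → ℂ} {x : E} (hu : AnalyticAt ℝ u x) (hv : AnalyticAt ℝ v x) (h : u x ≠ v x)
    (h' : armDisc a b (Complex.normSq (v x - u x)) ≠ 0) :
    AnalyticAt ℝ (fun y => armPt a b ς (u y) (v y)) x :=
  analyticAt_elbowPt analyticAt_const analyticAt_const
    (analyticAt_const.fun_mul (analyticAt_sqrt (analyticAt_armDisc
      (analyticAt_normSq (hv.fun_sub hu))) h')) hu hv h

/-- No condition on the discriminant: continuity persists at folded and stretched arms, which is
needed on the boundary of the domain. -/
theorem continuousAt_armPt {X : Type*} [TopologicalSpace X] {a b ς : ℝ}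
    {u v : X → ℂ} {x : X} (hu : ContinuousAt u x) (hv : ContinuousAt v x) (h : u x ≠ v x) :
    ContinuousAt (fun y => armPt a b ς (u y) (v y)) x := by
  have hn : ((Complex.normSq (v x - u x) : ℝ) : ℂ) ≠ 0 := by
    simpa [sub_eq_zero] using h.symm
  have hD : ContinuousAt (fun y => Complex.normSq (v y - u y)) x :=
    Complex.continuous_normSq.continuousAt.comp (hv.sub hu)
  have hs : ContinuousAt (fun y => ς * √(armDisc a b (Complex.normSq (v y - u y)))) x := by
    simp only [armDisc]
    exact continuousAt_const.mul (((hD.mul continuousAt_const).sub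
      ((((hD.add continuousAt_const).sub continuousAt_const).div_const 2).pow 2)).sqrt)
  have hof : ∀ {f : X → ℝ}, ContinuousAt f x → ContinuousAt (fun y => (f y : ℂ)) x := fun hf =>
    Complex.continuous_ofReal.continuousAt.comp hf
  simp only [armPt, elbowPt, Complex.mk_eq_add_mul_I]
  exact hu.add ((hv.sub hu).mul ((((hof (((hD.add continuousAt_const).sub
    continuousAt_const).div_const 2)).add ((hof hs).mul continuousAt_const)).div (hof hD) hn)))

end ArmAnalytic

namespace IOLinkage

variable {V : Type*} [Fintype V] {m n : ℕ} {L : IOLinkage V m n} {φ : V → ℂ}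

/-- Near a nondegenerate arm its elbow is an analytic function of its ends on the scheme. -/
theorem cong_armPt {u v T : V} {U W : (V → ℂ) → ℂ} {a b : ℝ} {ς : ℤˣ} (hφ : φ ∈ L.Config)
    (hu : L.Cong φ (fun ψ => ψ u) U) (hv : L.Cong φ (fun ψ => ψ v) W)
    (hU : AnalyticAt ℝ U φ) (hW : AnalyticAt ℝ W φ)
    (ha : L.Cong φ (fun ψ => Complex.normSq (ψ T - ψ u)) fun _ => a ^ 2)
    (hb : L.Cong φ (fun ψ => Complex.normSq (ψ T - ψ v)) fun _ => b ^ 2)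
    (hne : φ u ≠ φ v) (hpos : 0 < armDisc a b (Complex.normSq (φ v - φ u)))
    (hT : φ T = armPt a b (ς : ℤ) (φ u) (φ v)) :
    L.Cong φ (fun ψ => ψ T) fun ψ => armPt a b (ς : ℤ) (U ψ) (W ψ) := by
  have hς : ((ς : ℤ) : ℝ) ^ 2 = 1 := by
    rcases Int.units_eq_one_or ς with rfl | rfl <;> norm_num
  have ev : ∀ w : V, AnalyticAt ℝ (fun ψ : V → ℂ => ψ w) φ := fun w =>
    (ContinuousLinearMap.proj (R := ℝ) (φ := fun _ : V => ℂ) w).analyticAt φ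
  have hUφ : φ u = U φ := hu.eventually_eq.self_of_nhds hφ
  have hWφ : φ v = W φ := hv.eventually_eq.self_of_nhds hφ
  have haφ : Complex.normSq (φ T - φ u) = a ^ 2 := ha.eventually_eq.self_of_nhds hφ
  have hbφ : Complex.normSq (φ T - φ v) = b ^ 2 := hb.eventually_eq.self_of_nhds hφ
  have hareaφ : area (φ u) (φ v) (φ T) = (ς : ℤ) * √(armDisc a b (Complex.normSq (φ v - φ u))) := by
    rw [hT]
    have hD : Complex.normSq (φ v - φ u) ≠ 0 := by simpa [sub_eq_zero] using hne.symm
    simp only [area, armPt, elbowPt, add_sub_cancel_left, ← Complex.ofReal_inv, div_eq_mul_inv,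
      Complex.mul_re, Complex.mul_im, Complex.ofReal_re, Complex.ofReal_im]
    generalize √(armDisc a b (Complex.normSq (φ v - φ u))) = β
    rw [Complex.normSq_apply, ← sq, ← sq] at hD ⊢
    field_simp
    ring
  have hE : AnalyticAt ℝ (fun ψ => (Complex.normSq (ψ T - ψ u), Complex.normSq (ψ T - ψ v), ψ u,
      ψ v)) φ :=
    (analyticAt_normSq ((ev T).fun_sub (ev u))).prod
      ((analyticAt_normSq ((ev T).fun_sub (ev v))).prod ((ev u).prod (ev v)))
  have hE' : AnalyticAt ℝ (fun ψ => (a ^ 2, b ^ 2, U ψ, W ψ)) φ :=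
    analyticAt_const.prod (analyticAt_const.prod (hU.prod hW))
  have hEc := ha.prodMk (hb.prodMk (hu.prodMk hv))
  have hEφ : (Complex.normSq (φ T - φ u), Complex.normSq (φ T - φ v), φ u, φ v) =
      (a ^ 2, b ^ 2, U φ, W φ) := by rw [haφ, hbφ, hUφ, hWφ]
  -- the square of the area
  have hsq : L.Cong φ (fun ψ => area (ψ u) (ψ v) (ψ T) ^ 2)
      fun ψ => armDisc a b (Complex.normSq (W ψ - U ψ)) := by
    have h1 := hEc.comp (f := fun e : ℝ × ℝ × ℂ × ℂ => Complex.normSq (e.2.2.2 - e.2.2.1) * e.1 -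
      ((Complex.normSq (e.2.2.2 - e.2.2.1) + e.1 - e.2.1) / 2) ^ 2) ?_ hE hE' hEφ
    · simpa only [← area_sq, armDisc] using h1
    · have p1 : AnalyticAt ℝ (fun e : ℝ × ℝ × ℂ × ℂ => e.1) (Complex.normSq (φ T - φ u),
        Complex.normSq (φ T - φ v), φ u, φ v) := analyticAt_fst
      have p2 : AnalyticAt ℝ (fun e : ℝ × ℝ × ℂ × ℂ => e.2.1) (Complex.normSq (φ T - φ u),
        Complex.normSq (φ T - φ v), φ u, φ v) := analyticAt_fst.fun_comp analyticAt_snd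
      have p3 : AnalyticAt ℝ (fun e : ℝ × ℝ × ℂ × ℂ => e.2.2.2 - e.2.2.1)
        (Complex.normSq (φ T - φ u), Complex.normSq (φ T - φ v), φ u, φ v) :=
        (analyticAt_snd.fun_comp (analyticAt_snd.fun_comp analyticAt_snd)).fun_sub
          (analyticAt_fst.fun_comp (analyticAt_snd.fun_comp analyticAt_snd))
      have p4 := analyticAt_normSq p3
      exact (p4.fun_mul p1).fun_sub ((((p4.fun_add p1).fun_sub p2).fun_div analyticAt_const
        two_ne_zero).fun_pow 2)
  have hH := analyticAt_armDisc (a := a) (b := b) (analyticAt_normSq (hW.fun_sub hU))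
  have hposU : 0 < armDisc a b (Complex.normSq (W φ - U φ)) := by rwa [← hUφ, ← hWφ]
  have hS : AnalyticAt ℝ (fun ψ => ((ς : ℤ) : ℝ) * √(armDisc a b (Complex.normSq (W ψ - U ψ)))) φ :=
    analyticAt_const.fun_mul (analyticAt_sqrt hH hposU.ne')
  have hA := analyticAt_area (ev u) (ev v) (ev T)
  -- The squares of the two sides are congruent. Their sum does not vanish at `φ`, where both have
  -- the same value, so it can be divided out of the difference of squares. This selects the branch
  -- of the root.
  have hroot : L.Cong φ (fun ψ => area (ψ u) (ψ v) (ψ T))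
      fun ψ => ((ς : ℤ) : ℝ) * √(armDisc a b (Complex.normSq (W ψ - U ψ))) := by
    rw [cong_real_iff]
    have hsum : area (φ u) (φ v) (φ T) +
        ((ς : ℤ) : ℝ) * √(armDisc a b (Complex.normSq (W φ - U φ))) ≠ 0 := by
      rw [hareaφ, ← hUφ, ← hWφ, ← two_mul]
      have h2 : ((ς : ℤ) : ℝ) ≠ 0 := by
        intro h0; rw [h0] at hς; norm_num at hς
      exact mul_ne_zero two_ne_zero (mul_ne_zero h2 (Real.sqrt_pos.2 hpos).ne')
    have hinv := (hA.fun_add hS).fun_inv hsum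
    refine ((cong_real_iff.1 hsq).mul_left hinv).congr ?_
    filter_upwards [(hA.fun_add hS).continuousAt.eventually_ne hsum,
      hH.continuousAt.eventually (lt_mem_nhds hposU)] with ψ h1 h2
    have h3 : armDisc a b (Complex.normSq (W ψ - U ψ)) =
        (((ς : ℤ) : ℝ) * √(armDisc a b (Complex.normSq (W ψ - U ψ)))) ^ 2 := by
      rw [mul_pow, hς, Real.sq_sqrt h2.le, one_mul]
    rw [eq_inv_mul_iff_mul_eq₀ h1]
    nth_rewrite 3 [h3]
    ring
  have hfin := (hEc.prodMk hroot).comp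
    (f := fun e : (ℝ × ℝ × ℂ × ℂ) × ℝ => elbowPt e.1.1 e.1.2.1 e.2 e.1.2.2.1 e.1.2.2.2) ?_
    (hE.prod hA) (hE'.prod hS) (Prod.ext hEφ (by rw [hareaφ, ← hUφ, ← hWφ]))
  · refine (Cong.of_eventuallyEq ?_).trans hfin
    have : ∀ᶠ ψ in 𝓝 φ, ψ u - ψ v ≠ 0 :=
      ((ev u).fun_sub (ev v)).continuousAt.eventually_ne (sub_ne_zero.2 hne)
    filter_upwards [this] with ψ hψ
    exact eq_elbowPt (sub_ne_zero.1 hψ) _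
  · exact analyticAt_elbowPt (analyticAt_fst.fun_comp analyticAt_fst)
      (analyticAt_fst.fun_comp (analyticAt_snd.fun_comp analyticAt_fst)) analyticAt_snd
      (analyticAt_fst.fun_comp (analyticAt_snd.fun_comp (analyticAt_snd.fun_comp analyticAt_fst)))
      (analyticAt_snd.fun_comp (analyticAt_snd.fun_comp (analyticAt_snd.fun_comp analyticAt_fst)))
      hne

end IOLinkage
-- Regularity over the interior of the domain
namespace Plan

variable {P : Plan} {V : Type*} [Fintype V] {m n : ℕ} {L : IOLinkage V m n}
variable {𝕜 : Type*} [RCLike 𝕜] {F : EuclideanSpace 𝕜 (Fin m) → EuclideanSpace 𝕜 (Fin n)}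
  {O : EuclideanSpace 𝕜 (Fin m)}

theorem IsRealized.area_ne_zero {φ : P.Vtx (V := V) (m := m) (n := n) → ℂ}
    (hL : L.IsFunctional 𝕜 F O) (hP : P.IsGood L F) (h : P.IsRealized L φ) (g : Gad m n P.N) :
    area (φ (.inl (P.gu g))) (φ (.inl (P.gv L g))) (φ (P.inner g 0)) ≠ 0 := by
  obtain ⟨hin, hdom, hlift, -⟩ := h.exists_build hL hP
  obtain ⟨h1, h2⟩ := arm_bounds hL hP hdom hlift g
  have ht := (h.term_eq hP).1
  simp only [hin] at ht
  have ht' : ∀ t, φ (.inl t) = _ := fun t => congrFun ht t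
  rw [← ht', ← ht'] at h1 h2
  have hl := P.gl_pos g
  have h3 := armDisc_pos (a := P.gl g) (b := P.gl g) (by linarith) (by linarith) (by linarith) h1
    hl hl
  intro h0
  have h4 := area_sq (φ (.inl (P.gu g))) (φ (.inl (P.gv L g))) (φ (P.inner g 0))
  simp only [Complex.normSq_eq_norm_sq, h.elbow_u, h.elbow_v] at h4
  rw [h0] at h4
  rw [armDisc, ← h4] at h3
  norm_num at h3

/-- The determinant of the two linear equations for `(x, y)` is up to sign the signed area at the
elbow. It has no real zeros, hence is a unit, and Cramer's rule gives `x = y = 0` in the presence of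
nilpotents. -/
theorem isReduced_coordFun (hL : L.IsFunctional 𝕜 F O) (hP : P.IsGood L F) :
    P.IsReduced L (P.linkage L).coordFun := by
  refine isReduced_of_isPoint (P.linkage L).isPoint_coordFun fun g x y _ h1 h2 => ?_
  set X := (P.linkage L).coordFun
  set u := P.gu (m := m) (n := n) (V := V) g
  set v := P.gv L g
  have hΔ : IsUnit ((X (.inl u, 0) - X (P.inner g 0, 0)) * (X (.inl v, 1) - X (P.inner g 0, 1)) -
      (X (.inl u, 1) - X (P.inner g 0, 1)) * (X (.inl v, 0) - X (P.inner g 0, 0))) := by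
    refine (P.linkage L).isUnit_of_evalRat_ne_zero fun φ => ?_
    have := (mem_config_linkage_iff.1 φ.2).area_ne_zero hL hP g
    intro h0
    apply this
    simp only [map_sub, map_mul, X, IOLinkage.evalRat_coordFun, coords, if_pos, one_ne_zero,
      if_false] at h0
    rw [area, ← h0]
    simp only [Complex.sub_re, Complex.sub_im]
    ring
  constructor
  · refine hΔ.mul_right_eq_zero.1 ?_
    linear_combination (X (.inl v, 1) - X (P.inner g 0, 1)) * h1 -
      (X (.inl u, 1) - X (P.inner g 0, 1)) * h2
  · refine hΔ.mul_right_eq_zero.1 ?_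
    linear_combination (X (.inl u, 0) - X (P.inner g 0, 0)) * h2 -
      (X (.inl v, 0) - X (P.inner g 0, 0)) * h1

section Inclusion

variable (hR : P.IsReduced L (P.linkage L).coordFun)

/-- The functions on the scheme of the given linkage as functions on the scheme of the expanded
linkage, by means of one of the copies. -/
def incl (i : Fin P.N) : L.RatRing →ₐ[ℝ] (P.linkage L).RatRing :=
  L.ratLift (fun c => (P.linkage L).coordFun (.inl (P.copyT i c.1), c.2))
    ((L.isPoint_iff _).1 (hR.copy i))

theorem incl_coordFun (i : Fin P.N) (c : V × Fin 2) :
    incl hR i (L.coordFun c) = (P.linkage L).coordFun (.inl (P.copyT i c.1), c.2) :=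
  L.ratLift_coordFun _ _ c

variable {φ : P.Vtx (V := V) (m := m) (n := n) → ℂ} (hφ : φ ∈ (P.linkage L).Config)

include hφ in
theorem cong_pullMap_incl (i : Fin P.N) : (P.linkage L).Cong φ
    (fun χ => IOLinkage.pullMap (incl hR i) χ) fun χ v => χ (.inl (P.copyT i v)) := by
  refine IOLinkage.Cong.pi fun v => ?_
  have h : ∀ i', (P.linkage L).Cong φ (fun χ => coords (IOLinkage.pullMap (incl hR i) χ) (v, i'))
      fun χ => coords χ (.inl (P.copyT i v), i') := fun i' => ?_
  · exact IOLinkage.Cong.complex (by simpa [coords] using h 0) (by simpa [coords] using h 1)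
  simp only [IOLinkage.coords_pullMap, incl_coordFun]
  have := IOLinkage.cong_ratFun_ofPoly (L := P.linkage L)
    (MvPolynomial.X (.inl (P.copyT i v), i')) hφ
  simpa [IOLinkage.ofPoly_X] using this

include hφ in
theorem pullMap_incl (i : Fin P.N) :
    IOLinkage.pullMap (incl hR i) φ = fun v => φ (.inl (P.copyT i v)) := by
  have : FiniteDimensional ℝ (V → ℂ) := inferInstance
  exact (cong_pullMap_incl hR hφ i).eventually_eq.self_of_nhds hφ

include hφ in
theorem cong_linkage_two {v a b : P.Vtx (V := V) (m := m) (n := n)} {s t : ℝ}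
    (h : ∀ i, (P.linkage L).coordFun (v, i) = algebraMap ℝ _ s * (P.linkage L).coordFun (a, i) +
      algebraMap ℝ _ t * (P.linkage L).coordFun (b, i)) :
    (P.linkage L).Cong φ (fun ψ => ψ v) fun ψ => s • ψ a + t • ψ b := by
  simpa using IOLinkage.cong_linear (L := P.linkage L) (c := b) (t := 0) hφ
    (fun i => by rw [map_zero, zero_mul, add_zero]; exact h i)

include hR hφ in
/-- The terminals in terms of sections of the input maps of the copies. -/
theorem cong_term (hL : L.IsFunctional 𝕜 F O) (hP : P.IsGood L F)
    {s : Fin P.N → EuclideanSpace 𝕜 (Fin m) → V → ℂ}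
    (hs : ∀ i, AnalyticAt ℝ (s i) (P.τ i ^ 2 • (P.linkage L).inputMap 𝕜 φ))
    (hsec : ∀ i, ∀ᶠ y in 𝓝 (P.τ i ^ 2 • (P.linkage L).inputMap 𝕜 φ),
      s i y ∈ L.Config ∧ L.inputMap 𝕜 (s i y) = y)
    (hc : ∀ i, L.Cong (fun v => φ (.inl (P.copyT i v))) (fun ψ => ψ)
      fun ψ => s i (L.inputMap 𝕜 ψ)) (t : P.Term (V := V) (m := m) (n := n)) :
    (P.linkage L).Cong φ (fun χ => χ (.inl t)) fun χ =>
      P.term L (fun j => toComplex ((P.linkage L).inputMap 𝕜 χ j))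
        (fun i => s i (P.τ i ^ 2 • (P.linkage L).inputMap 𝕜 χ)) t := by
  set L' := P.linkage L with hL'
  set p := L'.inputMap 𝕜 with hp
  obtain ⟨hin, hdom, hlift, -⟩ := (mem_config_linkage_iff.1 hφ).exists_build hL hP
  -- In this quotient the terminals satisfy the linear equations exactly.
  set Q := (L'.congSubmodule φ).mkQ with hQ
  let E : P.Term (V := V) (m := m) (n := n) → (P.Vtx (V := V) (m := m) (n := n) → ℂ) → ℂ :=
    fun t χ => χ (.inl t)
  have hconst : ∀ v, P.IsFixed L v → L'.Cong φ (fun χ => χ v) fun _ => P.pos L v := fun v hv =>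
    IOLinkage.cong_const hφ (hR.mark v hv)
  have hE := eq_termVal (L := L) hP.c_last hP.μ_last (e := fun t => Q (E t))
    (b := Q fun _ => (P.far : ℂ)) (fun g => ?_) (fun i => ?_)
    (fun q => IOLinkage.cong_iff_mkQ_eq.1 (hconst (.inl (.inr (.acc q 0))) (Or.inl rfl)))
    (fun q => IOLinkage.cong_iff_mkQ_eq.1 (hconst (.inl (.inr (.acc q (Fin.last _)))) (Or.inr rfl)))
  rotate_left
  · rw [← map_smul, ← map_smul, ← map_add]
    exact IOLinkage.cong_iff_mkQ_eq.1 (cong_linkage_two hφ (hR.rel g))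
  · rw [← map_smul]
    refine IOLinkage.cong_iff_mkQ_eq.1 ((hconst (.inl (.inr (.near i))) trivial).trans ?_)
    have h1 := (hconst (.inl (.inr .far)) trivial).symm.clm
      ((- P.τ i) • ContinuousLinearMap.id ℝ ℂ)
    refine (IOLinkage.Cong.of_eventuallyEq (Eventually.of_forall fun χ => ?_)).trans h1
    simp [pos]
  obtain ⟨hE, hinp⟩ := hE
  -- the inputs of the copies
  have hpi : ∀ i, L'.Cong φ (fun χ => L.inputMap 𝕜 fun v => χ (.inl (P.copyT i v)))
      fun χ => P.τ i ^ 2 • p χ := by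
    intro i
    have h1 : L'.Cong φ (fun χ j => χ (.inl (P.copyT i (L.inp j))))
        fun χ j => P.τ i ^ 2 • χ (.inl (.inr (.inp j))) := IOLinkage.Cong.pi fun j => by
      refine IOLinkage.cong_iff_mkQ_eq.2 ((hinp i j).trans ?_)
      exact (map_smul Q _ _).symm
    refine (h1.clm (ofComplexCLM 𝕜 m)).trans (IOLinkage.Cong.of_eventuallyEq ?_)
    exact Eventually.of_forall fun χ => (ofComplexCLM 𝕜 m).map_smul _ fun j => χ (.inl (.inr (.inp j)))
  have hpan : AnalyticAt ℝ p φ := L'.analyticAt_inputMap 𝕜 φ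
  have hτp : ∀ i, AnalyticAt ℝ (fun χ => P.τ i ^ 2 • p χ) φ := fun i =>
    analyticAt_const.fun_smul hpan
  have hcopy : ∀ i, L'.Cong φ (fun χ v => χ (.inl (P.copyT i v))) fun χ => s i (P.τ i ^ 2 • p χ) := by
    intro i
    have h1 := cong_pullMap_incl hR hφ i
    have h2 : L'.Cong φ (fun χ => IOLinkage.pullMap (incl hR i) χ)
        fun χ => s i (L.inputMap 𝕜 (IOLinkage.pullMap (incl hR i) χ)) := by
      have := hc i
      rw [← pullMap_incl hR hφ i] at this
      exact IOLinkage.Cong.pullMap (incl hR i) hφ this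
    have h3 : L'.Cong φ (fun χ => L.inputMap 𝕜 (IOLinkage.pullMap (incl hR i) χ))
        fun χ => P.τ i ^ 2 • p χ := (h1.clm (L.inputCLM 𝕜)).trans (hpi i)
    have h4 : L.inputMap 𝕜 (IOLinkage.pullMap (incl hR i) φ) = P.τ i ^ 2 • p φ := by
      rw [pullMap_incl hR hφ i]
      exact (hlift i).2
    have h5 : AnalyticAt ℝ (fun χ => L.inputMap 𝕜 (IOLinkage.pullMap (incl hR i) χ)) φ :=
      AnalyticAt.fun_comp (L.analyticAt_inputMap 𝕜 _) (IOLinkage.analyticAt_pullMap (incl hR i) hφ)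
    exact h1.symm.trans (h2.trans (h3.comp (by rw [h4]; exact hs i) h5 (hτp i) h4))
  -- For `𝕜 = ℝ` this says that the imaginary part of an input vanishes on the scheme and not merely
  -- at its points. It is inherited from the first copy, where the section takes values in
  -- realizations.
  have hcz : ∀ j, Q (E (.inr (.inp j))) = Q fun χ => toComplex (p χ j) := by
    intro j
    let i : Fin P.N := ⟨0, hP.N_pos⟩
    have hτ := (pow_pos (P.τ_pos i) 2).ne'
    have h1 : Q (E (P.copyT i (L.inp j))) = Q fun χ => P.τ i ^ 2 • toComplex (p χ j) := by
      refine IOLinkage.cong_iff_mkQ_eq.1 (((hcopy i).apply (L.inp j)).trans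
        (IOLinkage.Cong.of_eventuallyEq ?_))
      filter_upwards [(hτp i).continuousAt.eventually (hsec i)] with χ hχ
      rw [hL.input_mem _ hχ.1, hχ.2, ← toComplex_smul]
      rfl
    have h2 := (hinp i j).symm.trans (h1.trans (map_smul Q (P.τ i ^ 2) fun χ => toComplex (p χ j)))
    exact smul_right_injective _ hτ h2
  have hz : (fun j => Q (E (.inr (.inp j)))) = fun j => Q fun χ => toComplex (p χ j) := funext hcz
  have hψ : (fun i v => Q (E (P.copyT i v))) = fun i v => Q fun χ => s i (P.τ i ^ 2 • p χ) v :=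
    funext fun i => funext fun v => IOLinkage.cong_iff_mkQ_eq.1 ((hcopy i).apply v)
  have hf : Q (E (.inr .far)) = Q fun _ => ((6 * P.R : ℝ) : ℂ) :=
    IOLinkage.cong_iff_mkQ_eq.1 (hconst (.inl (.inr .far)) trivial)
  have hb : Q (E (.inr .base)) = Q fun _ => ((- (2 * P.R) : ℝ) : ℂ) :=
    IOLinkage.cong_iff_mkQ_eq.1 (hconst (.inl (.inr .base)) trivial)
  refine IOLinkage.cong_iff_mkQ_eq.2 ((congrFun hE t).trans ?_)
  beta_reduce
  rw [hz, hψ, hf, hb, ← map_termVal]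
  congr 1
  ext χ
  exact map_termVal (LinearMap.proj (R := ℝ)
    (φ := fun _ : P.Vtx (V := V) (m := m) (n := n) → ℂ => ℂ) χ)
    (fun j χ => toComplex (p χ j)) (fun i v χ => s i (P.τ i ^ 2 • p χ) v)
    (fun _ => ((6 * P.R : ℝ) : ℂ)) (fun _ => (P.far : ℂ)) (fun _ => ((- (2 * P.R) : ℝ) : ℂ)) t

end Inclusion

variable {P : Plan} {V : Type*} [Fintype V] {m n : ℕ} {L : IOLinkage V m n}
variable {𝕜 : Type*} [RCLike 𝕜] {F : EuclideanSpace 𝕜 (Fin m) → EuclideanSpace 𝕜 (Fin n)}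
  {O : EuclideanSpace 𝕜 (Fin m)}

theorem analyticAt_sumVal {E : Type*} [NormedAddCommGroup E] [NormedSpace ℝ E]
    {y : E → Fin P.N → ℂ} {x : E} (hy : ∀ i, AnalyticAt ℝ (fun e => y e i) x) (k : Fin (P.N + 1)) :
    AnalyticAt ℝ (fun e => P.sumVal (y e) k) x := by
  refine Fin.lastCases ?_ (fun i => ?_) k
  · simp only [sumVal_last]
    exact Finset.analyticAt_fun_sum _ fun i _ => analyticAt_const.fun_smul (hy i)
  · simpa only [sumVal_castSucc] using hy i

theorem analyticAt_term {E : Type*} [NormedAddCommGroup E] [NormedSpace ℝ E]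
    {z : E → Fin m → ℂ} {ψ : E → Fin P.N → V → ℂ} {x : E}
    (hz : ∀ j, AnalyticAt ℝ (fun e => z e j) x) (hψ : ∀ i v, AnalyticAt ℝ (fun e => ψ e i v) x)
    (t : P.Term (V := V) (m := m) (n := n)) :
    AnalyticAt ℝ (fun e => P.term L (z e) (ψ e) t) x := by
  rcases t with ⟨i, v⟩ | p
  · exact hψ i _
  · cases p with
    | inp j => exact hz j
    | mid i j => exact analyticAt_const.fun_add (analyticAt_const.fun_smul (hz j))
    | acc q k =>
      refine analyticAt_const.fun_smul (analyticAt_const.fun_add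
        (Finset.analyticAt_fun_sum _ fun i _ => ?_))
      split_ifs
      · exact analyticAt_const.fun_smul (analyticAt_sumVal (fun i => hψ i _) i)
      · exact analyticAt_const
    | out q =>
      have (i : Fin P.N) : AnalyticAt ℝ (fun e => P.c i.castSucc • ψ e i (L.out q)) x :=
        analyticAt_const.fun_smul (hψ i _)
      show AnalyticAt ℝ (fun e => ∑ i : Fin P.N, P.c i.castSucc • ψ e i (L.out q)) x
      exact Finset.analyticAt_fun_sum _ fun i _ => this i
    | near i => exact analyticAt_const
    | far => exact analyticAt_const
    | base => exact analyticAt_const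

theorem analyticAt_assemble {E : Type*} [NormedAddCommGroup E] [NormedSpace ℝ E]
    {e : E → P.Term (V := V) (m := m) (n := n) → ℂ} {T : E → Arm m n P.N → ℂ} {x : E}
    (he : ∀ t, AnalyticAt ℝ (fun y => e y t) x) (hT : ∀ a, AnalyticAt ℝ (fun y => T y a) x) :
    AnalyticAt ℝ (fun y => P.assemble L (e y) (T y)) x := by
  refine analyticAt_pi_iff.2 fun v => ?_
  have hs : ∀ (c : ℝ) {f : E → ℂ}, AnalyticAt ℝ f x → AnalyticAt ℝ (fun y => c • f y) x :=
    fun c f hf => analyticAt_const.fun_smul hf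
  rcases v with t | ⟨g, a⟩ | j
  · exact he t
  · match a with
    | 0 => exact hT _
    | 1 => exact (hs _ (he _)).fun_add (hs _ (hT _))
    | 2 => exact (hs _ (hT _)).fun_add (hs _ (he _))
    | 3 => exact ((he _).fun_add ((hs _ (hT _)).fun_add (hs _ (he _)))).fun_sub (hT _)
  · exact hT _

theorem continuousAt_assemble {X : Type*} [TopologicalSpace X]
    {e : X → P.Term (V := V) (m := m) (n := n) → ℂ} {T : X → Arm m n P.N → ℂ} {x : X}
    (he : ∀ t, ContinuousAt (fun y => e y t) x) (hT : ∀ a, ContinuousAt (fun y => T y a) x) :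
    ContinuousAt (fun y => P.assemble L (e y) (T y)) x := by
  refine continuousAt_pi.2 fun v => ?_
  have hs : ∀ (c : ℝ) {f : X → ℂ}, ContinuousAt f x → ContinuousAt (fun y => c • f y) x :=
    fun c f hf => hf.const_smul c
  rcases v with t | ⟨g, a⟩ | j
  · exact he t
  · match a with
    | 0 => exact hT _
    | 1 => exact (hs _ (he _)).add (hs _ (hT _))
    | 2 => exact (hs _ (hT _)).add (hs _ (he _))
    | 3 => exact ((he _).add ((hs _ (hT _)).add (hs _ (he _)))).sub (hT _)
  · exact hT _

variable {φ : P.Vtx (V := V) (m := m) (n := n) → ℂ}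

variable (P L) in
/-- Analytic sections of the input maps of the copies near a realization. -/
structure IsSections (φ : P.Vtx (V := V) (m := m) (n := n) → ℂ) (x : EuclideanSpace 𝕜 (Fin m))
    (s : Fin P.N → EuclideanSpace 𝕜 (Fin m) → V → ℂ) : Prop where
  analyticAt : ∀ i, AnalyticAt ℝ (s i) (P.τ i ^ 2 • x)
  apply_eq : ∀ i, s i (P.τ i ^ 2 • x) = fun v => φ (.inl (P.copyT i v))
  eventually : ∀ i, ∀ᶠ y in 𝓝 (P.τ i ^ 2 • x), s i y ∈ L.Config ∧ L.inputMap 𝕜 (s i y) = y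
  cong : ∀ i, L.Cong (fun v => φ (.inl (P.copyT i v))) (fun ψ => ψ) fun ψ => s i (L.inputMap 𝕜 ψ)

theorem exists_isSections (hL : L.IsFunctional 𝕜 F O) (hP : P.IsGood L F)
    (hφ : φ ∈ (P.linkage L).Config) :
    ∃ s, P.IsSections L φ ((P.linkage L).inputMap 𝕜 φ) s := by
  obtain ⟨hin, hdom, hlift, -⟩ := (mem_config_linkage_iff.1 hφ).exists_build hL hP
  choose s h1 h2 h3 h4 using fun i => hP.hasSection _ hdom.norm_le i _ (hlift i).1 (hlift i).2
  have e := fun i => (hlift i).2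
  exact ⟨s, fun i => e i ▸ h1 i, fun i => e i ▸ h2 i, fun i => e i ▸ h3 i, h4⟩

variable (P L) in
/-- The realizations that belong to sections of the input maps of the copies. -/
def family (ς : Arm m n P.N → ℤˣ) (s : Fin P.N → EuclideanSpace 𝕜 (Fin m) → V → ℂ)
    (x : EuclideanSpace 𝕜 (Fin m)) : P.Vtx (V := V) (m := m) (n := n) → ℂ :=
  P.build L ς (fun j => toComplex (x j)) fun i => s i (P.τ i ^ 2 • x)

namespace IsSections

variable {x : EuclideanSpace 𝕜 (Fin m)} {s : Fin P.N → EuclideanSpace 𝕜 (Fin m) → V → ℂ}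

theorem analyticAt_term (hs : P.IsSections L φ x s) (t : P.Term (V := V) (m := m) (n := n)) :
    AnalyticAt ℝ (fun y : EuclideanSpace 𝕜 (Fin m) =>
      P.term L (fun j => toComplex (y j)) (fun i => s i (P.τ i ^ 2 • y)) t) x := by
  refine Plan.analyticAt_term (fun j => ?_) (fun i v => ?_) t
  · exact analyticAt_pi_iff.1 ((toComplexCLM 𝕜 m).analyticAt x) j
  · have h1 : AnalyticAt ℝ (fun y : EuclideanSpace 𝕜 (Fin m) => P.τ i ^ 2 • y) x :=
      analyticAt_const.fun_smul analyticAt_id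
    exact analyticAt_pi_iff.1 ((hs.analyticAt i).fun_comp h1) v

theorem eventually_lifts (hs : P.IsSections L φ x s) :
    ∀ᶠ y in 𝓝 x, P.Lifts L y fun i => s i (P.τ i ^ 2 • y) := by
  refine eventually_all.2 fun i => ?_
  have : ContinuousAt (fun y : EuclideanSpace 𝕜 (Fin m) => P.τ i ^ 2 • y) x := by fun_prop
  exact this.eventually (hs.eventually i)

theorem eventually_mem (hL : L.IsFunctional 𝕜 F O) (hP : P.IsGood L F) (hs : P.IsSections L φ x s)
    (ς : Arm m n P.N → ℤˣ) : ∀ᶠ y in 𝓝 x, P.InDom y →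
      P.family L ς s y ∈ (P.linkage L).Config ∧
        (P.linkage L).inputMap 𝕜 (P.family L ς s y) = y := by
  filter_upwards [hs.eventually_lifts] with y hy hdom
  exact ⟨mem_config_linkage_iff.2 (isRealized_build hL hP hdom hy ς), inputMap_build _ _ _⟩

theorem exists_family (hL : L.IsFunctional 𝕜 F O) (hP : P.IsGood L F)
    (hφ : φ ∈ (P.linkage L).Config) (hs : P.IsSections L φ ((P.linkage L).inputMap 𝕜 φ) s) :
    ∃ ς, P.family L ς s ((P.linkage L).inputMap 𝕜 φ) = φ := by
  obtain ⟨hin, hdom, hlift, ς, h⟩ := (mem_config_linkage_iff.1 hφ).exists_build hL hP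
  refine ⟨ς, ?_⟩
  conv_rhs => rw [h]
  simp only [family, hs.apply_eq]

/-- Valid up to the boundary; this allows realizations over the boundary to be approached from the
interior with constant signs. -/
theorem continuousAt_family (hL : L.IsFunctional 𝕜 F O) (hP : P.IsGood L F)
    (hs : P.IsSections L φ x s) (hx : P.InDom x) (ς : Arm m n P.N → ℤˣ) :
    ContinuousAt (P.family L ς s) x := by
  have hc := fun t => (hs.analyticAt_term (n := n) t).continuousAt
  refine continuousAt_assemble
    (e := fun y : EuclideanSpace 𝕜 (Fin m) => P.term L (fun j => toComplex (y j)) fun i => s i (P.τ i ^ 2 • y))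
    (T := fun y a => armPt (P.aa a) (P.ab a) (ς a : ℤ)
      (P.term L (fun j => toComplex (y j)) (fun i => s i (P.τ i ^ 2 • y)) (P.au a))
      (P.term L (fun j => toComplex (y j)) (fun i => s i (P.τ i ^ 2 • y)) (P.av L a)))
    hc fun a => ?_
  exact continuousAt_armPt (hc (P.au a)) (hc (P.av L a))
    (term_sub_ne hL hP hx hs.eventually_lifts.self_of_nhds a)

theorem analyticAt_family (hL : L.IsFunctional 𝕜 F O) (hP : P.IsGood L F)
    (hs : P.IsSections L φ x s) (hx : P.InDom x) (hx' : ∀ j,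
      P.R < ‖toComplex (x j) + (2 * P.R : ℝ)‖ ∧ ‖toComplex (x j) + (2 * P.R : ℝ)‖ < 3 * P.R)
    (ς : Arm m n P.N → ℤˣ) : AnalyticAt ℝ (P.family L ς s) x := by
  have hc := fun t => hs.analyticAt_term (n := n) t
  have hl := hs.eventually_lifts.self_of_nhds
  refine analyticAt_assemble
    (e := fun y : EuclideanSpace 𝕜 (Fin m) => P.term L (fun j => toComplex (y j)) fun i => s i (P.τ i ^ 2 • y))
    (T := fun y a => armPt (P.aa a) (P.ab a) (ς a : ℤ)
      (P.term L (fun j => toComplex (y j)) (fun i => s i (P.τ i ^ 2 • y)) (P.au a))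
      (P.term L (fun j => toComplex (y j)) (fun i => s i (P.τ i ^ 2 • y)) (P.av L a)))
    hc fun a => ?_
  exact analyticAt_armPt (hc (P.au a)) (hc (P.av L a))
    (term_sub_ne hL hP hx hl a) (armDisc_term_pos hL hP hx hl hx' a).ne'

end IsSections

/-- Realizations over the interior of the domain are regular. -/
theorem hasSection_linkage (hL : L.IsFunctional 𝕜 F O) (hP : P.IsGood L F)
    (hφ : φ ∈ (P.linkage L).Config) (hx : ∀ j,
      P.R < ‖toComplex ((P.linkage L).inputMap 𝕜 φ j) + (2 * P.R : ℝ)‖ ∧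
      ‖toComplex ((P.linkage L).inputMap 𝕜 φ j) + (2 * P.R : ℝ)‖ < 3 * P.R) :
    (P.linkage L).HasSection 𝕜 φ := by
  set L' := P.linkage L with hL'
  set p := L'.inputMap 𝕜 with hp
  have hR := isReduced_coordFun hL hP
  have hreal := mem_config_linkage_iff.1 hφ
  obtain ⟨hin, hdom, hlift, -⟩ := hreal.exists_build hL hP
  obtain ⟨s, hs⟩ := exists_isSections hL hP hφ
  obtain ⟨ς, hς⟩ := hs.exists_family hL hP hφ
  have hfam := hs.analyticAt_family hL hP hdom hx ς
  have hpan : AnalyticAt ℝ p φ := L'.analyticAt_inputMap 𝕜 φ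
  refine ⟨P.family L ς s, hfam, hς, ?_, ?_⟩
  · have hopen : ∀ᶠ y in 𝓝 (p φ), P.InDom y := by
      refine eventually_all.2 fun j => ?_
      have hc : ContinuousAt (fun y : EuclideanSpace 𝕜 (Fin m) =>
          ‖toComplex (y j) + (2 * P.R : ℝ)‖) (p φ) := by
        have : Continuous fun y : EuclideanSpace 𝕜 (Fin m) => toComplex (y j) :=
          continuous_pi_iff.1 (toComplexCLM 𝕜 m).continuous j
        exact (this.add continuous_const).norm.continuousAt
      filter_upwards [hc.eventually (lt_mem_nhds (hx j).1),
        hc.eventually (gt_mem_nhds (hx j).2)] with y h1 h2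
      exact ⟨h1.le, h2.le⟩
    filter_upwards [hopen, hs.eventually_mem hL hP ς] with y h1 h2
    exact h2 h1
  -- First the terminals, then the elbows as analytic functions of their ends, then the remaining
  -- vertices, which are linear in both.
  · have hterm := cong_term hR hφ hL hP hs.analyticAt hs.eventually (fun i => hs.cong i)
    have hterm_an : ∀ t, AnalyticAt ℝ (fun χ => P.term L (fun j => toComplex (p χ j))
        (fun i => s i (P.τ i ^ 2 • p χ)) t) φ := fun t =>
      (hs.analyticAt_term (n := n) t).fun_comp hpan
    have htφ : ∀ t, φ (.inl t) = P.term L (fun j => toComplex (p φ j))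
        (fun i => s i (P.τ i ^ 2 • p φ)) t := fun t =>
      (hterm t).eventually_eq.self_of_nhds hφ
    have hl := hs.eventually_lifts.self_of_nhds
    have harm : ∀ a, L'.Cong φ (fun χ => χ (P.elbow a)) fun χ => P.family L ς s (p χ) (P.elbow a) := by
      intro a
      have h1 : L'.Cong φ (fun χ => Complex.normSq (χ (P.elbow a) - χ (.inl (P.au a))))
          fun _ => P.aa a ^ 2 := by
        rcases a with g | j
        · exact IOLinkage.cong_normSq hφ (hR.elbow_u g)
        · exact IOLinkage.cong_normSq hφ (hR.lim_base j)
      have h2 : L'.Cong φ (fun χ => Complex.normSq (χ (P.elbow a) - χ (.inl (P.av L a))))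
          fun _ => P.ab a ^ 2 := by
        rcases a with g | j
        · exact IOLinkage.cong_normSq hφ (hR.elbow_v g)
        · exact IOLinkage.cong_normSq hφ (hR.lim_inp j)
      have h3 := IOLinkage.cong_armPt (ς := ς a) hφ (hterm (P.au a)) (hterm (P.av L a))
        (hterm_an _) (hterm_an _) h1 h2
        (by rw [htφ, htφ]; exact term_sub_ne hL hP hdom hl a)
        (by rw [htφ, htφ]; exact armDisc_term_pos hL hP hdom hl hx a)
        (by
          rw [htφ, htφ]
          conv_lhs => rw [← hς]
          cases a <;> rfl)
      refine h3.trans (IOLinkage.Cong.of_eventuallyEq (Eventually.of_forall fun χ => ?_))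
      cases a <;> rfl
    have hcomb : ∀ {u w u' w' : (P.Vtx (V := V) (m := m) (n := n) → ℂ) → ℂ} (a b : ℝ),
        L'.Cong φ u w → L'.Cong φ u' w' →
          L'.Cong φ (fun χ => a • u χ + b • u' χ) fun χ => a • w χ + b • w' χ :=
      fun a b h h' => (h.prodMk h').clm (a • ContinuousLinearMap.fst ℝ ℂ ℂ +
        b • ContinuousLinearMap.snd ℝ ℂ ℂ)
    have htwo : ∀ g, L'.Cong φ (fun χ => χ (P.inner g 2))
        fun χ => P.family L ς s (p χ) (P.inner g 2) := fun g =>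
      (cong_linkage_two hφ (hR.inner_two g)).trans (hcomb _ _ (harm (.inl g)) (hterm _))
    refine IOLinkage.Cong.pi fun v => ?_
    rcases v with t | ⟨g, a⟩ | j
    · exact hterm t
    · match a with
      | 0 => exact harm (.inl g)
      | 1 =>
        exact (cong_linkage_two hφ (hR.inner_one g)).trans (hcomb _ _ (hterm _) (harm (.inl g)))
      | 2 => exact htwo g
      | 3 =>
        have h1 := IOLinkage.cong_linear (L := L') (v := P.inner g 3) (a := .inl (P.gu g))
          (b := P.inner g 2) (c := P.inner g 0) (r := 1) (s := 1) (t := -1) hφ fun i => by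
            rw [hR.inner_three, map_neg, map_one]; ring
        have h2 := hcomb 1 (-1) (hcomb 1 1 (hterm (P.gu g)) (htwo g)) (harm (.inl g))
        simp only [one_smul, neg_smul, ← sub_eq_add_neg] at h1 h2
        exact h1.trans h2
    · exact harm (.inr j)

end Plan

/-! ### Topology of the input map -/

namespace IOLinkage

variable {V : Type*} {m n : ℕ} (L : IOLinkage V m n) {𝕜 : Type*} [RCLike 𝕜]

theorem isClosed_config : IsClosed L.Config := by
  have : L.Config = (⋂ v, ⋂ w, ⋂ (_ : L.graph.Adj v w),
      {φ : V → ℂ | ‖φ v - φ w‖ ^ 2 = L.len s(v, w) ^ 2}) ∩ ⋂ j, {φ : V → ℂ | φ (L.fixed j) = L.Z j} := by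
    ext φ
    simp [Config]
  rw [this]
  refine IsClosed.inter ?_ (isClosed_iInter fun j => isClosed_eq (by fun_prop) (by fun_prop))
  exact isClosed_iInter fun v => isClosed_iInter fun w => isClosed_iInter fun _ =>
    isClosed_eq (by fun_prop) (by fun_prop)

variable [Fintype V]

theorem continuous_toDom : Continuous (L.toDom 𝕜) :=
  ((L.continuous_inputMap 𝕜).comp continuous_subtype_val).subtype_mk _

variable {L}

/-- At regular points the input map is a local homeomorphism. -/
theorem isLocalHomeomorphOn_toDom {S : Set L.Config} (h : ∀ φ ∈ S, L.HasSection 𝕜 φ.1) :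
    IsLocalHomeomorphOn (L.toDom 𝕜) S := by
  classical
  refine IsLocalHomeomorphOn.mk _ _ fun φ hφ => ?_
  obtain ⟨s, hs, hsφ, hsec, hc⟩ := h φ hφ
  have : FiniteDimensional ℝ (V → ℂ) := inferInstance
  obtain ⟨U, hU, hUo, hφU⟩ := eventually_nhds_iff.1 (hs.eventually_analyticAt.and hsec)
  obtain ⟨W, hW, hWo, hφW⟩ := eventually_nhds_iff.1 hc.eventually_eq
  have hcont : ContinuousOn s U := fun x hx => (hU x hx).1.continuousAt.continuousWithinAt
  have hO : IsOpen (U ∩ s ⁻¹' W) := hcont.isOpen_inter_preimage hUo hWo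
  -- The inverse is the section; on `W` the congruence gives `ψ = s (p ψ)` at the real points.
  let e : OpenPartialHomeomorph L.Config (L.Dom 𝕜) :=
    { toFun := L.toDom 𝕜
      invFun := fun x => if hx : s x.1 ∈ L.Config then ⟨s x.1, hx⟩ else φ
      source := {ψ | L.inputMap 𝕜 ψ.1 ∈ U ∧ ψ.1 ∈ W}
      target := {x | x.1 ∈ U ∩ s ⁻¹' W}
      map_source' := fun ψ hψ => by
        refine ⟨hψ.1, ?_⟩
        show s (L.inputMap 𝕜 ψ.1) ∈ W
        rw [← hW ψ.1 hψ.2 ψ.2]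
        exact hψ.2
      map_target' := fun x hx => by
        have h1 := (hU x.1 hx.1).2
        simp only [h1.1, dif_pos, Set.mem_ofPred_eq, h1.2]
        exact hx
      left_inv' := fun ψ hψ => by
        have h1 : s (L.inputMap 𝕜 ψ.1) = ψ.1 := (hW ψ.1 hψ.2 ψ.2).symm
        have h2 : s (L.toDom 𝕜 ψ).1 = ψ.1 := h1
        apply Subtype.ext
        rw [dif_pos (by rw [h2]; exact ψ.2)]
        exact h1
      right_inv' := fun x hx => by
        have h1 := (hU x.1 hx.1).2
        apply Subtype.ext
        rw [dif_pos h1.1]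
        exact h1.2
      open_source := by
        exact (hUo.preimage ((L.continuous_inputMap 𝕜).comp continuous_subtype_val)).inter
          (hWo.preimage continuous_subtype_val)
      open_target := hO.preimage continuous_subtype_val
      continuousOn_toFun := L.continuous_toDom.continuousOn
      continuousOn_invFun := by
        rw [IsInducing.subtypeVal.continuousOn_iff]
        have h1 : ContinuousOn (fun x : L.Dom 𝕜 => s x.1) {x | x.1 ∈ U ∩ s ⁻¹' W} :=
          hcont.comp continuous_subtype_val.continuousOn fun x hx => hx.1
        refine h1.congr fun x hx => ?_
        simp only [Function.comp_apply, dif_pos (hU x.1 hx.1).2.1] }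
  exact ⟨e, ⟨hφU, hφW⟩, fun ψ _ => rfl⟩

/-- The realizations over a compact part of the domain form a compact set. -/
theorem IsFunctional.isCompact_preimage {F : EuclideanSpace 𝕜 (Fin m) → EuclideanSpace 𝕜 (Fin n)}
    {O : EuclideanSpace 𝕜 (Fin m)} (hL : L.IsFunctional 𝕜 F O) {K : Set (EuclideanSpace 𝕜 (Fin m))}
    (hK : IsCompact K) (hKD : K ⊆ L.Dom 𝕜) : IsCompact {ψ | ψ ∈ L.Config ∧ L.inputMap 𝕜 ψ ∈ K} := by
  -- A closed continuous map with finite fibers is proper. The configuration space of `L` itself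
  -- need not be compact.
  have hproper : IsProperMap (L.toDom 𝕜) := isProperMap_iff_isClosedMap_and_compact_fibers.2
    ⟨hL.branched.continuous, hL.branched.isClosedMap, fun y => (hL.branched.finite_fibers y).isCompact⟩
  have h1 : IsCompact ((↑) ⁻¹' K : Set (L.Dom 𝕜)) :=
    IsInducing.subtypeVal.isCompact_preimage' hK (by simpa using hKD)
  have h2 := (hproper.isCompact_preimage h1).image continuous_subtype_val
  convert h2 using 1
  ext ψ
  simp [toDom, and_comm]

theorem IsFunctional.finite_fiber {F : EuclideanSpace 𝕜 (Fin m) → EuclideanSpace 𝕜 (Fin n)}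
    {O : EuclideanSpace 𝕜 (Fin m)} (hL : L.IsFunctional 𝕜 F O) (x : EuclideanSpace 𝕜 (Fin m)) :
    {ψ | ψ ∈ L.Config ∧ L.inputMap 𝕜 ψ = x}.Finite := by
  by_cases hx : x ∈ L.Dom 𝕜
  · refine ((hL.branched.finite_fibers ⟨x, hx⟩).image Subtype.val).subset fun ψ hψ => ?_
    exact ⟨⟨ψ, hψ.1⟩, Subtype.ext hψ.2, rfl⟩
  · refine Set.finite_empty.subset fun ψ hψ => hx ?_
    exact ⟨ψ, hψ.1, hψ.2⟩

end IOLinkage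

/-! ### Compactness, boundary, and the branched covering -/

namespace Plan

variable {P : Plan} {V : Type*} [Fintype V] {m n : ℕ} {L : IOLinkage V m n}
variable {𝕜 : Type*} [RCLike 𝕜] {F : EuclideanSpace 𝕜 (Fin m) → EuclideanSpace 𝕜 (Fin n)}
  {O : EuclideanSpace 𝕜 (Fin m)}

theorem isCompact_polydisc (r : ℝ) : IsCompact {x : EuclideanSpace 𝕜 (Fin m) | ∀ j, ‖x j‖ ≤ r} := by
  have h := (isCompact_univ_pi fun _ : Fin m => isCompact_closedBall (0 : 𝕜) r).image
    (PiLp.continuous_toLp 2 _)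
  convert h using 1
  ext x
  simp only [Set.mem_ofPred_eq, Set.mem_image, Set.mem_pi, Set.mem_univ, true_imp_iff,
    mem_closedBall_zero_iff]
  exact ⟨fun hx => ⟨x.ofLp, hx, rfl⟩, by rintro ⟨y, hy, rfl⟩; exact hy⟩

/-- The limiting arms bound the inputs; each copy then lies in the preimage of a compact set under a
proper map, the terminals depend continuously on these data, and the elbows stay within the arm
lengths. -/
theorem isCompact_config (hL : L.IsFunctional 𝕜 F O) (hP : P.IsGood L F) :
    IsCompact (P.linkage L).Config := by
  let K : Fin P.N → Set (EuclideanSpace 𝕜 (Fin m)) := fun i =>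
    (fun x => P.τ i ^ 2 • x) '' {x | ∀ j, ‖x j‖ ≤ 5 * P.R}
  have hK : ∀ i, IsCompact {ψ | ψ ∈ L.Config ∧ L.inputMap 𝕜 ψ ∈ K i} := fun i => by
    refine hL.isCompact_preimage ((isCompact_polydisc _).image (by fun_prop)) ?_
    rintro _ ⟨x, hx, rfl⟩
    obtain ⟨ψ, h1, h2⟩ := hP.exists_lift x hx i
    exact ⟨ψ, h1, h2⟩
  let C : Set ((Fin m → ℂ) × (Fin P.N → V → ℂ)) :=
    (Set.pi Set.univ fun _ => Metric.closedBall 0 (5 * P.R)) ×ˢ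
      Set.pi Set.univ fun i => {ψ | ψ ∈ L.Config ∧ L.inputMap 𝕜 ψ ∈ K i}
  have hC : IsCompact C :=
    (isCompact_univ_pi fun _ => isCompact_closedBall _ _).prod (isCompact_univ_pi hK)
  have hterm : Continuous fun c : (Fin m → ℂ) × (Fin P.N → V → ℂ) =>
      (P.term L c.1 c.2 : P.Term (V := V) (m := m) (n := n) → ℂ) := by
    refine continuous_pi fun t => continuous_iff_continuousAt.2 fun c => ?_
    refine (analyticAt_term (fun j => ?_) (fun i v => ?_) t).continuousAt
    · exact analyticAt_pi_iff.1 analyticAt_fst j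
    · have h : AnalyticAt ℝ (fun c : (Fin m → ℂ) × (Fin P.N → V → ℂ) => c.2 i) c :=
        analyticAt_pi_iff.1 analyticAt_snd i
      exact analyticAt_pi_iff.1 h v
  have hS := hC.image hterm
  obtain ⟨M, hM⟩ := hS.isBounded.exists_norm_le
  have hT : IsCompact (Set.pi Set.univ fun a : Arm m n P.N => Metric.closedBall (0 : ℂ) (M + P.aa a)) :=
    isCompact_univ_pi fun _ => isCompact_closedBall _ _
  have hasm : Continuous fun c : (P.Term (V := V) (m := m) (n := n) → ℂ) × (Arm m n P.N → ℂ) =>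
      P.assemble L c.1 c.2 :=
    continuous_iff_continuousAt.2 fun c => continuousAt_assemble
      (fun t => ((continuous_apply t).comp continuous_fst).continuousAt)
      (fun a => ((continuous_apply a).comp continuous_snd).continuousAt)
  refine ((hS.prod hT).image hasm).of_isClosed_subset (P.linkage L).isClosed_config fun φ hφ => ?_
  have hreal := mem_config_linkage_iff.1 hφ
  obtain ⟨hin, hdom, hlift, -⟩ := hreal.exists_build hL hP
  have hmem : (fun t => φ (.inl t)) ∈
      (fun c : (Fin m → ℂ) × (Fin P.N → V → ℂ) => P.term L c.1 c.2) '' C := by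
    refine ⟨(_, _), ⟨fun j _ => ?_, fun i _ => ⟨(hlift i).1, ?_⟩⟩, (hreal.term_eq hP).1.symm⟩
    · simp only [mem_closedBall_zero_iff, hin, norm_toComplex]
      exact hdom.norm_le j
    · exact ⟨_, hdom.norm_le, (hlift i).2.symm⟩
  refine ⟨(fun t => φ (.inl t), fun a => φ (P.elbow a)), ⟨hmem, fun a _ => ?_⟩,
    hreal.eq_assemble.symm⟩
  rw [mem_closedBall_zero_iff]
  have h1 : ‖φ (P.elbow a) - φ (.inl (P.au a))‖ = P.aa a := by
    have h0 := P.R_pos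
    have h2 : ‖φ (P.elbow a) - φ (.inl (P.au a))‖ ^ 2 = P.aa a ^ 2 := by
      rcases a with g | j
      · exact hreal.elbow_u g
      · exact hreal.lim_base j
    refine (pow_left_inj₀ (norm_nonneg _) ?_ two_ne_zero).1 h2
    rcases a with g | j
    · exact (P.gl_pos g).le
    · simp only [aa]; positivity
  have h2 : ‖φ (.inl (P.au a))‖ ≤ M := (norm_le_pi_norm (fun t => φ (.inl t)) _).trans (hM _ hmem)
  have h3 := norm_add_le (φ (P.elbow a) - φ (.inl (P.au a))) (φ (.inl (P.au a)))
  rw [sub_add_cancel] at h3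
  linarith

theorem finite_fiber (hL : L.IsFunctional 𝕜 F O) (hP : P.IsGood L F)
    (x : EuclideanSpace 𝕜 (Fin m)) :
    {φ | φ ∈ (P.linkage L).Config ∧ (P.linkage L).inputMap 𝕜 φ = x}.Finite := by
  have h1 : (Set.pi Set.univ fun i : Fin P.N =>
      {ψ | ψ ∈ L.Config ∧ L.inputMap 𝕜 ψ = P.τ i ^ 2 • x}).Finite :=
    Set.Finite.pi fun i => hL.finite_fiber _
  refine (Set.Finite.image2 (fun ς ψ => P.build L ς (fun j => toComplex (x j)) ψ)
    (Set.finite_univ (α := Arm m n P.N → ℤˣ)) h1).subset ?_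
  rintro φ ⟨hφ, rfl⟩
  obtain ⟨hin, hdom, hlift, ς, h⟩ := (mem_config_linkage_iff.1 hφ).exists_build hL hP
  exact ⟨ς, Set.mem_univ _, _, fun i _ => hlift i, h.symm⟩

theorem exists_mem_config (hL : L.IsFunctional 𝕜 F O) (hP : P.IsGood L F)
    {x : EuclideanSpace 𝕜 (Fin m)} (hx : P.InDom x) :
    ∃ φ ∈ (P.linkage L).Config, (P.linkage L).inputMap 𝕜 φ = x := by
  choose ψ h1 h2 using hP.exists_lift x hx.norm_le
  exact ⟨_, mem_config_linkage_iff.2 (isRealized_build hL hP hx (fun i => ⟨h1 i, h2 i⟩) fun _ => 1),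
    inputMap_build _ _ _⟩

variable (P) in
/-- The boundary of the domain. -/
def IsBoundary (x : EuclideanSpace 𝕜 (Fin m)) : Prop :=
  ∃ j, ‖toComplex (x j) + (2 * P.R : ℝ)‖ = P.R ∨ ‖toComplex (x j) + (2 * P.R : ℝ)‖ = 3 * P.R

theorem InDom.strict {x : EuclideanSpace 𝕜 (Fin m)} (hx : P.InDom x) (hb : ¬ P.IsBoundary x)
    (j : Fin m) : P.R < ‖toComplex (x j) + (2 * P.R : ℝ)‖ ∧
      ‖toComplex (x j) + (2 * P.R : ℝ)‖ < 3 * P.R := by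
  simp only [IsBoundary, not_exists, not_or] at hb
  exact ⟨lt_of_le_of_ne (hx j).1 (Ne.symm (hb j).1), lt_of_le_of_ne (hx j).2 (hb j).2⟩

theorem continuous_norm_toComplex (j : Fin m) : Continuous fun y : EuclideanSpace 𝕜 (Fin m) =>
    ‖toComplex (y j) + (2 * P.R : ℝ)‖ := by
  have : Continuous fun y : EuclideanSpace 𝕜 (Fin m) => toComplex (y j) :=
    continuous_pi_iff.1 (toComplexCLM 𝕜 m).continuous j
  exact (this.add continuous_const).norm

theorem isClosed_isBoundary : IsClosed {x : EuclideanSpace 𝕜 (Fin m) | P.IsBoundary x} := by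
  simp only [IsBoundary, Set.ofPred_exists, Set.ofPred_or]
  exact isClosed_iUnion_of_finite fun j =>
    (isClosed_eq (continuous_norm_toComplex j) continuous_const).union
      (isClosed_eq (continuous_norm_toComplex j) continuous_const)

variable (P) in
/-- The motion of the coordinates towards the circle in the middle of the domain. -/
def retract (x : EuclideanSpace 𝕜 (Fin m)) (h : ℝ) : EuclideanSpace 𝕜 (Fin m) :=
  WithLp.toLp 2 fun j => (1 - h + 2 * P.R * h / ‖toComplex (x j) + (2 * P.R : ℝ)‖) •
    (x j + ((2 * P.R : ℝ) : 𝕜)) - ((2 * P.R : ℝ) : 𝕜)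

theorem retract_zero (x : EuclideanSpace 𝕜 (Fin m)) : P.retract x 0 = x := by
  ext j
  simp [retract]

theorem continuous_retract (x : EuclideanSpace 𝕜 (Fin m)) : Continuous (P.retract x) := by
  unfold retract
  fun_prop

theorem toComplex_ofReal (a : ℝ) : toComplex (a : 𝕜) = (a : ℂ) := by
  apply Complex.ext <;> simp [toComplex]

/-- The distance `ρ` from `-2R` becomes `(1 - h) ρ + 2 R h`, a proper average with `2R`. The factor
is real, so the motion stays in `𝕜`. -/
theorem retract_strict {x : EuclideanSpace 𝕜 (Fin m)} (hx : P.InDom x) {h : ℝ} (h0 : 0 < h)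
    (h1 : h ≤ 1) (j : Fin m) : P.R < ‖toComplex (P.retract x h j) + (2 * P.R : ℝ)‖ ∧
      ‖toComplex (P.retract x h j) + (2 * P.R : ℝ)‖ < 3 * P.R := by
  have hR := P.R_pos
  obtain ⟨h2, h3⟩ := hx j
  set ρ := ‖toComplex (x j) + (2 * P.R : ℝ)‖ with hρ
  have hρ0 : 0 < ρ := hR.trans_le h2
  have e : toComplex (P.retract x h j) + (2 * P.R : ℝ) =
      (1 - h + 2 * P.R * h / ρ) • (toComplex (x j) + (2 * P.R : ℝ)) := by
    have h4 := (toComplexLM 𝕜).map_sub ((1 - h + 2 * P.R * h / ρ) • (x j + ((2 * P.R : ℝ) : 𝕜)))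
      ((2 * P.R : ℝ) : 𝕜)
    rw [map_smul, map_add] at h4
    change toComplex (_ - _) = _ • (toComplex _ + toComplex _) - toComplex _ at h4
    rw [toComplex_ofReal] at h4
    show toComplex (_ - _) + _ = _
    rw [h4]
    ring
  have hc : 0 ≤ 1 - h + 2 * P.R * h / ρ := by
    have : 0 ≤ 2 * P.R * h / ρ := by positivity
    linarith
  rw [e, norm_smul, Real.norm_of_nonneg hc, ← hρ]
  have e2 : (1 - h + 2 * P.R * h / ρ) * ρ = (1 - h) * ρ + 2 * P.R * h := by field_simp
  rw [e2]
  constructor <;> nlinarith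

/-- A realization over the boundary is the limit of the members of its family, with the same signs
and sections, over the retracted inputs. -/
theorem dense_not_isBoundary (hL : L.IsFunctional 𝕜 F O) (hP : P.IsGood L F) :
    Dense {φ : (P.linkage L).Config | ¬ P.IsBoundary ((P.linkage L).inputMap 𝕜 φ.1)} := by
  intro φ
  rw [IsInducing.subtypeVal.closure_eq_preimage_closure_image]
  show φ.1 ∈ closure _
  obtain ⟨hin, hdom, hlift, -⟩ := (mem_config_linkage_iff.1 φ.2).exists_build hL hP
  obtain ⟨s, hs⟩ := exists_isSections hL hP φ.2
  obtain ⟨ς, hς⟩ := hs.exists_family hL hP φ.2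
  set x := (P.linkage L).inputMap 𝕜 φ.1 with hx
  have hr : Tendsto (P.retract x) (𝓝[>] 0) (𝓝 x) := by
    have := (continuous_retract (P := P) x).continuousAt (x := 0)
    rw [ContinuousAt, retract_zero] at this
    exact this.mono_left nhdsWithin_le_nhds
  have hf : Tendsto (fun h => P.family L ς s (P.retract x h)) (𝓝[>] 0) (𝓝 φ.1) := by
    have := hs.continuousAt_family hL hP hdom ς
    rw [ContinuousAt, hς] at this
    exact this.comp hr
  refine mem_closure_of_tendsto hf ?_
  filter_upwards [hr.eventually (hs.eventually_mem hL hP ς), self_mem_nhdsWithin,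
    nhdsWithin_le_nhds (Iic_mem_nhds (zero_lt_one' ℝ))] with h h1 h2 h3
  have h4 := retract_strict hdom h2 h3
  obtain ⟨h5, h6⟩ := h1 fun j => ⟨(h4 j).1.le, (h4 j).2.le⟩
  refine ⟨⟨_, h5⟩, ?_, rfl⟩
  show ¬ P.IsBoundary ((P.linkage L).inputMap 𝕜 _)
  rw [h6]
  rintro ⟨j, h7 | h7⟩
  · exact (h4 j).1.ne' h7
  · exact (h4 j).2.ne h7

/-- The boundary serves as branch set. Elsewhere the map is a local homeomorphism with compact
source, hence a covering; density of the complement upstairs passes to the image. -/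
theorem isBranchedCovering (hL : L.IsFunctional 𝕜 F O) (hP : P.IsGood L F) :
    IsBranchedCovering ((P.linkage L).toDom 𝕜) := by
  set L' := P.linkage L with hL'
  have hsurj : Function.Surjective (L'.toDom 𝕜) := by
    rintro ⟨_, φ, hφ, rfl⟩
    exact ⟨⟨φ, hφ⟩, rfl⟩
  have hcomp : CompactSpace L'.Config := isCompact_iff_compactSpace.1 (isCompact_config hL hP)
  have hcont := L'.continuous_toDom (𝕜 := 𝕜)
  let B : Set (L'.Dom 𝕜) := {x | P.IsBoundary x.1}
  have hB : IsClosed B := isClosed_isBoundary.preimage continuous_subtype_val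
  have hd := dense_not_isBoundary hL hP
  refine ⟨hcont, hsurj, hcont.isClosedMap, fun y => ?_, B, hB, ?_, ?_, ?_⟩
  · refine Set.Finite.of_finite_image ((finite_fiber hL hP y.1).subset ?_)
      Subtype.val_injective.injOn
    rintro _ ⟨φ, hφ, rfl⟩
    exact ⟨φ.2, congrArg Subtype.val hφ⟩
  · rw [hB.isNowhereDense_iff, ← compl_compl B, interior_compl, Set.compl_empty_iff]
    refine Dense.closure_eq ((hsurj.denseRange.dense_image hcont hd).mono ?_)
    rintro _ ⟨φ, hφ, rfl⟩
    exact hφ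
  · rw [(hB.preimage hcont).isNowhereDense_iff, ← compl_compl (_ ⁻¹' B), interior_compl,
      Set.compl_empty_iff]
    exact hd.closure_eq
  · refine IsCoveringMapOn.of_isLocalHomeomorphOn hcont
      (IOLinkage.isLocalHomeomorphOn_toDom fun φ hφ => ?_)
    obtain ⟨hin, hdom, -⟩ := (mem_config_linkage_iff.1 φ.2).exists_build hL hP
    exact hasSection_linkage hL hP φ.2 (hdom.strict hφ)

theorem inDom_of_norm_lt {x : EuclideanSpace 𝕜 (Fin m)} (hx : ‖x‖ < P.R) (j : Fin m) :
    P.R < ‖toComplex (x j) + (2 * P.R : ℝ)‖ ∧ ‖toComplex (x j) + (2 * P.R : ℝ)‖ < 3 * P.R := by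
  have h1 := (PiLp.norm_apply_le x j).trans_lt hx
  rw [← norm_toComplex] at h1
  have h2 : ‖((2 * P.R : ℝ) : ℂ)‖ = 2 * P.R := by
    have := P.R_pos
    rw [Complex.norm_real, Real.norm_of_nonneg (by positivity)]
  have h3 := norm_add_le (toComplex (x j)) ((2 * P.R : ℝ) : ℂ)
  have h4 := norm_sub_le_norm_add ((2 * P.R : ℝ) : ℂ) (toComplex (x j))
  rw [h2] at h3 h4
  rw [add_comm ((2 * P.R : ℝ) : ℂ)] at h4
  constructor <;> linarith

theorem exists_hasSection (hL : L.IsFunctional 𝕜 F O) (hP : P.IsGood L F)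
    {x : EuclideanSpace 𝕜 (Fin m)} (hx : ‖x‖ < P.R) : ∃ φ ∈ (P.linkage L).Config,
      (P.linkage L).inputMap 𝕜 φ = x ∧ (P.linkage L).HasSection 𝕜 φ := by
  have h1 := inDom_of_norm_lt hx
  obtain ⟨φ, hφ, rfl⟩ := exists_mem_config hL hP fun j => ⟨(h1 j).1.le, (h1 j).2.le⟩
  exact ⟨φ, hφ, rfl, hasSection_linkage hL hP hφ h1⟩

theorem ball_subset_domStar (hL : L.IsFunctional 𝕜 F O) (hP : P.IsGood L F) :
    Metric.ball 0 P.R ⊆ (P.linkage L).DomStar 𝕜 := by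
  intro x hx
  obtain ⟨φ, hφ, h1, h2⟩ := exists_hasSection hL hP (mem_ball_zero_iff.1 hx)
  exact ⟨φ, ⟨hφ, fun h => h.2 h2.isRegularAt⟩, h1⟩

theorem nonempty_interior_dom (hL : L.IsFunctional 𝕜 F O) (hP : P.IsGood L F) :
    (interior ((P.linkage L).Dom 𝕜)).Nonempty := by
  obtain ⟨φ, hφ, h1, h2⟩ := exists_hasSection hL hP (x := 0) (by simpa using P.R_pos)
  refine ⟨_, mem_interior_iff_mem_nhds.2 (mem_of_superset h2.eventually ?_)⟩
  rintro x ⟨ψ, hψ, rfl, -⟩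
  exact ⟨ψ, hψ, rfl⟩

end Plan

/-! ### Reflection of arms -/

section Reflection

/-- The reflection of the elbow `T` of an arm in the line through its ends. -/
theorem dsq_reflect {A : Type*} [CommRing A] {u v T R : Fin 2 → A} {κ a b : A}
    (ha : (T 0 - u 0) ^ 2 + (T 1 - u 1) ^ 2 = a) (hb : (T 0 - v 0) ^ 2 + (T 1 - v 1) ^ 2 = b)
    (hκ : κ * ((v 0 - u 0) ^ 2 + (v 1 - u 1) ^ 2) = (v 0 - u 0) ^ 2 + (v 1 - u 1) ^ 2 + a - b)
    (hR : ∀ i, R i = 2 * u i + κ * (v i - u i) - T i) :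
    (R 0 - u 0) ^ 2 + (R 1 - u 1) ^ 2 = a ∧ (R 0 - v 0) ^ 2 + (R 1 - v 1) ^ 2 = b := by
  simp only [hR]
  constructor
  · linear_combination κ * hκ + (1 - κ) * ha + κ * hb
  · linear_combination (κ - 2) * hκ + (2 - κ) * ha + (κ - 1) * hb

/-- Two different positions have opposite signs, so the square root cancels in `T + T'`. The
reflection is therefore rational, without poles as long as the ends differ. -/
theorem eq_or_reflect {a b : ℝ} {u v T T' : ℂ} (h : u ≠ v) (ha : ‖T - u‖ ^ 2 = a ^ 2)
    (hb : ‖T - v‖ ^ 2 = b ^ 2) (ha' : ‖T' - u‖ ^ 2 = a ^ 2) (hb' : ‖T' - v‖ ^ 2 = b ^ 2)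
    (hT : T ≠ T') :
    T' = 2 * u + (1 + (a ^ 2 - b ^ 2) * (Complex.normSq (v - u))⁻¹ : ℝ) * (v - u) - T := by
  have hD : ((Complex.normSq (v - u) : ℝ) : ℂ) ≠ 0 := by
    simpa [sub_eq_zero] using h.symm
  obtain ⟨ς, rfl⟩ := exists_eq_armPt h ha hb
  obtain ⟨ς', rfl⟩ := exists_eq_armPt h ha' hb'
  have hς : ς' = - ς := by
    rcases Int.units_eq_one_or ς with rfl | rfl <;> rcases Int.units_eq_one_or ς' with rfl | rfl <;>
      first | rfl | exact absurd rfl hT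
  subst hς
  rw [armPt, armPt, elbowPt, elbowPt, Complex.mk_eq_add_mul_I, Complex.mk_eq_add_mul_I]
  push_cast
  field_simp
  ring

end Reflection

/-! ### Symmetries of the expanded linkage -/

namespace Plan

variable {P : Plan} {V : Type*} [Fintype V] {m n : ℕ} {L : IOLinkage V m n}
variable {𝕜 : Type*} [RCLike 𝕜] {F : EuclideanSpace 𝕜 (Fin m) → EuclideanSpace 𝕜 (Fin n)}
  {O : EuclideanSpace 𝕜 (Fin m)}

theorem map_assemble {M M' : Type*} [AddCommGroup M] [Module ℝ M] [AddCommGroup M'] [Module ℝ M']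
    (l : M →ₗ[ℝ] M') (e : P.Term (V := V) (m := m) (n := n) → M) (T : Arm m n P.N → M) (v) :
    l (P.assemble L e T v) = P.assemble L (fun t => l (e t)) (fun a => l (T a)) v := by
  rcases v with t | ⟨g, a⟩ | j
  · rfl
  · match a with
    | 0 => rfl
    | 1 => simp [assemble]
    | 2 => simp [assemble]
    | 3 => simp [assemble]
  · rfl

theorem IsReduced.eq_assemble {A : Type*} [CommRing A] [Algebra ℝ A]
    {X : P.Vtx (V := V) (m := m) (n := n) × Fin 2 → A} (h : P.IsReduced L X) (i : Fin 2) (v) :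
    X (v, i) = P.assemble L (fun t => X (.inl t, i)) (fun a => X (P.elbow a, i)) v := by
  rcases v with t | ⟨g, a⟩ | j
  · rfl
  · match a with
    | 0 => rfl
    | 1 =>
      have h1 := h.inner_one g i
      simp only [← Algebra.smul_def] at h1
      exact h1
    | 2 =>
      have h1 := h.inner_two g i
      simp only [← Algebra.smul_def] at h1
      exact h1
    | 3 =>
      have h1 := h.inner_three g i
      rw [h.inner_two g i] at h1
      simp only [← Algebra.smul_def] at h1
      exact h1
  · rfl

section Symmetry

variable (hR : P.IsReduced L (P.linkage L).coordFun)

theorem evalRat_incl (i : Fin P.N) (φ : (P.linkage L).Config) (r : L.RatRing) :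
    (P.linkage L).evalRat φ (incl hR i r) =
      L.evalRat ⟨fun v => φ.1 (.inl (P.copyT i v)), (mem_config_linkage_iff.1 φ.2).copy i⟩ r := by
  refine DFunLike.congr_fun (f := ((P.linkage L).evalRat φ).comp (incl hR i))
    (IOLinkage.ratRing_algHom_ext L fun c => ?_) r
  simp only [AlgHom.comp_apply, incl_coordFun, IOLinkage.evalRat_coordFun]
  rfl

include hR in
/-- Symmetries of the given linkage preserve the output functions near the image of the expanded
linkage. -/
theorem incl_out (hL : L.IsFunctional 𝕜 F O) (hP : P.IsGood L F) {σ : L.RatRing ≃ₐ[ℝ] L.RatRing}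
    (hσ : σ ∈ L.Sym) (i : Fin P.N) (q : Fin n) (j : Fin 2) :
    incl hR i (σ (L.coordFun (L.out q, j))) = incl hR i (L.coordFun (L.out q, j)) := by
  rw [← sub_eq_zero, ← map_sub]
  refine (P.linkage L).ratRing_eq_zero fun φ => ?_
  obtain ⟨hin, hdom, hlift, -⟩ := (mem_config_linkage_iff.1 φ.2).exists_build hL hP
  obtain ⟨h1, h2⟩ := hlift i
  have hsec := hP.hasSection _ hdom.norm_le i _ h1 h2
  -- Outputs are functions of inputs only at the real points of `L`, whose scheme may have
  -- nilpotents. Near regular points vanishing at real points suffices, and the copies only meet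
  -- such points.
  have hI := hsec.inAnalyticIdeal (IOLinkage.analyticAt_ratFun
    (σ (L.coordFun (L.out q, j)) - L.coordFun (L.out q, j)) h1) (Eventually.of_forall fun ψ hψ => ?_)
  · obtain ⟨b, hb, hb'⟩ := IOLinkage.exists_mul_eq_zero (φ := ⟨_, h1⟩) hI
    refine ⟨incl hR i b, ?_, by rw [← map_mul, hb', map_zero]⟩
    rw [evalRat_incl]
    exact hb
  · rw [L.ratFun_eq_evalRat _ ⟨ψ, hψ⟩, map_sub, sub_eq_zero]
    have h3 := IOLinkage.evalRat_pullMap σ.toAlgHom ⟨ψ, hψ⟩ (L.coordFun (L.out q, j))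
    have h4 := IOLinkage.inputMap_pullMap (𝕜 := 𝕜) hσ hψ
    have h5 : IOLinkage.pullMap σ.toAlgHom ψ (L.out q) = ψ (L.out q) := by
      rw [hL.output_eq _ (IOLinkage.pullMap_mem_config σ.toAlgHom hψ), h4, hL.output_eq _ hψ]
    refine h3.symm.trans ?_
    simp only [IOLinkage.evalRat_coordFun, coords, h5]

variable (P L) in
/-- The inverse of the squared distance of the ends of an arm. -/
def invDist (a : Arm m n P.N) : (P.linkage L).RatRing :=
  Ring.inverse (dsq (P.linkage L).coordFun (.inl (P.av L a)) (.inl (P.au a)))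

theorem isUnit_dist (hL : L.IsFunctional 𝕜 F O) (hP : P.IsGood L F) (a : Arm m n P.N) :
    IsUnit (dsq (P.linkage L).coordFun (.inl (P.av L a)) (.inl (P.au a))) := by
  refine (P.linkage L).isUnit_of_evalRat_ne_zero fun φ => ?_
  have hreal := mem_config_linkage_iff.1 φ.2
  obtain ⟨hin, hdom, hlift, -⟩ := hreal.exists_build hL hP
  have hne := term_sub_ne hL hP hdom hlift a
  have ht := (hreal.term_eq hP).1
  simp only [hin] at ht
  have ht' : ∀ t, φ.1 (.inl t) = _ := fun t => congrFun ht t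
  rw [← ht', ← ht'] at hne
  have : (P.linkage L).evalRat φ (dsq (P.linkage L).coordFun (.inl (P.av L a)) (.inl (P.au a))) =
      dsq (coords φ.1) (.inl (P.av L a)) (.inl (P.au a)) := by
    simp only [dsq, map_add, map_pow, map_sub, IOLinkage.evalRat_coordFun]
  rw [this, dsq_coords]
  simpa [sub_eq_zero] using hne.symm

variable (P L) in
/-- The ratio of the projection of the elbow of an arm to half of the distance of its ends. -/
def ratio (a : Arm m n P.N) : (P.linkage L).RatRing :=
  1 + algebraMap ℝ _ (P.aa a ^ 2 - P.ab a ^ 2) * invDist P L a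

open scoped Classical in
variable (P L) in
/-- The elbows after reflection of a set of arms. -/
def symElbow (S : Set (Arm m n P.N)) (i : Fin 2) (a : Arm m n P.N) : (P.linkage L).RatRing :=
  if a ∈ S then 2 * (P.linkage L).coordFun (.inl (P.au a), i) + ratio P L a *
    ((P.linkage L).coordFun (.inl (P.av L a), i) - (P.linkage L).coordFun (.inl (P.au a), i)) -
      (P.linkage L).coordFun (P.elbow a, i)
  else (P.linkage L).coordFun (P.elbow a, i)

/-- The terminals after application of symmetries to the copies of the given linkage. -/
def symTerm (σ : Fin P.N → L.RatRing ≃ₐ[ℝ] L.RatRing) (i : Fin 2) :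
    P.Term (V := V) (m := m) (n := n) → (P.linkage L).RatRing
  | .inl (k, v) => incl hR k (σ k (L.coordFun ((Fintype.equivFin V).symm v, i)))
  | .inr p => (P.linkage L).coordFun (.inl (.inr p), i)

/-- The images of the coordinate functions under the symmetry that is induced by symmetries of the
copies and reflections of a set of arms. -/
def symFun (σ : Fin P.N → L.RatRing ≃ₐ[ℝ] L.RatRing) (S : Set (Arm m n P.N))
    (c : P.Vtx (V := V) (m := m) (n := n) × Fin 2) : (P.linkage L).RatRing :=
  P.assemble L (symTerm hR σ c.2) (symElbow P L S c.2) c.1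

variable {σ : Fin P.N → L.RatRing ≃ₐ[ℝ] L.RatRing} (hσ : ∀ i, σ i ∈ L.Sym)
  (hL : L.IsFunctional 𝕜 F O) (hP : P.IsGood L F) (S : Set (Arm m n P.N))

theorem symTerm_copyT (i : Fin 2) (k : Fin P.N) (v : V) :
    symTerm hR σ i (P.copyT k v) = incl hR k (σ k (L.coordFun (v, i))) := by
  simp [symTerm, copyT]

include hσ in
theorem symTerm_inp (i : Fin 2) (k : Fin P.N) (j : Fin m) : symTerm hR σ i (P.copyT k (L.inp j)) =
    (P.linkage L).coordFun (.inl (P.copyT k (L.inp j)), i) := by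
  rw [symTerm_copyT, hσ k, incl_coordFun]

include hσ hL hP in
theorem symTerm_out (i : Fin 2) (k : Fin P.N) (q : Fin n) : symTerm hR σ i (P.copyT k (L.out q)) =
    (P.linkage L).coordFun (.inl (P.copyT k (L.out q)), i) := by
  rw [symTerm_copyT, incl_out hR hL hP (hσ k), incl_coordFun]

theorem symTerm_gu (i : Fin 2) (g : Gad m n P.N) :
    symTerm hR σ i (P.gu g) = (P.linkage L).coordFun (.inl (P.gu g), i) := by
  cases g with
  | scale k j => rfl
  | shift k j => rfl
  | sum q k => simp only [gu]; split_ifs <;> rfl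

include hσ hL hP in
theorem symTerm_gv (i : Fin 2) (g : Gad m n P.N) :
    symTerm hR σ i (P.gv L g) = (P.linkage L).coordFun (.inl (P.gv L g), i) := by
  cases g with
  | scale k j => rfl
  | shift k j => rfl
  | sum q k =>
    simp only [gv]
    refine Fin.lastCases ?_ (fun k => ?_) k
    · simp [summand, symTerm]
    · simpa only [summand, Fin.lastCases_castSucc] using symTerm_out hR hσ hL hP i k q

include hσ in
theorem symTerm_gw (i : Fin 2) (g : Gad m n P.N) :
    symTerm hR σ i (P.gw L g) = (P.linkage L).coordFun (.inl (P.gw L g), i) := by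
  cases g with
  | scale k j => rfl
  | shift k j => exact symTerm_inp hR hσ i k j
  | sum q k => simp only [gw]; split_ifs <;> rfl

theorem symTerm_au (i : Fin 2) (a : Arm m n P.N) :
    symTerm hR σ i (P.au a) = (P.linkage L).coordFun (.inl (P.au a), i) := by
  rcases a with g | j
  · exact symTerm_gu hR i g
  · rfl

include hσ hL hP in
theorem symTerm_av (i : Fin 2) (a : Arm m n P.N) :
    symTerm hR σ i (P.av L a) = (P.linkage L).coordFun (.inl (P.av L a), i) := by
  rcases a with g | j
  · exact symTerm_gv hR hσ hL hP i g
  · rfl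

theorem IsReduced.dsq_au {A : Type*} [CommRing A] [Algebra ℝ A]
    {X : P.Vtx (V := V) (m := m) (n := n) × Fin 2 → A} (h : P.IsReduced L X) (a : Arm m n P.N) :
    dsq X (P.elbow a) (.inl (P.au a)) = algebraMap ℝ A (P.aa a ^ 2) := by
  rcases a with g | j
  · exact h.elbow_u g
  · exact h.lim_base j

theorem IsReduced.dsq_av {A : Type*} [CommRing A] [Algebra ℝ A]
    {X : P.Vtx (V := V) (m := m) (n := n) × Fin 2 → A} (h : P.IsReduced L X) (a : Arm m n P.N) :
    dsq X (P.elbow a) (.inl (P.av L a)) = algebraMap ℝ A (P.ab a ^ 2) := by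
  rcases a with g | j
  · exact h.elbow_v g
  · exact h.lim_inp j

include hR hL hP in
theorem symElbow_dsq (a : Arm m n P.N) :
    (symElbow P L S 0 a - (P.linkage L).coordFun (.inl (P.au a), 0)) ^ 2 +
      (symElbow P L S 1 a - (P.linkage L).coordFun (.inl (P.au a), 1)) ^ 2 =
        algebraMap ℝ _ (P.aa a ^ 2) ∧
    (symElbow P L S 0 a - (P.linkage L).coordFun (.inl (P.av L a), 0)) ^ 2 +
      (symElbow P L S 1 a - (P.linkage L).coordFun (.inl (P.av L a), 1)) ^ 2 =
        algebraMap ℝ _ (P.ab a ^ 2) := by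
  by_cases ha : a ∈ S
  · refine dsq_reflect (T := fun i => (P.linkage L).coordFun (P.elbow a, i))
      (u := fun i => (P.linkage L).coordFun (.inl (P.au a), i))
      (v := fun i => (P.linkage L).coordFun (.inl (P.av L a), i))
      (R := fun i => symElbow P L S i a) (κ := ratio P L a) (hR.dsq_au a) (hR.dsq_av a) ?_
      fun i => by simp only [symElbow, if_pos ha]
    have h1 := Ring.inverse_mul_cancel _ (isUnit_dist hL hP a)
    rw [ratio, invDist, map_sub]
    simp only [dsq] at h1 ⊢
    linear_combination (algebraMap ℝ (P.linkage L).RatRing (P.aa a ^ 2) -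
      algebraMap ℝ (P.linkage L).RatRing (P.ab a ^ 2)) * h1
  · simp only [symElbow, if_neg ha]
    exact ⟨hR.dsq_au a, hR.dsq_av a⟩

include hσ hL hP in
-- The symmetries of the copies fix their inputs and outputs, hence all ends and intermediate points
-- of pantographs; reflections keep the two lengths of an arm. No other equation connects the moved
-- vertices.
theorem isReduced_symFun : P.IsReduced L (symFun hR σ S) := by
  have hcopy : ∀ k, L.IsPoint fun c => symFun hR σ S (.inl (P.copyT k c.1), c.2) := fun k => by
    have h1 : (fun c : V × Fin 2 => symFun hR σ S (.inl (P.copyT k c.1), c.2)) =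
        (incl hR k).comp (σ k).toAlgHom ∘ L.coordFun := funext fun c => symTerm_copyT hR c.2 k c.1
    rw [h1]
    exact L.isPoint_coordFun.map _
  have hu := symTerm_gu (σ := σ) hR
  have hv := symTerm_gv hR hσ hL hP
  have hw := symTerm_gw hR hσ
  have hdu : ∀ a, dsq (symFun hR σ S) (P.elbow a) (.inl (P.au a)) =
      algebraMap ℝ _ (P.aa a ^ 2) := fun a => by
    have := (symElbow_dsq hR hL hP S a).1
    rw [← symTerm_au (σ := σ) hR, ← symTerm_au (σ := σ) hR] at this
    rcases a with g | j <;> exact this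
  have hdv : ∀ a, dsq (symFun hR σ S) (P.elbow a) (.inl (P.av L a)) =
      algebraMap ℝ _ (P.ab a ^ 2) := fun a => by
    have := (symElbow_dsq hR hL hP S a).2
    rw [← symTerm_av hR hσ hL hP, ← symTerm_av hR hσ hL hP] at this
    rcases a with g | j <;> exact this
  refine ⟨hcopy, fun v hv' => ?_, fun g i => ?_, fun g => hdu (.inl g), fun g => hdv (.inl g),
    fun g i => ?_, fun g i => ?_, fun g i => ?_, fun j => hdu (.inr j), fun j => hdv (.inr j)⟩
  · rcases v with (⟨k, v⟩ | p) | (⟨g, a⟩ | j)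
    · obtain ⟨j, hj⟩ := hv'
      have h1 := (hcopy k).mark j
      have h2 : (Sum.inl (P.copyT k (L.fixed j)) : P.Vtx (V := V) (m := m) (n := n)) =
          .inl (.inl (k, v)) := by rw [hj]; simp [copyT]
      rw [← P.pos_copyT L k j] at h1
      simpa only [h2] using h1
    · exact hR.mark _ hv'
    · exact hv'.elim
    · exact hv'.elim
  · show symTerm hR σ i _ = _ * symTerm hR σ i _ + _ * symTerm hR σ i _
    rw [hu, hv, hw]
    exact hR.rel g i
  · simp only [← Algebra.smul_def]; rfl
  · simp only [← Algebra.smul_def]; rfl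
  · rfl

/-- The symmetry that is induced by symmetries of the copies and reflections of arms, as an
endomorphism. -/
def symHom : (P.linkage L).RatRing →ₐ[ℝ] (P.linkage L).RatRing :=
  (P.linkage L).ratLift (symFun hR σ S)
    (((P.linkage L).isPoint_iff _).1 (isReduced_symFun hR hσ hL hP S).isPoint)

theorem symHom_coordFun (c : P.Vtx (V := V) (m := m) (n := n) × Fin 2) :
    symHom hR hσ hL hP S ((P.linkage L).coordFun c) = symFun hR σ S c :=
  (P.linkage L).ratLift_coordFun _ _ c

theorem symHom_incl (k : Fin P.N) (r : L.RatRing) :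
    symHom hR hσ hL hP S (incl hR k r) = incl hR k (σ k r) := by
  have e : (symHom hR hσ hL hP S).comp (incl hR k) = (incl hR k).comp (σ k).toAlgHom :=
    IOLinkage.ratRing_algHom_ext (A := (P.linkage L).RatRing) L fun c => ?_
  · exact DFunLike.congr_fun e r
  simp only [AlgHom.comp_apply, incl_coordFun, symHom_coordFun]
  exact symTerm_copyT hR c.2 k c.1

theorem symHom_au (i : Fin 2) (a : Arm m n P.N) :
    symHom hR hσ hL hP S ((P.linkage L).coordFun (.inl (P.au a), i)) =
      (P.linkage L).coordFun (.inl (P.au a), i) := by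
  rw [symHom_coordFun]
  exact symTerm_au hR i a

theorem symHom_av (i : Fin 2) (a : Arm m n P.N) :
    symHom hR hσ hL hP S ((P.linkage L).coordFun (.inl (P.av L a), i)) =
      (P.linkage L).coordFun (.inl (P.av L a), i) := by
  rw [symHom_coordFun]
  exact symTerm_av hR hσ hL hP i a

theorem symHom_ratio (a : Arm m n P.N) : symHom hR hσ hL hP S (ratio P L a) = ratio P L a := by
  have hD : symHom hR hσ hL hP S (dsq (P.linkage L).coordFun (.inl (P.av L a)) (.inl (P.au a))) =
      dsq (P.linkage L).coordFun (.inl (P.av L a)) (.inl (P.au a)) := by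
    simp only [dsq, map_add, map_pow, map_sub, symHom_au, symHom_av]
  have h1 := Ring.inverse_mul_cancel _ (isUnit_dist hL hP a)
  have h2 := congrArg (symHom hR hσ hL hP S) h1
  rw [map_mul, hD, map_one, ← h1] at h2
  have h3 := (isUnit_dist hL hP a).mul_right_cancel h2
  simp only [ratio, invDist, map_add, map_one, map_mul, AlgHom.commutes, h3]

theorem symHom_elbow (i : Fin 2) (a : Arm m n P.N) :
    symHom hR hσ hL hP S ((P.linkage L).coordFun (P.elbow a, i)) = symElbow P L S i a := by
  rw [symHom_coordFun]
  rcases a with g | j <;> rfl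

/-- The ends and the projection ratios of the arms are fixed, so a reflection is an involution and
the inverse uses the same set `S`. -/
theorem symHom_comp {σ' : Fin P.N → L.RatRing ≃ₐ[ℝ] L.RatRing} (hσ' : ∀ i, σ' i ∈ L.Sym)
    (h : ∀ k r, σ' k (σ k r) = r) (r : (P.linkage L).RatRing) :
    symHom hR hσ' hL hP S (symHom hR hσ hL hP S r) = r := by
  have e : (symHom hR hσ' hL hP S).comp (symHom hR hσ hL hP S) =
      AlgHom.id ℝ (P.linkage L).RatRing :=
    IOLinkage.ratRing_algHom_ext (A := (P.linkage L).RatRing) (P.linkage L) fun c => ?_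
  · exact DFunLike.congr_fun e r
  obtain ⟨v, i⟩ := c
  simp only [AlgHom.comp_apply, AlgHom.id_apply]
  rw [symHom_coordFun, symFun, hR.eq_assemble]
  refine (map_assemble (symHom hR hσ' hL hP S).toLinearMap _ _ _).trans ?_
  congr 1
  · ext t
    rcases t with ⟨k, v⟩ | p
    · show symHom hR hσ' hL hP S (incl hR k _) = _
      rw [symHom_incl, h, incl_coordFun]
      simp [copyT]
    · exact symHom_coordFun hR hσ' hL hP S _
  · ext a
    show symHom hR hσ' hL hP S (symElbow P L S i a) = _
    by_cases ha : a ∈ S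
    · rw [symElbow, if_pos ha]
      simp only [map_sub, map_add, map_mul, symHom_au, symHom_av, symHom_ratio, symHom_elbow,
        map_ofNat]
      rw [symElbow, if_pos ha]
      ring
    · rw [symElbow, if_neg ha, symHom_elbow, symElbow, if_neg ha]

/-- The symmetry that is induced by symmetries of the copies and reflections of arms. -/
def symEquiv : (P.linkage L).RatRing ≃ₐ[ℝ] (P.linkage L).RatRing :=
  AlgEquiv.ofAlgHom (symHom hR hσ hL hP S)
    (symHom hR (σ := fun i => (σ i)⁻¹) (fun i => L.Sym.inv_mem (hσ i)) hL hP S)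
    (AlgHom.ext fun r => symHom_comp hR (σ := fun i => (σ i)⁻¹) (fun i => L.Sym.inv_mem (hσ i))
      hL hP S hσ (fun k r => (σ k).apply_symm_apply r) r)
    (AlgHom.ext fun r => symHom_comp hR hσ hL hP S (σ' := fun i => (σ i)⁻¹)
      (fun i => L.Sym.inv_mem (hσ i)) (fun k r => (σ k).symm_apply_apply r) r)

theorem symEquiv_mem : symEquiv hR hσ hL hP S ∈ (P.linkage L).Sym := fun j i =>
  symHom_coordFun hR hσ hL hP S (.inl (.inr (.inp j)), i)

end Symmetry

/-- The symmetries act transitively on the fibers of the input map. -/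
theorem exists_mem_sym (hL : L.IsFunctional 𝕜 F O) (hP : P.IsGood L F)
    (φ χ : (P.linkage L).Config)
    (h : (P.linkage L).inputMap 𝕜 φ.1 = (P.linkage L).inputMap 𝕜 χ.1) :
    ∃ σ ∈ (P.linkage L).Sym, ∀ r, (P.linkage L).evalRat φ (σ r) = (P.linkage L).evalRat χ r := by
  have hR := isReduced_coordFun hL hP
  have hφ := mem_config_linkage_iff.1 φ.2
  have hχ := mem_config_linkage_iff.1 χ.2
  obtain ⟨hin, hdom, hlift, -⟩ := hφ.exists_build hL hP
  obtain ⟨hin', hdom', hlift', -⟩ := hχ.exists_build hL hP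
  choose σ hσ hσe using fun i => hL.regular ⟨_, hφ.copy i⟩ ⟨_, hχ.copy i⟩
    (((hlift i).2.trans (by rw [h])).trans (hlift' i).2.symm)
  have ht := (hφ.term_eq hP).1
  have ht' := (hχ.term_eq hP).1
  simp only [hin] at ht
  simp only [hin', ← h] at ht'
  have hout : ∀ i q, φ.1 (.inl (P.copyT i (L.out q))) = χ.1 (.inl (P.copyT i (L.out q))) := by
    intro i q
    have h1 := hlift.apply_out hL i q
    have h2 := hlift'.apply_out hL i q
    rw [← h] at h2
    exact h1.trans h2.symm
  have hpt : ∀ p, φ.1 (.inl (.inr p)) = χ.1 (.inl (.inr p)) := by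
    intro p
    have h1 := congrFun ht (.inr p)
    have h2 := congrFun ht' (.inr p)
    rw [h1, h2]
    cases p <;> simp only [term, termVal, hout]
  have hau : ∀ a : Arm m n P.N, φ.1 (.inl (P.au a)) = χ.1 (.inl (P.au a)) := by
    rintro ((⟨i, j⟩ | ⟨i, j⟩ | ⟨q, k⟩) | j)
    · exact hpt _
    · exact hpt _
    · simp only [au, gu]; split_ifs <;> exact hpt _
    · exact hpt _
  have hav : ∀ a : Arm m n P.N, φ.1 (.inl (P.av L a)) = χ.1 (.inl (P.av L a)) := by
    rintro ((⟨i, j⟩ | ⟨i, j⟩ | ⟨q, k⟩) | j)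
    · exact hpt _
    · exact hpt _
    · simp only [av, gv]
      refine Fin.lastCases ?_ (fun k => ?_) k
      · simpa [summand] using hpt _
      · simpa [summand] using hout k q
    · exact hpt _
  -- Over the same input both realizations have the same ends of arms, so their elbows agree or are
  -- mirror images; exactly the latter are reflected.
  let S : Set (Arm m n P.N) := {a | φ.1 (P.elbow a) ≠ χ.1 (P.elbow a)}
  refine ⟨symEquiv hR hσ hL hP S, symEquiv_mem hR hσ hL hP S, fun r => ?_⟩
  have e : ((P.linkage L).evalRat φ).comp (symHom hR hσ hL hP S) = (P.linkage L).evalRat χ :=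
    (P.linkage L).ratRing_algHom_ext fun c => ?_
  · exact DFunLike.congr_fun e r
  obtain ⟨v, i⟩ := c
  rw [AlgHom.comp_apply, symHom_coordFun, IOLinkage.evalRat_coordFun,
    (isReduced_coords_iff.2 hχ).eq_assemble, symFun]
  refine (map_assemble ((P.linkage L).evalRat φ).toLinearMap _ _ _).trans ?_
  congr 1
  · ext t
    rcases t with ⟨k, v⟩ | p
    · show (P.linkage L).evalRat φ (incl hR k _) = _
      rw [evalRat_incl, hσe, IOLinkage.evalRat_coordFun]
      simp [coords, copyT]
    · show (P.linkage L).evalRat φ ((P.linkage L).coordFun _) = _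
      rw [IOLinkage.evalRat_coordFun]
      simp only [coords, hpt]
  · ext a
    show (P.linkage L).evalRat φ (symElbow P L S i a) = _
    by_cases ha : φ.1 (P.elbow a) = χ.1 (P.elbow a)
    · rw [symElbow, if_neg (show a ∉ S from not_not_intro ha), IOLinkage.evalRat_coordFun]
      simp only [coords, ha]
    · have hne := term_sub_ne hL hP hdom hlift a
      have e : ∀ t, φ.1 (.inl t) = _ := fun t => congrFun ht t
      rw [← e, ← e] at hne
      have h1 := (isReduced_coords_iff.2 hφ).dsq_au a
      have h2 := (isReduced_coords_iff.2 hφ).dsq_av a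
      have h3 := (isReduced_coords_iff.2 hχ).dsq_au a
      have h4 := (isReduced_coords_iff.2 hχ).dsq_av a
      rw [dsq_coords] at h1 h2 h3 h4
      rw [← hau] at h3
      rw [← hav] at h4
      have h5 := eq_or_reflect hne h1 h2 h3 h4 ha
      have hinv : (P.linkage L).evalRat φ (ratio P L a) = 1 + (P.aa a ^ 2 - P.ab a ^ 2) *
          (Complex.normSq (φ.1 (.inl (P.av L a)) - φ.1 (.inl (P.au a))))⁻¹ := by
        have h6 := congrArg ((P.linkage L).evalRat φ)
          (Ring.inverse_mul_cancel _ (isUnit_dist hL hP a))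
        have h7 : (P.linkage L).evalRat φ
            (dsq (P.linkage L).coordFun (.inl (P.av L a)) (.inl (P.au a))) =
            Complex.normSq (φ.1 (.inl (P.av L a)) - φ.1 (.inl (P.au a))) := by
          rw [Complex.normSq_eq_norm_sq, ← dsq_coords]
          simp only [dsq, map_add, map_pow, map_sub, IOLinkage.evalRat_coordFun]
        rw [map_mul, h7, map_one] at h6
        rw [ratio, map_add, map_mul, map_one, AlgHom.commutes, invDist, eq_inv_of_mul_eq_one_left h6]
        rfl
      generalize (1 + (P.aa a ^ 2 - P.ab a ^ 2) *
        (Complex.normSq (φ.1 (.inl (P.av L a)) - φ.1 (.inl (P.au a))))⁻¹ : ℝ) = ρ at h5 hinv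
      rw [symElbow, if_pos (show a ∈ S from ha)]
      simp only [map_sub, map_add, map_mul, IOLinkage.evalRat_coordFun, hinv, map_ofNat]
      have h6 := (coords_eq_iff χ.1 (P.elbow a) _).1 h5 i
      rw [h6]
      fin_cases i <;> simp [coords]

theorem isFunctional_linkage (hL : L.IsFunctional 𝕜 F O) (hP : P.IsGood L F) :
    (P.linkage L).IsFunctional 𝕜 F 0 where
  input_mem φ hφ := ((mem_config_linkage_iff.1 hφ).exists_build hL hP).1
  domain := nonempty_interior_dom hL hP
  branched := isBranchedCovering hL hP
  regular := exists_mem_sym hL hP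
  base_mem := ball_subset_domStar hL hP (Metric.mem_ball_self P.R_pos)
  output_eq φ hφ q := by
    have hreal := mem_config_linkage_iff.1 hφ
    obtain ⟨hin, hdom, hlift, -⟩ := hreal.exists_build hL hP
    rw [← hlift.term_out hL hP (fun j => φ (.inl (.inr (.inp j))))]
    exact congrFun (hreal.term_eq hP).1 _

end Plan

/-! ### Extrapolation and the choice of the numerical data -/

/-- Extrapolation of polynomials to `1` from finitely many nodes. -/
theorem exists_extrapolation {N : ℕ} {t : Fin N → ℝ} (ht : Function.Injective t)
    (ht1 : ∀ i, t i ≠ 1) :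
    ∃ c : Fin N → ℝ, (∀ i, c i ≠ 0) ∧ ∀ k < N, ∑ i, c i * t i ^ k = 1 := by
  -- A Lagrange basis polynomial vanishes only at the other nodes, and `1` is not a node;
  -- interpolation on `N` nodes is exact for `X ^ k`, `k < N`.
  refine ⟨fun i => (Lagrange.basis Finset.univ t i).eval 1, fun i => ?_, fun k hk => ?_⟩
  · simp only [Lagrange.basis]
    rw [Polynomial.eval_prod, Finset.prod_ne_zero_iff]
    intro j hj
    have hij : t i ≠ t j := fun h => (Finset.mem_erase.1 hj).1 (ht h).symm
    simp [Lagrange.basisDivisor, sub_eq_zero, hij, (ht1 j).symm]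
  · have h := Lagrange.eq_interpolate (s := Finset.univ) (v := t) (f := Polynomial.X ^ k)
      ht.injOn (by simpa using hk)
    have h1 := congrArg (Polynomial.eval 1) h
    rw [Lagrange.interpolate_apply, Polynomial.eval_finsetSum] at h1
    simp only [Polynomial.eval_pow, Polynomial.eval_X, one_pow, Polynomial.eval_mul,
      Polynomial.eval_C] at h1
    refine Eq.trans ?_ h1.symm
    exact Finset.sum_congr rfl fun i _ => mul_comm _ _

/-- On the homogeneous component of degree `k` the scaling by `t i` is multiplication by `t i ^ k`.
-/
theorem eval_eq_sum_eval_smul {𝕜 κ : Type*} [RCLike 𝕜] {N : ℕ} {c t : Fin N → ℝ}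
    (h : ∀ k < N, ∑ i, c i * t i ^ k = 1) {p : MvPolynomial κ 𝕜} (hp : p.totalDegree < N)
    (x : κ → 𝕜) :
    MvPolynomial.eval x p = ∑ i, c i • MvPolynomial.eval (t i • x) p := by
  have hsum : ∀ y : κ → 𝕜, MvPolynomial.eval y p =
      ∑ k ∈ Finset.range (p.totalDegree + 1), MvPolynomial.eval y (p.homogeneousComponent k) := by
    intro y
    rw [← map_sum, MvPolynomial.sum_homogeneousComponent]
  simp only [hsum, Finset.smul_sum]
  rw [Finset.sum_comm]
  refine Finset.sum_congr rfl fun k hk => ?_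
  have h1 : ∀ i, MvPolynomial.eval (t i • x) (p.homogeneousComponent k) =
      (t i ^ k) • MvPolynomial.eval x (p.homogeneousComponent k) := fun i => by
    have := eval_smul_of_isHomogeneous (MvPolynomial.homogeneousComponent_isHomogeneous k p)
      (t i : 𝕜) x
    rw [RCLike.real_smul_eq_coe_mul, RCLike.ofReal_pow, ← this]
    congr 2
    ext j
    simp [RCLike.real_smul_eq_coe_mul]
  simp only [h1, smul_smul]
  rw [← Finset.sum_smul, h k (by have := Finset.mem_range.1 hk; omega), one_smul]

namespace Plan

/-- A plan with given scaling factors, coefficients and radius. -/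
def ofCoeff {N : ℕ} (τ : Fin N → ℝ) (τ_pos : ∀ i, 0 < τ i) (τ_lt_one : ∀ i, τ i < 1)
    (c : Fin N → ℝ) (c_ne : ∀ i, c i ≠ 0) (R : ℝ) (R_pos : 0 < R) (far bar : ℝ)
    (bar_pos : 0 < bar) : Plan where
  N := N
  τ := τ
  τ_pos := τ_pos
  τ_lt_one := τ_lt_one
  c := Fin.lastCases (motive := fun _ => ℝ) (-1) c
  c_ne := Fin.lastCases (by simp) fun i => by simpa using c_ne i
  -- The partial sums of coefficients, the last one being `-1`, are at least `-(1 + ∑ |c i|)`, so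
  -- all weights are at least `1`.
  μ k := 2 + ∑ i, |c i| + ∑ i : Fin (N + 1),
    if i.castSucc < k then (Fin.lastCases (motive := fun _ => ℝ) (-1) c i : ℝ) else 0
  μ_pos k := by
    have h : ∀ i : Fin (N + 1), -|(Fin.lastCases (motive := fun _ => ℝ) (-1) c i : ℝ)| ≤
        if i.castSucc < k then (Fin.lastCases (motive := fun _ => ℝ) (-1) c i : ℝ) else 0 := by
      intro i
      split_ifs
      · exact neg_abs_le _
      · simp
    have h1 := Finset.sum_le_sum fun i (_ : i ∈ Finset.univ) => h i
    rw [Fin.sum_univ_castSucc] at h1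
    simp only [Fin.lastCases_castSucc, Fin.lastCases_last, Finset.sum_neg_distrib, abs_neg,
      abs_one] at h1
    linarith
  μ_succ k := by
    rw [add_assoc (2 + _)]
    congr 1
    rw [← sub_eq_iff_eq_add', ← Finset.sum_sub_distrib, Finset.sum_eq_single k]
    · simp
    · intro i _ hi
      have h : i.castSucc < k.succ ↔ i.castSucc < k.castSucc := by
        simp only [Fin.lt_def, Fin.val_castSucc, Fin.val_succ]
        have : i.val ≠ k.val := fun h => hi (Fin.ext h)
        omega
      simp [h]
    · simp
  R := R
  R_pos := R_pos
  far := far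
  bar := bar
  bar_pos := bar_pos

variable (P : Plan)

theorem norm_accVal_le {y : Fin (P.N + 1) → ℂ} {Y : ℝ} (hY : ∀ l, ‖y l‖ ≤ Y) (k) :
    ‖∑ i : Fin (P.N + 1), if i.castSucc < k then P.c i • y i else 0‖ ≤ (∑ i, |P.c i|) * Y := by
  have hY0 : 0 ≤ Y := (norm_nonneg _).trans (hY 0)
  rw [Finset.sum_mul]
  refine norm_sum_le_of_le _ fun i _ => ?_
  split_ifs
  · rw [norm_smul, Real.norm_eq_abs]
    exact mul_le_mul_of_nonneg_left (hY i) (abs_nonneg _)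
  · simpa using mul_nonneg (abs_nonneg (P.c i)) hY0

/-- If the chain starts far enough away, the initial term dominates and every partial sum has norm
at least `Y + 1`, hence differs from all summands. The norms are also bounded, so long bars reach.
Both choices depend only on the bound `Y`. -/
theorem exists_far_bar {Y : ℝ} (hY0 : 0 ≤ Y) : ∃ far bar : ℝ, 0 < bar ∧
    ∀ y : Fin (P.N + 1) → ℂ, (∀ l, ‖y l‖ ≤ Y) → ∀ k l,
      0 < ‖P.accVal (far : ℂ) y k - y l‖ ∧ ‖P.accVal (far : ℂ) y k - y l‖ < 2 * bar := by
  have hM : ∀ k, P.μ k ≤ ∑ k, P.μ k := fun k =>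
    Finset.single_le_sum (fun i _ => (P.μ_pos i).le) (Finset.mem_univ k)
  have hW : ∀ k, (P.μ k)⁻¹ ≤ ∑ k, (P.μ k)⁻¹ := fun k =>
    Finset.single_le_sum (f := fun k => (P.μ k)⁻¹) (fun i _ => (inv_pos.2 (P.μ_pos i)).le)
      (Finset.mem_univ k)
  have hC0 : 0 ≤ ∑ i, |P.c i| := Finset.sum_nonneg fun i _ => abs_nonneg _
  set C := ∑ i, |P.c i|
  set M := ∑ k, P.μ k
  set W := ∑ k, (P.μ k)⁻¹
  have hM0 : 0 < M := (P.μ_pos 0).trans_le (hM 0)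
  have hW0 : 0 < W := (inv_pos.2 (P.μ_pos 0)).trans_le (hW 0)
  have hfar : 0 ≤ C * Y + M * (Y + 1) := by positivity
  refine ⟨(P.μ 0)⁻¹ * (C * Y + M * (Y + 1)), W * (C * Y + M * (Y + 1) + C * Y) + Y + 1,
    by positivity, fun y hy k l => ?_⟩
  have hS := P.norm_accVal_le hy k
  rw [accVal]
  set S := ∑ i : Fin (P.N + 1), if i.castSucc < k then P.c i • y i else 0
  have hμ := P.μ_pos k
  have e1 : P.μ 0 • (((P.μ 0)⁻¹ * (C * Y + M * (Y + 1)) : ℝ) : ℂ) =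
      ((C * Y + M * (Y + 1) : ℝ) : ℂ) := by
    rw [Complex.real_smul, ← Complex.ofReal_mul, mul_inv_cancel_left₀ (P.μ_pos 0).ne']
  have e2 : ‖((C * Y + M * (Y + 1) : ℝ) : ℂ)‖ = C * Y + M * (Y + 1) := by
    rw [Complex.norm_real, Real.norm_of_nonneg hfar]
  rw [e1]
  have h1 := norm_sub_le ((C * Y + M * (Y + 1) : ℝ) + S) S
  rw [add_sub_cancel_right, e2] at h1
  have h2 := norm_add_le ((C * Y + M * (Y + 1) : ℝ) : ℂ) S
  rw [e2] at h2
  have h3 : ‖(P.μ k)⁻¹ • (((C * Y + M * (Y + 1) : ℝ) : ℂ) + S)‖ =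
      (P.μ k)⁻¹ * ‖((C * Y + M * (Y + 1) : ℝ) : ℂ) + S‖ := by
    rw [norm_smul, Real.norm_of_nonneg (inv_nonneg.2 hμ.le)]
  have h4 : Y + 1 ≤ ‖(P.μ k)⁻¹ • (((C * Y + M * (Y + 1) : ℝ) : ℂ) + S)‖ := by
    rw [h3, inv_mul_eq_div, le_div_iff₀ hμ]
    have := mul_le_mul_of_nonneg_right (hM k) (by positivity : 0 ≤ Y + 1)
    linarith
  have h5 : ‖(P.μ k)⁻¹ • (((C * Y + M * (Y + 1) : ℝ) : ℂ) + S)‖ ≤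
      W * (C * Y + M * (Y + 1) + C * Y) := by
    rw [h3]
    exact mul_le_mul (hW k) (by linarith) (norm_nonneg _) hW0.le
  have h6 := norm_sub_norm_le ((P.μ k)⁻¹ • (((C * Y + M * (Y + 1) : ℝ) : ℂ) + S)) (y l)
  have h7 := norm_sub_le ((P.μ k)⁻¹ • (((C * Y + M * (Y + 1) : ℝ) : ℂ) + S)) (y l)
  have h8 := hy l
  have h9 : 0 ≤ W * (C * Y + M * (Y + 1) + C * Y) := (norm_nonneg _).trans h5
  constructor <;> linarith

end Plan

/-! ### Existence of good data -/

section Existence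

variable {V : Type*} [Fintype V] {m n : ℕ} {L : IOLinkage V m n} {𝕜 : Type*} [RCLike 𝕜]

theorem continuous_polyMap (f : Fin n → MvPolynomial (Fin m) 𝕜) : Continuous (polyMap f) := by
  refine (PiLp.continuous_toLp 2 _).comp (continuous_pi fun q => ?_)
  exact (MvPolynomial.continuous_eval (f q)).comp (PiLp.continuous_ofLp 2 _)

theorem exists_isGood {f : Fin n → MvPolynomial (Fin m) 𝕜} (hL : L.IsFunctional 𝕜 (polyMap f) 0)
    {R : ℝ} (hR : 0 < R) : ∃ P : Plan, P.R = R ∧ P.IsGood L (polyMap f) := by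
  obtain ⟨ε, hε, hball⟩ := hL.exists_ball
  obtain ⟨B, hB0, hB⟩ :=
    (Plan.isCompact_polydisc (𝕜 := 𝕜) (m := m) (5 * R)).isBounded.exists_pos_norm_le
  obtain ⟨N, hN0, hN⟩ : ∃ N : ℕ, 0 < N ∧ ∀ q, (f q).totalDegree < N :=
    ⟨(Finset.univ.sup fun q => (f q).totalDegree) + 1, Nat.succ_pos _, fun q =>
      Nat.lt_succ_of_le (Finset.le_sup (f := fun q => (f q).totalDegree) (Finset.mem_univ q))⟩
  -- The bound `η ≤ 1 / 2` keeps the ratios below `1`, and `η B < ε` brings the rescaled inputs into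
  -- the ball over which all realizations of `L` are regular. The ratios `η / (i + 1)` are distinct.
  set η := min (1 / 2) (ε / (2 * B))
  have hη : 0 < η := by positivity
  have hη1 : η ≤ 1 / 2 := min_le_left _ _
  have hηB : η * B < ε := by
    have h1 : η ≤ ε / (2 * B) := min_le_right _ _
    have h2 := mul_le_mul_of_nonneg_right h1 hB0.le
    have h3 : ε / (2 * B) * B = ε / 2 := by field_simp
    linarith
  let τ : Fin N → ℝ := fun i => η / (i + 1)
  have τ_pos : ∀ i, 0 < τ i := fun i => by positivity
  have τ_le : ∀ i, τ i ≤ η := fun i => div_le_self hη.le (by simp)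
  have τ_lt : ∀ i, τ i < 1 := fun i => (τ_le i).trans_lt (by linarith)
  have ht_inj : Function.Injective fun i => τ i ^ 2 := fun i j h => by
    have h1 : τ i = τ j := (sq_eq_sq₀ (τ_pos i).le (τ_pos j).le).1 h
    have h2 : ((i : ℕ) : ℝ) + 1 = (j : ℕ) + 1 := by
      have h3 : ((i : ℕ) : ℝ) + 1 ≠ 0 := by positivity
      have h4 : ((j : ℕ) : ℝ) + 1 ≠ 0 := by positivity
      have h5 := (div_eq_div_iff h3 h4).1 h1
      exact (mul_left_cancel₀ hη.ne' h5).symm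
    exact Fin.ext (by exact_mod_cast add_right_cancel h2)
  have ht_lt : ∀ i, τ i ^ 2 < 1 := fun i => pow_lt_one₀ (τ_pos i).le (τ_lt i) two_ne_zero
  obtain ⟨c, hc0, hc⟩ := exists_extrapolation ht_inj fun i => (ht_lt i).ne
  -- Provisional values for `far` and `bar`: the coefficients and weights, from which the final
  -- values are found, do not depend on them.
  let P₀ := Plan.ofCoeff τ τ_pos τ_lt c hc0 R hR 0 1 one_pos
  have hmem : ∀ x : EuclideanSpace 𝕜 (Fin m), (∀ j, ‖x j‖ ≤ 5 * R) → ∀ i,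
      τ i ^ 2 • x ∈ Metric.ball 0 ε := fun x hx i => by
    rw [mem_ball_zero_iff, norm_smul, Real.norm_of_nonneg (by positivity)]
    have h1 : τ i ^ 2 ≤ η := by nlinarith [τ_le i, τ_lt i, τ_pos i]
    exact (mul_le_mul h1 (hB x hx) (norm_nonneg _) hη.le).trans_lt hηB
  obtain ⟨Y, hY0, hY⟩ : ∃ Y : ℝ, 0 ≤ Y ∧ ∀ x : EuclideanSpace 𝕜 (Fin m), (∀ j, ‖x j‖ ≤ 5 * R) →
      ∀ q l, ‖P₀.sumVal (fun i => toComplex (polyMap f (τ i ^ 2 • x) q)) l‖ ≤ Y := by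
    have hcpt : IsCompact (closure (Metric.ball (0 : EuclideanSpace 𝕜 (Fin m)) ε)) :=
      Metric.isBounded_ball.isCompact_closure
    obtain ⟨D, hD0, hD⟩ := (hcpt.image (continuous_polyMap f)).isBounded.exists_pos_norm_le
    have h1 : ∀ x : EuclideanSpace 𝕜 (Fin m), (∀ j, ‖x j‖ ≤ 5 * R) → ∀ i q,
        ‖toComplex (polyMap f (τ i ^ 2 • x) q)‖ ≤ D := fun x hx i q => by
      rw [norm_toComplex]
      exact (PiLp.norm_apply_le _ q).trans
        (hD _ ⟨_, subset_closure (hmem x hx i), rfl⟩)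
    refine ⟨D + (∑ i, |c i|) * D, by positivity, fun x hx q l => ?_⟩
    refine Fin.lastCases ?_ (fun i => ?_) l
    · rw [Plan.sumVal, Fin.lastCases_last]
      refine (norm_sum_le_of_le (n := fun i => |c i| * D) _ fun i _ => ?_).trans ?_
      · rw [norm_smul, Real.norm_eq_abs]
        refine mul_le_mul (le_of_eq ?_) (h1 x hx i q) (norm_nonneg _) (abs_nonneg _)
        simp [P₀, Plan.ofCoeff]
      · exact (Finset.sum_mul _ _ _).symm.le.trans (le_add_of_nonneg_left hD0.le)
    · rw [Plan.sumVal, Fin.lastCases_castSucc]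
      exact (h1 x hx i q).trans (le_add_of_nonneg_right (by positivity))
  obtain ⟨far, bar, hbar, hnd⟩ := P₀.exists_far_bar hY0
  refine ⟨Plan.ofCoeff τ τ_pos τ_lt c hc0 R hR far bar hbar, rfl, hN0, ?_, ?_, ?_, ?_, ?_, ?_⟩
  · simp [Plan.ofCoeff]
  -- The case `k = 0` says `∑ c i = 1`, which together with the last coefficient `-1` makes the
  -- weights return to their initial value.
  · have h1 := hc 0 hN0
    simp only [pow_zero, mul_one] at h1
    simp only [Plan.ofCoeff, Fin.castSucc_lt_last, if_true]
    rw [Fin.sum_univ_castSucc, Finset.sum_eq_zero fun i _ => if_neg i.castSucc.not_lt_zero]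
    simp [h1]
  · exact fun x hx i => (hball _ (hmem x hx i)).1
  · exact fun x hx i => (hball _ (hmem x hx i)).2
  · intro x q
    have h1 := eval_eq_sum_eval_smul hc (hN q) x.ofLp
    simp only [Plan.ofCoeff, Fin.lastCases_castSucc]
    exact h1
  · exact fun x hx q k l => hnd _ (hY x hx q) k l

end Existence
end Linkages

end

theorem mainTheorem10 {𝕜 : Type*} [RCLike 𝕜] {m n : ℕ} (f : Fin n → MvPolynomial (Fin m) 𝕜)
    {V : Type*} [Fintype V] (L : Linkages.IOLinkage V m n)
    (hL : L.IsFunctional 𝕜 (Linkages.polyMap f) 0) (r : ℝ) (hr : 0 < r) :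
    ∃ (V' : Type) (_ : Fintype V') (L' : Linkages.IOLinkage V' m n) (ι : V ↪ V'),
      L.IsSublinkage L' ι ∧
      L'.IsFunctional 𝕜 (Linkages.polyMap f) 0 ∧
      Metric.closedBall (0 : EuclideanSpace 𝕜 (Fin m)) r ⊆ L'.DomStar 𝕜 := by
  -- Only the open ball of radius `R` is regular, since the limiting arms are tangent to the circle
  -- of radius `R`; a larger radius covers the closed ball.
  obtain ⟨P, hPR, hP⟩ := Linkages.exists_isGood hL (R := r + 1) (by linarith)
  refine ⟨P.Vtx (V := V) (m := m) (n := n), inferInstance, P.linkage L, _,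
    P.isSublinkage L ⟨0, hP.N_pos⟩, Linkages.Plan.isFunctional_linkage hL hP,
    fun x hx => Linkages.Plan.ball_subset_domStar hL hP ?_⟩
  rw [hPR, mem_ball_zero_iff]
  exact (mem_closedBall_zero_iff.1 hx).trans_lt (lt_add_one r)
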